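/- Let $\tilde L$ be a locally conformal almost cosymplectic manifold: a smooth manifold with an almost contact metric structure $(\Phi,\xi,\eta,g)$, that is, $\Phi^2=-I+\eta\otimes\xi$, $\eta(\xi)=1$, $\Phi\xi=0$, $\eta\circ\Phi=0$, $g(\Phi X,\Phi Y)=g(X,Y)-\eta(X)\eta(Y)$, and a smooth function $\beta$ on $\tilde L$ such that, for the Levi-Civita connection $\tilde\nabla$ of $g$ and all vector fields $X,Y$, $$(\tilde\nabla_X\Phi)Y=\beta\,\bigl(g(\Phi X,Y)\xi-\eta(Y)\Phi X\bigr),\qquad \tilde\nabla_X\xi=\beta\,(X-\eta(X)\xi).$$ Let $L_T,L_\perp,L_\nu$ be Riemannian manifolds with $\dim L_\perp=t_2\ge 1$ and $\dim L_\nu=2t_3\ge 2$, let $\phi_1,\phi_2:L_T\to(0,\infty)$ be smooth, and let $L=L_T\times_{\phi_1}L_\perp\times_{\phi_2}L_\nu$ be the bi-warped product, i.e. $L_T\times L_\perp\times L_\nu$ with the metric $\pi_1^*g_T+(\phi_1\circ\pi_1)^2\pi_2^*g_\perp+(\phi_2\circ\pi_1)^2\pi_3^*g_\nu$. Let $L$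 be isometrically immersed in $\tilde L$, with second fundamental form $\Sigma$, and write $\mathfrak D,\mathfrak D^\perp,\mathfrak D^\nu$ for the distributions on $L$ tangent to the copies of $L_T,L_\perp,L_\nu$. Assume that * $\xi$ is tangent to $L_T$ (along $L$, $\xi$ lies in $\mathfrak D$), and $L_T$ is invariant: $\Phi\mathfrak D\subset\mathfrak D$; * $L_\perp$ is anti-invariant: $\Phi\mathfrak D^\perp\subset T^\perp L$; * $L_\nu$ is proper slant with slant angle $\nu\in(0,\pi/2)$: for every nonzero $Z\in\mathfrak D^\nu$ the angle between $\Phi Z$ and $\mathfrak D^\nu$ is $\nu$; * $L$ is $\mathfrak D^\perp$–$\mathfrak D^\nu$ mixed totally geodesic: $\Sigma(V,Z)=0$ for $V\in\mathfrak D^\perp$, $Z\in\mathfrak D^\nu$. Let $\|\Sigma\|^2=\sum_{i,j}g(\Sigma(e_i,e_j),\Sigma(e_i,e_j))$ for an orthonormal frame $(e_i)$ of $TL$, and let $\nabla\ln\phi_i$ be the gradient of $\ln\phi_i$ on $L_T$. Then: (i) At every point of $L$, $$\|\Sigma\|^2\ \ge\ 2t_2\bigl(\|\nabla\ln\phi_1\|^2-\beta^2\bigr)+4t_3\csc^2\nu\,\bigl(\sin^2\nu+2\cos^2\nu\bigr)\bigl(\|\nabla\ln\phi_2\|^2-\beta^2\bigr).$$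 (ii) If equality holds in (i) at every point of $L$, then every copy of $L_T$ in $L$ is a totally geodesic submanifold of $\tilde L$, and every copy of $L_\perp$ and every copy of $L_\nu$ is a totally umbilical submanifold of $\tilde L$, with mean curvature vector $-\nabla\ln\phi_1$ and $-\nabla\ln\phi_2$ respectively (regarded as vectors tangent to $L_T$). -/

import Mathlib

open Bundle Manifold
open scoped ContDiff

noncomputable section

section AmbientGeometry

variable {E : Type*} [NormedAddCommGroup E] [NormedSpace ℝ E]
  {H : Type*} [TopologicalSpace H] {I : ModelWithCorners ℝ E H}
  {M : Type*} [TopologicalSpace M] [ChartedSpace H M]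

/-- The gradient of a real function `h` on a Riemannian manifold: the tangent vector that
represents the differential of `h` at `x` with respect to the metric. -/
def riemGrad [FiniteDimensional ℝ E] [RiemannianBundle (fun x : M ↦ TangentSpace I x)]
    (h : M → ℝ) (x : M) : TangentSpace I x :=
  haveI : FiniteDimensional ℝ (TangentSpace I x) := inferInstanceAs (FiniteDimensional ℝ E)
  haveI : CompleteSpace (TangentSpace I x) := FiniteDimensional.complete ℝ _
  (InnerProductSpace.toDual ℝ (TangentSpace I x)).symm (mvfderiv I h x)

/-- `nabla` is the Levi-Civita connection of the Riemannian metric: it is compatible with the metric,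
`X g(Y, Z) = g(∇_X Y, Z) + g(Y, ∇_X Z)`, and torsion-free. In Mathlib `nabla Y x X` is `∇_X Y`
at `x`. -/
structure IsLeviCivita [FiniteDimensional ℝ E] [IsManifold I ∞ M]
    [RiemannianBundle (fun x : M ↦ TangentSpace I x)]
    (nabla : CovariantDerivative I E (TangentSpace I : M → Type _)) : Prop where
  metric : ∀ (x : M) (X : TangentSpace I x) (Y Z : ∀ y : M, TangentSpace I y),
    MDifferentiableAt I (I.prod 𝓘(ℝ, E)) (fun y ↦ TotalSpace.mk' E y (Y y)) x →
    MDifferentiableAt I (I.prod 𝓘(ℝ, E)) (fun y ↦ TotalSpace.mk' E y (Z y)) x →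
    mvfderiv I (fun y ↦ (inner ℝ (Y y) (Z y) : ℝ)) x X =
      inner ℝ (nabla Y x X) (Z x) + inner ℝ (Y x) (nabla Z x X)
  torsionFree : nabla.torsion = 0

/-- `(Phi, xi, eta, g)` is an almost contact metric structure. -/
structure IsAlmostContactMetric [IsManifold I ∞ M]
    [RiemannianBundle (fun x : M ↦ TangentSpace I x)]
    (Phi : ∀ x : M, TangentSpace I x →L[ℝ] TangentSpace I x)
    (xi : ∀ x : M, TangentSpace I x)
    (eta : ∀ x : M, TangentSpace I x →L[ℝ] ℝ) : Prop where
  smooth_Phi : ContMDiff I (I.prod 𝓘(ℝ, E →L[ℝ] E)) ∞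
    (fun x ↦ TotalSpace.mk' (E →L[ℝ] E)
      (E := fun x : M ↦ TangentSpace I x →L[ℝ] TangentSpace I x) x (Phi x))
  smooth_xi : ContMDiff I (I.prod 𝓘(ℝ, E)) ∞
    (fun x ↦ TotalSpace.mk' E (E := fun x : M ↦ TangentSpace I x) x (xi x))
  smooth_eta : ContMDiff I (I.prod 𝓘(ℝ, E →L[ℝ] ℝ)) ∞
    (fun x ↦ TotalSpace.mk' (E →L[ℝ] ℝ)
      (E := fun x : M ↦ TangentSpace I x →L[ℝ] Bundle.Trivial M ℝ x) x (eta x))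
  Phi_sq : ∀ (x : M) (X : TangentSpace I x), Phi x (Phi x X) = -X + eta x X • xi x
  eta_xi : ∀ x : M, eta x (xi x) = 1
  Phi_xi : ∀ x : M, Phi x (xi x) = 0
  eta_Phi : ∀ (x : M) (X : TangentSpace I x), eta x (Phi x X) = 0
  inner_Phi : ∀ (x : M) (X Y : TangentSpace I x),
    inner ℝ (Phi x X) (Phi x Y) = inner ℝ X Y - eta x X * eta x Y

/-- A locally conformal almost cosymplectic structure with function `beta`: an almost contact
metric structure with `(∇_X Φ) Y = β (g(Φ X, Y) ξ - η(Y) Φ X)` and `∇_X ξ = β (X - η(X) ξ)`,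
where `(∇_X Φ) Y = ∇_X (Φ Y) - Φ (∇_X Y)`. -/
structure IsLocConfAlmostCosymplectic [IsManifold I ∞ M]
    [RiemannianBundle (fun x : M ↦ TangentSpace I x)]
    (nabla : CovariantDerivative I E (TangentSpace I : M → Type _))
    (Phi : ∀ x : M, TangentSpace I x →L[ℝ] TangentSpace I x)
    (xi : ∀ x : M, TangentSpace I x)
    (eta : ∀ x : M, TangentSpace I x →L[ℝ] ℝ) (beta : M → ℝ) : Prop
    extends IsAlmostContactMetric Phi xi eta where
  smooth_beta : ContMDiff I 𝓘(ℝ, ℝ) ∞ beta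
  nabla_Phi : ∀ (x : M) (X : TangentSpace I x) (Y : ∀ y : M, TangentSpace I y),
    MDifferentiableAt I (I.prod 𝓘(ℝ, E)) (fun y ↦ TotalSpace.mk' E y (Y y)) x →
    nabla (fun y ↦ Phi y (Y y)) x X - Phi x (nabla Y x X) =
      beta x • ((inner ℝ (Phi x X) (Y x) : ℝ) • xi x - eta x (Y x) • Phi x X)
  nabla_xi : ∀ (x : M) (X : TangentSpace I x),
    nabla xi x X = beta x • (X - eta x X • xi x)

end AmbientGeometry

section Submanifolds

variable {E : Type*} [NormedAddCommGroup E] [NormedSpace ℝ E]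
  {H : Type*} [TopologicalSpace H] {I : ModelWithCorners ℝ E H}
  {M : Type*} [TopologicalSpace M] [ChartedSpace H M] [IsManifold I ∞ M]
  {E' : Type*} [NormedAddCommGroup E'] [NormedSpace ℝ E']
  {H' : Type*} [TopologicalSpace H'] (J : ModelWithCorners ℝ E' H')
  {N : Type*} [TopologicalSpace N] [ChartedSpace H' N] [IsManifold J ∞ N]

/-- The covariant derivative along a map `F : N → M` of a vector field `W` along `F`, at `p` in the
direction `u`. In the local frame of `TM` around `F p` given by the preferred trivialization write
`W = ∑ Wⁱ (eᵢ ∘ F)`; the value is `∑ dWⁱ(u) eᵢ + ∑ Wⁱ(p) ∇_{dF u} eᵢ`. The second sum is the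
derivative of the section `FiberBundle.extend E (W p)`, which has constant coefficients `Wⁱ(p)`. -/
def covDerivAlong (nabla : CovariantDerivative I E (TangentSpace I : M → Type _))
    (F : N → M) (W : ∀ q : N, TangentSpace I (F q)) (p : N) (u : TangentSpace J p) :
    TangentSpace I (F p) :=
  (trivializationAt E (TangentSpace I : M → Type _) (F p)).symm (F p)
      (mvfderiv J (fun q ↦ (trivializationAt E (TangentSpace I : M → Type _) (F p)
        (TotalSpace.mk' E (F q) (W q))).2) p u)
    + nabla (FiberBundle.extend E (W p)) (F p) (mfderiv J I F p u)

/-- The tangent space of the immersed submanifold `F : N → M` at `p`, inside `T_{F p} M`. -/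
def immTangent (F : N → M) (p : N) : Submodule ℝ (TangentSpace I (F p)) :=
  LinearMap.range (mfderiv J I F p).toLinearMap

variable [FiniteDimensional ℝ E'] [RiemannianBundle (fun x : M ↦ TangentSpace I x)]

instance immTangent_finiteDimensional (F : N → M) (p : N) :
    FiniteDimensional ℝ (immTangent (I := I) J F p) :=
  haveI : FiniteDimensional ℝ (TangentSpace J p) := inferInstanceAs (FiniteDimensional ℝ E')
  LinearMap.finiteDimensional_range _

/-- The second fundamental form of the immersed submanifold `F : N → M` (Gauss formula): the
component normal to `N` of `∇_u (dF v)`, where `v` is extended to a local vector field on `N`. -/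
def secondFF (nabla : CovariantDerivative I E (TangentSpace I : M → Type _))
    (F : N → M) (p : N) (u v : TangentSpace J p) : TangentSpace I (F p) :=
  let D := covDerivAlong J nabla F (fun q ↦ mfderiv J I F q (FiberBundle.extend E' v q)) p u
  D - (immTangent (I := I) J F p).starProjection D

/-- An orthonormal frame of the tangent space of the submanifold, as vectors of `T_p N`. -/
def tangentFrame (F : N → M) (p : N)
    (i : Fin (Module.finrank ℝ (immTangent (I := I) J F p))) : TangentSpace J p :=
  (stdOrthonormalBasis ℝ (immTangent (I := I) J F p) i).2.choose

/-- The squared norm `∑ᵢⱼ g(Σ(eᵢ, eⱼ), Σ(eᵢ, eⱼ))` of the second fundamental form. -/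
def secondFFNormSq (nabla : CovariantDerivative I E (TangentSpace I : M → Type _))
    (F : N → M) (p : N) : ℝ :=
  ∑ i, ∑ j, (inner ℝ
    (secondFF J nabla F p (tangentFrame (I := I) J F p i) (tangentFrame (I := I) J F p j))
    (secondFF J nabla F p (tangentFrame (I := I) J F p i) (tangentFrame (I := I) J F p j)) : ℝ)

/-- The mean curvature vector `(1/n) ∑ᵢ Σ(eᵢ, eᵢ)`. -/
def meanCurvature (nabla : CovariantDerivative I E (TangentSpace I : M → Type _))
    (F : N → M) (p : N) : TangentSpace I (F p) :=
  ((Module.finrank ℝ (immTangent (I := I) J F p) : ℝ)⁻¹) •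
    ∑ i, secondFF J nabla F p (tangentFrame (I := I) J F p i) (tangentFrame (I := I) J F p i)

/-- The submanifold is totally geodesic: its second fundamental form vanishes. -/
def IsTotallyGeodesic (nabla : CovariantDerivative I E (TangentSpace I : M → Type _))
    (F : N → M) : Prop :=
  ∀ (p : N) (u v : TangentSpace J p), secondFF J nabla F p u v = 0

/-- The submanifold is totally umbilical: `Σ(u, v) = g(u, v) H`, `H` the mean curvature vector. -/
def IsTotallyUmbilical (nabla : CovariantDerivative I E (TangentSpace I : M → Type _))
    (F : N → M) : Prop :=
  ∀ (p : N) (u v : TangentSpace J p), secondFF J nabla F p u v =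
    (inner ℝ (mfderiv J I F p u) (mfderiv J I F p v) : ℝ) • meanCurvature J nabla F p

end Submanifolds

section BiWarped

variable {E₁ : Type*} [NormedAddCommGroup E₁] [NormedSpace ℝ E₁]
  {H₁ : Type*} [TopologicalSpace H₁] (I₁ : ModelWithCorners ℝ E₁ H₁)
  {L₁ : Type*} [TopologicalSpace L₁] [ChartedSpace H₁ L₁]
  {E₂ : Type*} [NormedAddCommGroup E₂] [NormedSpace ℝ E₂]
  {H₂ : Type*} [TopologicalSpace H₂] (I₂ : ModelWithCorners ℝ E₂ H₂)
  {L₂ : Type*} [TopologicalSpace L₂] [ChartedSpace H₂ L₂]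
  {E₃ : Type*} [NormedAddCommGroup E₃] [NormedSpace ℝ E₃]
  {H₃ : Type*} [TopologicalSpace H₃] (I₃ : ModelWithCorners ℝ E₃ H₃)
  {L₃ : Type*} [TopologicalSpace L₃] [ChartedSpace H₃ L₃]

/-- The model of the product manifold `L₁ × L₂ × L₃`. -/
abbrev model₃ := I₁.prod (I₂.prod I₃)

/-- Differential of the projection `L₁ × L₂ × L₃ → L₁`. -/
def dpr₁ (p : L₁ × L₂ × L₃) :
    TangentSpace (model₃ I₁ I₂ I₃) p →L[ℝ] TangentSpace I₁ p.1 :=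
  mfderiv (model₃ I₁ I₂ I₃) I₁ (fun q : L₁ × L₂ × L₃ ↦ q.1) p

/-- Differential of the projection `L₁ × L₂ × L₃ → L₂`. -/
def dpr₂ (p : L₁ × L₂ × L₃) :
    TangentSpace (model₃ I₁ I₂ I₃) p →L[ℝ] TangentSpace I₂ p.2.1 :=
  mfderiv (model₃ I₁ I₂ I₃) I₂ (fun q : L₁ × L₂ × L₃ ↦ q.2.1) p

/-- Differential of the projection `L₁ × L₂ × L₃ → L₃`. -/
def dpr₃ (p : L₁ × L₂ × L₃) :
    TangentSpace (model₃ I₁ I₂ I₃) p →L[ℝ] TangentSpace I₃ p.2.2 :=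
  mfderiv (model₃ I₁ I₂ I₃) I₃ (fun q : L₁ × L₂ × L₃ ↦ q.2.2) p

/-- The distribution on `L₁ × L₂ × L₃` tangent to the copies of `L₁`. -/
def dist₁ (p : L₁ × L₂ × L₃) : Submodule ℝ (TangentSpace (model₃ I₁ I₂ I₃) p) :=
  LinearMap.ker (dpr₂ I₁ I₂ I₃ p).toLinearMap ⊓ LinearMap.ker (dpr₃ I₁ I₂ I₃ p).toLinearMap

/-- The distribution on `L₁ × L₂ × L₃` tangent to the copies of `L₂`. -/
def dist₂ (p : L₁ × L₂ × L₃) : Submodule ℝ (TangentSpace (model₃ I₁ I₂ I₃) p) :=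
  LinearMap.ker (dpr₁ I₁ I₂ I₃ p).toLinearMap ⊓ LinearMap.ker (dpr₃ I₁ I₂ I₃ p).toLinearMap

/-- The distribution on `L₁ × L₂ × L₃` tangent to the copies of `L₃`. -/
def dist₃ (p : L₁ × L₂ × L₃) : Submodule ℝ (TangentSpace (model₃ I₁ I₂ I₃) p) :=
  LinearMap.ker (dpr₁ I₁ I₂ I₃ p).toLinearMap ⊓ LinearMap.ker (dpr₂ I₁ I₂ I₃ p).toLinearMap

variable {E : Type*} [NormedAddCommGroup E] [NormedSpace ℝ E]
  {H : Type*} [TopologicalSpace H] (I : ModelWithCorners ℝ E H)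
  {M : Type*} [TopologicalSpace M] [ChartedSpace H M]
  [RiemannianBundle (fun x : M ↦ TangentSpace I x)]

/-- `F` is an isometric immersion into `M` of the bi-warped product `L₁ ×_{f₁} L₂ ×_{f₂} L₃`: the
metric induced by `F` is `π₁^* g₁ + (f₁ ∘ π₁)² π₂^* g₂ + (f₂ ∘ π₁)² π₃^* g₃`, with positive smooth
`f₁, f₂ : L₁ → ℝ`. (The differential of `F` is then automatically injective.) -/
structure IsBiWarpedImmersion
    [RiemannianBundle (fun x : L₁ ↦ TangentSpace I₁ x)]
    [RiemannianBundle (fun x : L₂ ↦ TangentSpace I₂ x)]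
    [RiemannianBundle (fun x : L₃ ↦ TangentSpace I₃ x)]
    (f₁ f₂ : L₁ → ℝ) (F : L₁ × L₂ × L₃ → M) : Prop where
  smooth : ContMDiff (model₃ I₁ I₂ I₃) I ∞ F
  smooth_f₁ : ContMDiff I₁ 𝓘(ℝ, ℝ) ∞ f₁
  smooth_f₂ : ContMDiff I₁ 𝓘(ℝ, ℝ) ∞ f₂
  pos_f₁ : ∀ x, 0 < f₁ x
  pos_f₂ : ∀ x, 0 < f₂ x
  isometric : ∀ (p : L₁ × L₂ × L₃) (u v : TangentSpace (model₃ I₁ I₂ I₃) p),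
    (inner ℝ (mfderiv (model₃ I₁ I₂ I₃) I F p u) (mfderiv (model₃ I₁ I₂ I₃) I F p v) : ℝ) =
      inner ℝ (dpr₁ I₁ I₂ I₃ p u) (dpr₁ I₁ I₂ I₃ p v)
      + f₁ p.1 ^ 2 * inner ℝ (dpr₂ I₁ I₂ I₃ p u) (dpr₂ I₁ I₂ I₃ p v)
      + f₂ p.1 ^ 2 * inner ℝ (dpr₃ I₁ I₂ I₃ p u) (dpr₃ I₁ I₂ I₃ p v)

/-- The copies of `L₁` are invariant under `Phi`. -/
def IsInvariant₁ (Phi : ∀ x : M, TangentSpace I x →L[ℝ] TangentSpace I x)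
    (F : L₁ × L₂ × L₃ → M) : Prop :=
  ∀ (p : L₁ × L₂ × L₃), ∀ u ∈ dist₁ I₁ I₂ I₃ p, ∃ w ∈ dist₁ I₁ I₂ I₃ p,
    Phi (F p) (mfderiv (model₃ I₁ I₂ I₃) I F p u) = mfderiv (model₃ I₁ I₂ I₃) I F p w

/-- The vector field `xi` is, along `F`, tangent to the copies of `L₁`. -/
def IsTangent₁ (xi : ∀ x : M, TangentSpace I x) (F : L₁ × L₂ × L₃ → M) : Prop :=
  ∀ p : L₁ × L₂ × L₃, ∃ u ∈ dist₁ I₁ I₂ I₃ p, mfderiv (model₃ I₁ I₂ I₃) I F p u = xi (F p)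

/-- The distribution tangent to the copies of `L₂` is anti-invariant: `Phi` maps it into the
normal bundle of the submanifold. -/
def IsAntiInvariant₂ (Phi : ∀ x : M, TangentSpace I x →L[ℝ] TangentSpace I x)
    (F : L₁ × L₂ × L₃ → M) : Prop :=
  ∀ (p : L₁ × L₂ × L₃), ∀ u ∈ dist₂ I₁ I₂ I₃ p, ∀ w : TangentSpace (model₃ I₁ I₂ I₃) p,
    (inner ℝ (Phi (F p) (mfderiv (model₃ I₁ I₂ I₃) I F p u))
      (mfderiv (model₃ I₁ I₂ I₃) I F p w) : ℝ) = 0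

/-- The copies of `L₃` are slant with angle `nu`: for every nonzero tangent vector `u` of such a
copy, the angle between `Phi u` and the tangent space of the copy, that is, between `Phi u` and
its orthogonal projection to this space, is `nu`. -/
def IsSlant₃ [FiniteDimensional ℝ E]
    (Phi : ∀ x : M, TangentSpace I x →L[ℝ] TangentSpace I x) (nu : ℝ)
    (F : L₁ × L₂ × L₃ → M) : Prop :=
  ∀ (p : L₁ × L₂ × L₃), ∀ u ∈ dist₃ I₁ I₂ I₃ p, u ≠ 0 →
    haveI : FiniteDimensional ℝ (TangentSpace I (F p)) := inferInstanceAs (FiniteDimensional ℝ E)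
    InnerProductGeometry.angle (Phi (F p) (mfderiv (model₃ I₁ I₂ I₃) I F p u))
      (((dist₃ I₁ I₂ I₃ p).map (mfderiv (model₃ I₁ I₂ I₃) I F p).toLinearMap).starProjection
        (Phi (F p) (mfderiv (model₃ I₁ I₂ I₃) I F p u))) = nu

end BiWarped

end

/-!
# The second fundamental form of a bi-warped submanifold

Let `B(u, v) = ∇_u (dF v)` be the second derivative of the immersion `F`, computed with coordinate
fields of the product (`mapHessian`). It is bilinear and symmetric because `∇` is torsion-free, and
its component normal to `F` is the second fundamental form `Σ`. Two sources of information
determine the mixed components of `Σ`.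

* The Koszul formula (`two_mul_inner_mapHessian`) applied to the bi-warped metric gives the tangential
  part of `B`: for `X` tangent to the first factor and `V`, `W` tangent to the factor with warping
  function `f`, `⟪B(X, V), ·⟫ = (X ln f) ⟪V, ·⟫` and `⟪B(V, W), X⟫ = -(X ln f) ⟪V, W⟫`.
* The relations `⟪Φ X, W⟫ = 0` and `⟪ξ, W⟫ = 0` hold on the whole submanifold. Differentiating them
  along `V` with the structure equations for `∇Φ` and `∇ξ` gives `ξ ln f = β` and
  `⟪B(X, V), Φ W⟫ = -(Φ X ln f) ⟪V, W⟫ - β η(X) ⟪Φ V, W⟫`.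

On the anti-invariant factor `Φ W` is normal, and `Φ` maps an orthonormal basis `(e_k)` of this
factor to an orthonormal system; Bessel's inequality for `Σ(X, e_j)` against this system bounds
the mixed block from below by `t₂ ‖Φ ∇ ln f₁‖² = t₂ (‖∇ ln f₁‖² - β²)`. On the slant factor, with
`P W` the component of `Φ W` tangent to this factor, `Φ W - P W` is normal, `P` is
skew and equal to `cos ν` times an isometry, and `Φ - P` is `sin ν` times an isometry; here Bessel's
inequality gives `csc² ν (1 + cos² ν) (‖∇ ln f₂‖² - β²)` for each basis vector. These are the lemmas
`le_formNormSq_of_antiInvariant` and `le_formNormSq_of_slant`, combined in `formNormSq_ge_of_contact`.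

The diagonal blocks of `Σ` are discarded in the estimate, so they vanish in the case of equality.
Then `B` is tangential on pairs of vectors tangent to the same factor, hence known from
the Koszul formula. Since coordinate fields of a slice extend to coordinate fields of the product,
`B` restricted to the slice is the second derivative of the slice (`mapHessian_comp`), and its
component normal to the slice can be read off.
-/

noncomputable section

/-! ### Vector fields along a map -/

section Along

open Filter Topology

variable {E : Type*} [NormedAddCommGroup E] [NormedSpace ℝ E]
  {H : Type*} [TopologicalSpace H] {I : ModelWithCorners ℝ E H}
  {M : Type*} [TopologicalSpace M] [ChartedSpace H M] [IsManifold I ∞ M]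
  {E' : Type*} [NormedAddCommGroup E'] [NormedSpace ℝ E']
  {H' : Type*} [TopologicalSpace H'] {J : ModelWithCorners ℝ E' H'}
  {N : Type*} [TopologicalSpace N] [ChartedSpace H' N]

/-- Differentiability at `p` of a vector field `W` along the map `F`. -/
def DiffAlongAt (I : ModelWithCorners ℝ E H) [IsManifold I ∞ M] (J : ModelWithCorners ℝ E' H')
    (F : N → M) (W : ∀ q : N, TangentSpace I (F q)) (p : N) : Prop :=
  MDifferentiableAt J (I.prod 𝓘(ℝ, E)) (fun q ↦ TotalSpace.mk' E (F q) (W q)) p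

/-- The components of a vector field `W` along `F` in the preferred trivialization around `F p`. -/
def alongCoord (I : ModelWithCorners ℝ E H) [IsManifold I ∞ M]
    (F : N → M) (p : N) (W : ∀ q : N, TangentSpace I (F q)) (q : N) : E :=
  (trivializationAt E (TangentSpace I : M → Type _) (F p) (TotalSpace.mk' E (F q) (W q))).2

variable {F : N → M} {p : N} {W W' : ∀ q : N, TangentSpace I (F q)}

theorem diffAlongAt_iff :
    DiffAlongAt I J F W p ↔
      MDifferentiableAt J I F p ∧ MDifferentiableAt J 𝓘(ℝ, E) (alongCoord I F p W) p :=
  mdifferentiableAt_totalSpace _ _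

theorem eventually_mem_baseSet (hF : ContinuousAt F p) :
    ∀ᶠ q in 𝓝 p, F q ∈ (trivializationAt E (TangentSpace I : M → Type _) (F p)).baseSet :=
  hF.eventually <| (Trivialization.open_baseSet _).mem_nhds
    (mem_baseSet_trivializationAt E (TangentSpace I : M → Type _) (F p))

theorem alongCoord_add (hF : ContinuousAt F p) :
    alongCoord I F p (fun q ↦ W q + W' q) =ᶠ[𝓝 p]
      (fun q ↦ alongCoord I F p W q + alongCoord I F p W' q) :=
  (eventually_mem_baseSet hF).mono fun _ hq ↦
    ((trivializationAt E (TangentSpace I : M → Type _) (F p)).linear ℝ hq).map_add _ _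

theorem alongCoord_smul (hF : ContinuousAt F p) (c : N → ℝ) :
    alongCoord I F p (fun q ↦ c q • W q) =ᶠ[𝓝 p] (fun q ↦ c q • alongCoord I F p W q) :=
  (eventually_mem_baseSet hF).mono fun _ hq ↦
    ((trivializationAt E (TangentSpace I : M → Type _) (F p)).linear ℝ hq).map_smul _ _

theorem DiffAlongAt.add (hW : DiffAlongAt I J F W p) (hW' : DiffAlongAt I J F W' p) :
    DiffAlongAt I J F (fun q ↦ W q + W' q) p := by
  rw [diffAlongAt_iff] at *
  exact ⟨hW.1, (hW.2.add hW'.2).congr_of_eventuallyEq (alongCoord_add hW.1.continuousAt)⟩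

theorem DiffAlongAt.smul {c : N → ℝ} (hc : MDifferentiableAt J 𝓘(ℝ, ℝ) c p)
    (hW : DiffAlongAt I J F W p) : DiffAlongAt I J F (fun q ↦ c q • W q) p := by
  rw [diffAlongAt_iff] at *
  exact ⟨hW.1, (hc.smul hW.2).congr_of_eventuallyEq (alongCoord_smul hW.1.continuousAt c)⟩

theorem DiffAlongAt.congr (hW : DiffAlongAt I J F W p) (h : ∀ᶠ q in 𝓝 p, W' q = W q) :
    DiffAlongAt I J F W' p :=
  MDifferentiableAt.congr_of_eventuallyEq hW (h.mono fun q hq ↦ by simp [hq])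

theorem DiffAlongAt.of_section (hF : MDifferentiableAt J I F p) {Y : ∀ x : M, TangentSpace I x}
    (hY : MDifferentiableAt I (I.prod 𝓘(ℝ, E)) (fun y ↦ TotalSpace.mk' E y (Y y)) (F p)) :
    DiffAlongAt I J F (fun q ↦ Y (F q)) p :=
  MDifferentiableAt.comp p hY hF

/-- A field with constant components in a local trivialization, in terms of the linear map
`symmL`. -/
theorem extend_eq_symmL {x : M} (a : TangentSpace I x) {y : M}
    (hy : y ∈ (trivializationAt E (TangentSpace I : M → Type _) x).baseSet) :
    FiberBundle.extend E a y =
      (trivializationAt E (TangentSpace I : M → Type _) x).symmL ℝ y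
        ((trivializationAt E (TangentSpace I : M → Type _) x) (TotalSpace.mk' E x a)).2 :=
  ((trivializationAt E (TangentSpace I : M → Type _) x).symmL_apply hy _).symm

theorem trivializationAt_self_add {x : M} (a b : TangentSpace I x) :
    ((trivializationAt E (TangentSpace I : M → Type _) x) (TotalSpace.mk' E x (a + b))).2 =
      ((trivializationAt E (TangentSpace I : M → Type _) x) (TotalSpace.mk' E x a)).2 +
      ((trivializationAt E (TangentSpace I : M → Type _) x) (TotalSpace.mk' E x b)).2 :=
  ((trivializationAt E (TangentSpace I : M → Type _) x).linear ℝ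
    (mem_baseSet_trivializationAt E (TangentSpace I : M → Type _) x)).map_add _ _

theorem trivializationAt_self_smul {x : M} (c : ℝ) (a : TangentSpace I x) :
    ((trivializationAt E (TangentSpace I : M → Type _) x) (TotalSpace.mk' E x (c • a))).2 =
      c • ((trivializationAt E (TangentSpace I : M → Type _) x) (TotalSpace.mk' E x a)).2 :=
  ((trivializationAt E (TangentSpace I : M → Type _) x).linear ℝ
    (mem_baseSet_trivializationAt E (TangentSpace I : M → Type _) x)).map_smul _ _

theorem eventually_mem_baseSet_self (x : M) :
    ∀ᶠ y in 𝓝 x, y ∈ (trivializationAt E (TangentSpace I : M → Type _) x).baseSet :=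
  eventually_mem_baseSet (F := (id : M → M)) continuousAt_id

theorem extend_add {x : M} (a b : TangentSpace I x) :
    ∀ᶠ y in 𝓝 x, FiberBundle.extend E (a + b) y =
      (FiberBundle.extend E a + FiberBundle.extend E b : ∀ y : M, TangentSpace I y) y := by
  filter_upwards [eventually_mem_baseSet_self (I := I) x] with y hy
  simp only [Pi.add_apply, extend_eq_symmL _ hy, trivializationAt_self_add, map_add]

theorem extend_smul {x : M} (c : ℝ) (a : TangentSpace I x) :
    ∀ᶠ y in 𝓝 x, FiberBundle.extend E (c • a) y =
      (c • FiberBundle.extend E a : ∀ y : M, TangentSpace I y) y := by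
  filter_upwards [eventually_mem_baseSet_self (I := I) x] with y hy
  simp only [Pi.smul_apply, extend_eq_symmL _ hy, trivializationAt_self_smul, map_smul]

theorem extend_zero (x : M) :
    ∀ᶠ y in 𝓝 x, FiberBundle.extend E (0 : TangentSpace I x) y = (0 : TangentSpace I y) := by
  filter_upwards [extend_smul (0 : ℝ) (0 : TangentSpace I x)] with y hy
  simpa using hy

/-- Around `p`, a vector field along `F` is a combination of the local frame of `TM` given by the
preferred trivialization; so a property of vector fields along `F` which is local, additive and
stable under multiplication by functions holds as soon as it holds for restrictions to `F` of
vector fields on `M` with constant components in this trivialization. -/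
theorem DiffAlongAt.induction [FiniteDimensional ℝ E]
    {P : (∀ q : N, TangentSpace I (F q)) → Prop}
    (hsec : ∀ a : TangentSpace I (F p), P (fun q ↦ FiberBundle.extend E a (F q)))
    (hadd : ∀ W W', DiffAlongAt I J F W p → DiffAlongAt I J F W' p → P W → P W' →
      P (fun q ↦ W q + W' q))
    (hsmul : ∀ (c : N → ℝ) W, MDifferentiableAt J 𝓘(ℝ, ℝ) c p → DiffAlongAt I J F W p → P W →
      P (fun q ↦ c q • W q))
    (hcongr : ∀ W W', DiffAlongAt I J F W p → (∀ᶠ q in 𝓝 p, W' q = W q) → P W → P W')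
    (hW : DiffAlongAt I J F W p) : P W := by
  classical
  set t := trivializationAt E (TangentSpace I : M → Type _) (F p) with ht
  obtain ⟨hF, hw⟩ := diffAlongAt_iff.1 hW
  have hmem : F p ∈ t.baseSet := mem_baseSet_trivializationAt E (TangentSpace I : M → Type _) (F p)
  let b := Module.finBasis ℝ E
  let a : Fin (Module.finrank ℝ E) → TangentSpace I (F p) := fun i ↦ t.symm (F p) (b i)
  have he (i) := FiberBundle.mdifferentiableAt_extend I E (a i)
  let c : Fin (Module.finrank ℝ E) → N → ℝ := fun i q ↦ b.repr (alongCoord I F p W q) i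
  have hc (i) : MDifferentiableAt J 𝓘(ℝ, ℝ) (c i) p := by
    have h1 : MDifferentiableAt 𝓘(ℝ, E) 𝓘(ℝ, ℝ) (b.coord i).toContinuousLinearMap
        (alongCoord I F p W p) :=
      (b.coord i).toContinuousLinearMap.differentiableAt.mdifferentiableAt
    exact h1.comp p hw
  have key (s : Finset (Fin (Module.finrank ℝ E))) :
      DiffAlongAt I J F (fun q ↦ ∑ i ∈ s, c i q • FiberBundle.extend E (a i) (F q)) p ∧
        P (fun q ↦ ∑ i ∈ s, c i q • FiberBundle.extend E (a i) (F q)) := by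
    induction s using Finset.induction_on with
    | empty =>
      have h1 := DiffAlongAt.of_section hF
        (FiberBundle.mdifferentiableAt_extend I E (0 : TangentSpace I (F p)))
      have h2 : ∀ᶠ q in 𝓝 p, (0 : TangentSpace I (F q)) =
          FiberBundle.extend E (0 : TangentSpace I (F p)) (F q) :=
        (hF.continuousAt.eventually (extend_zero (I := I) (F p))).mono fun _ h ↦ h.symm
      simp only [Finset.sum_empty]
      exact ⟨h1.congr h2, hcongr _ _ h1 h2 (hsec 0)⟩
    | insert i s hi ih =>
      simp only [Finset.sum_insert hi]
      have h1 := (DiffAlongAt.of_section hF (he i))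
      exact ⟨(h1.smul (hc i)).add ih.1, hadd _ _ (h1.smul (hc i)) ih.1
        (hsmul _ _ (hc i) h1 (hsec _)) ih.2⟩
  refine hcongr _ _ (key Finset.univ).1 ?_ (key Finset.univ).2
  filter_upwards [eventually_mem_baseSet (I := I) hF.continuousAt] with q hq
  have h2 : ∀ i, FiberBundle.extend E (a i) (F q) = t.symmL ℝ (F q) (b i) := by
    intro i
    have h3 : (t (TotalSpace.mk' E (F p) (a i))).2 = b i := by
      have := t.apply_mk_symm hmem (b i)
      exact congrArg Prod.snd this
    rw [← h3]
    exact extend_eq_symmL _ hq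
  simp only [h2, ← map_smul, ← map_sum]
  rw [show ∑ i, c i q • b i = alongCoord I F p W q from b.sum_repr _]
  rw [t.symmL_apply hq]
  exact (t.symm_proj_apply (TotalSpace.mk' E (F q) (W q)) hq).symm

/-! ### Algebraic rules for the covariant derivative along a map -/

variable (nabla : CovariantDerivative I E (TangentSpace I : M → Type _))

theorem covDerivAlong_eq (W : ∀ q : N, TangentSpace I (F q)) (u : TangentSpace J p) :
    covDerivAlong J nabla F W p u =
      (trivializationAt E (TangentSpace I : M → Type _) (F p)).symmL ℝ (F p)
        (mvfderiv J (alongCoord I F p W) p u)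
      + nabla (FiberBundle.extend E (W p)) (F p) (mfderiv J I F p u) := by
  rw [Trivialization.symmL_apply _
    (mem_baseSet_trivializationAt E (TangentSpace I : M → Type _) (F p))]
  rfl

omit [IsManifold I ∞ M] in
theorem mvfderiv_congr {g g' : N → E} (h : g =ᶠ[𝓝 p] g') : mvfderiv J g p = mvfderiv J g' p := by
  have h1 : (mfderiv J 𝓘(ℝ, E) g p : E' →L[ℝ] E) = (mfderiv J 𝓘(ℝ, E) g' p : E' →L[ℝ] E) :=
    h.mfderiv_eq
  exact h1

theorem covDerivAlong_congr (h : ∀ᶠ q in 𝓝 p, W' q = W q) (u : TangentSpace J p) :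
    covDerivAlong J nabla F W' p u = covDerivAlong J nabla F W p u := by
  have h1 : alongCoord I F p W' =ᶠ[𝓝 p] alongCoord I F p W :=
    h.mono fun q hq ↦ by simp only [alongCoord, hq]
  rw [covDerivAlong_eq, covDerivAlong_eq, mvfderiv_congr h1, h.self_of_nhds]

theorem nabla_extend_add {x : M} (a b : TangentSpace I x) :
    nabla (FiberBundle.extend E (a + b)) x =
      nabla (FiberBundle.extend E a) x + nabla (FiberBundle.extend E b) x := by
  have ha := FiberBundle.mdifferentiableAt_extend I E a
  have hb := FiberBundle.mdifferentiableAt_extend I E b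
  rw [← nabla.isCovariantDerivativeOnUniv.add ha hb]
  exact nabla.isCovariantDerivativeOnUniv.congr_of_eventuallyEq
    (FiberBundle.mdifferentiableAt_extend I E _) (mdifferentiableAt_add_section ha hb)
    Filter.univ_mem (extend_add a b)

theorem nabla_extend_smul {x : M} (c : ℝ) (a : TangentSpace I x) :
    nabla (FiberBundle.extend E (c • a)) x = c • nabla (FiberBundle.extend E a) x := by
  have ha := FiberBundle.mdifferentiableAt_extend I E a
  rw [← nabla.isCovariantDerivativeOnUniv.smul_const c ha]
  exact nabla.isCovariantDerivativeOnUniv.congr_of_eventuallyEq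
    (FiberBundle.mdifferentiableAt_extend I E _) ha.smul_const_section
    Filter.univ_mem (extend_smul c a)

theorem covDerivAlong_add (hW : DiffAlongAt I J F W p) (hW' : DiffAlongAt I J F W' p)
    (u : TangentSpace J p) :
    covDerivAlong J nabla F (fun q ↦ W q + W' q) p u =
      covDerivAlong J nabla F W p u + covDerivAlong J nabla F W' p u := by
  rw [diffAlongAt_iff] at hW hW'
  rw [covDerivAlong_eq, covDerivAlong_eq, covDerivAlong_eq,
    mvfderiv_congr (alongCoord_add hW.1.continuousAt), mvfderiv_fun_add hW.2 hW'.2,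
    nabla_extend_add]
  simp only [add_apply, map_add]
  abel

/-- The Leibniz rule for the covariant derivative along a map. -/
theorem covDerivAlong_smul {c : N → ℝ} (hc : MDifferentiableAt J 𝓘(ℝ, ℝ) c p)
    (hW : DiffAlongAt I J F W p) (u : TangentSpace J p) :
    covDerivAlong J nabla F (fun q ↦ c q • W q) p u =
      c p • covDerivAlong J nabla F W p u + mvfderiv J c p u • W p := by
  rw [diffAlongAt_iff] at hW
  have h1 : (trivializationAt E (TangentSpace I : M → Type _) (F p)).symmL ℝ (F p)
      (alongCoord I F p W p) = W p := by
    rw [Trivialization.symmL_apply _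
      (mem_baseSet_trivializationAt E (TangentSpace I : M → Type _) (F p))]
    exact (trivializationAt E (TangentSpace I : M → Type _) (F p)).symm_proj_apply
      (TotalSpace.mk' E (F p) (W p))
      (mem_baseSet_trivializationAt E (TangentSpace I : M → Type _) (F p))
  rw [covDerivAlong_eq, covDerivAlong_eq, mvfderiv_congr (alongCoord_smul hW.1.continuousAt c),
    mvfderiv_fun_smul hc hW.2, nabla_extend_smul]
  simp only [add_apply, smul_apply,
    ContinuousLinearMap.smulRight_apply, map_add, map_smul, h1, smul_add]
  abel

/-- For the restriction to `F` of a field with constant components, the derivative along `F` is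
`∇_{dF u}` by definition. -/
theorem covDerivAlong_extend (hF : MDifferentiableAt J I F p) (a : TangentSpace I (F p))
    (u : TangentSpace J p) :
    covDerivAlong J nabla F (fun q ↦ FiberBundle.extend E a (F q)) p u =
      nabla (FiberBundle.extend E a) (F p) (mfderiv J I F p u) := by
  have h1 : alongCoord I F p (fun q ↦ FiberBundle.extend E a (F q)) =ᶠ[𝓝 p] fun _ ↦
      ((trivializationAt E (TangentSpace I : M → Type _) (F p)) (TotalSpace.mk' E (F p) a)).2 := by
    filter_upwards [eventually_mem_baseSet (I := I) hF.continuousAt] with q hq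
    have := (trivializationAt E (TangentSpace I : M → Type _) (F p)).apply_mk_symm hq
      ((trivializationAt E (TangentSpace I : M → Type _) (F p)) (TotalSpace.mk' E (F p) a)).2
    have h := congrArg Prod.snd this
    exact h
  rw [covDerivAlong_eq, mvfderiv_congr h1, mvfderiv_const, FiberBundle.extend_apply_self]
  simp

theorem covDerivAlong_id [FiniteDimensional ℝ E] {x : M} {Y : ∀ y : M, TangentSpace I y}
    (hY : MDifferentiableAt I (I.prod 𝓘(ℝ, E)) (fun y ↦ TotalSpace.mk' E y (Y y)) x)
    (v : TangentSpace I x) :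
    covDerivAlong I nabla (id : M → M) Y x v = nabla Y x v := by
  have hY' : DiffAlongAt I I (id : M → M) Y x := hY
  refine hY'.induction (P := fun Y ↦ covDerivAlong I nabla (id : M → M) Y x v = nabla Y x v)
    ?_ ?_ ?_ ?_
  · intro a
    rw [covDerivAlong_extend nabla mdifferentiableAt_id, mfderiv_id]
    rfl
  · intro W W' hW hW' h h'
    rw [covDerivAlong_add nabla hW hW', h, h']
    have := nabla.isCovariantDerivativeOnUniv.add hW hW'
    exact (congrArg (fun L ↦ L v) this).symm
  · intro c W hc hW h
    rw [covDerivAlong_smul nabla hc hW, h]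
    have := nabla.isCovariantDerivativeOnUniv.leibniz hW hc
    exact (congrArg (fun L ↦ L v) this).symm
  · intro W W' hW h h1
    rw [covDerivAlong_congr nabla h, h1]
    have := nabla.isCovariantDerivativeOnUniv.congr_of_eventuallyEq (hW.congr h) hW
      Filter.univ_mem h
    exact (congrArg (fun L ↦ L v) this).symm

/-- For the restriction to `F` of a vector field `Y` on `M`, the derivative along `F` in the
direction `u` is `∇_{dF u} Y`. -/
theorem covDerivAlong_section [FiniteDimensional ℝ E] (hF : MDifferentiableAt J I F p)
    {Y : ∀ y : M, TangentSpace I y}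
    (hY : MDifferentiableAt I (I.prod 𝓘(ℝ, E)) (fun y ↦ TotalSpace.mk' E y (Y y)) (F p))
    (u : TangentSpace J p) :
    covDerivAlong J nabla F (fun q ↦ Y (F q)) p u = nabla Y (F p) (mfderiv J I F p u) := by
  have hY' : DiffAlongAt I I (id : M → M) Y (F p) := hY
  rw [← covDerivAlong_id nabla hY, covDerivAlong_eq, covDerivAlong_eq]
  have h1 : mvfderiv J (alongCoord I F p (fun q ↦ Y (F q))) p u =
      mvfderiv I (alongCoord I (id : M → M) (F p) Y) (F p) (mfderiv J I F p u) :=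
    mfderiv_comp_apply p (diffAlongAt_iff.1 hY').2 hF u
  rw [h1, mfderiv_id]
  rfl

end Along

section Along2

open Filter Topology

variable {E : Type*} [NormedAddCommGroup E] [NormedSpace ℝ E]
  {H : Type*} [TopologicalSpace H] {I : ModelWithCorners ℝ E H}
  {M : Type*} [TopologicalSpace M] [ChartedSpace H M] [IsManifold I ∞ M]
  {E' : Type*} [NormedAddCommGroup E'] [NormedSpace ℝ E']
  {H' : Type*} [TopologicalSpace H'] {J : ModelWithCorners ℝ E' H'}
  {N : Type*} [TopologicalSpace N] [ChartedSpace H' N]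
  {F : N → M} {p : N} {W W' : ∀ q : N, TangentSpace I (F q)}

/-! ### The structures of the ambient manifold, differentiated along a map -/

section Structures

variable [FiniteDimensional ℝ E]
  [RiemannianBundle (fun x : M ↦ TangentSpace I x)]
  [IsContMDiffRiemannianBundle I ∞ E (fun x : M ↦ TangentSpace I x)]
  {nabla : CovariantDerivative I E (TangentSpace I : M → Type _)}

omit [FiniteDimensional ℝ E] in
theorem DiffAlongAt.inner (hW : DiffAlongAt I J F W p) (hW' : DiffAlongAt I J F W' p) :
    MDifferentiableAt J 𝓘(ℝ, ℝ) (fun q ↦ (inner ℝ (W q) (W' q) : ℝ)) p :=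
  MDifferentiableAt.inner_bundle hW hW'

/-- The Levi-Civita connection is metric also along a map. -/
theorem mvfderiv_inner_along (hnabla : IsLeviCivita nabla)
    (hW : DiffAlongAt I J F W p) (hW' : DiffAlongAt I J F W' p) (u : TangentSpace J p) :
    mvfderiv J (fun q ↦ (inner ℝ (W q) (W' q) : ℝ)) p u =
      inner ℝ (covDerivAlong J nabla F W p u) (W' p)
        + inner ℝ (W p) (covDerivAlong J nabla F W' p u) := by
  have hF := (diffAlongAt_iff.1 hW).1
  have hadd : ∀ V V' U : (∀ q : N, TangentSpace I (F q)), DiffAlongAt I J F V p →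
      DiffAlongAt I J F V' p → DiffAlongAt I J F U p →
      mvfderiv J (fun q ↦ (inner ℝ (V q) (U q) : ℝ)) p u =
        inner ℝ (covDerivAlong J nabla F V p u) (U p)
        + inner ℝ (V p) (covDerivAlong J nabla F U p u) →
      mvfderiv J (fun q ↦ (inner ℝ (V' q) (U q) : ℝ)) p u =
        inner ℝ (covDerivAlong J nabla F V' p u) (U p)
        + inner ℝ (V' p) (covDerivAlong J nabla F U p u) →
      mvfderiv J (fun q ↦ (inner ℝ (V q + V' q) (U q) : ℝ)) p u =
        inner ℝ (covDerivAlong J nabla F (fun q ↦ V q + V' q) p u) (U p)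
        + inner ℝ (V p + V' p) (covDerivAlong J nabla F U p u) := by
    intro V V' U hV hV' hU h h'
    simp only [inner_add_left]
    rw [mvfderiv_fun_add (hV.inner hU) (hV'.inner hU), covDerivAlong_add nabla hV hV',
      inner_add_left, add_apply, h, h']
    ring
  have hsmul : ∀ (c : N → ℝ) (V U : ∀ q : N, TangentSpace I (F q)),
      MDifferentiableAt J 𝓘(ℝ, ℝ) c p → DiffAlongAt I J F V p → DiffAlongAt I J F U p →
      mvfderiv J (fun q ↦ (inner ℝ (V q) (U q) : ℝ)) p u =
        inner ℝ (covDerivAlong J nabla F V p u) (U p)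
        + inner ℝ (V p) (covDerivAlong J nabla F U p u) →
      mvfderiv J (fun q ↦ (inner ℝ (c q • V q) (U q) : ℝ)) p u =
        inner ℝ (covDerivAlong J nabla F (fun q ↦ c q • V q) p u) (U p)
        + inner ℝ (c p • V p) (covDerivAlong J nabla F U p u) := by
    intro c V U hc hV hU h
    simp only [real_inner_smul_left]
    rw [mvfderiv_fun_mul hc (hV.inner hU), covDerivAlong_smul nabla hc hV,
      inner_add_left, add_apply, smul_apply, smul_apply, h, real_inner_smul_left,
      real_inner_smul_left, smul_eq_mul, smul_eq_mul]
    ring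
  have hcongr : ∀ V V' U : (∀ q : N, TangentSpace I (F q)), (∀ᶠ q in 𝓝 p, V' q = V q) →
      mvfderiv J (fun q ↦ (inner ℝ (V q) (U q) : ℝ)) p u =
        inner ℝ (covDerivAlong J nabla F V p u) (U p)
        + inner ℝ (V p) (covDerivAlong J nabla F U p u) →
      mvfderiv J (fun q ↦ (inner ℝ (V' q) (U q) : ℝ)) p u =
        inner ℝ (covDerivAlong J nabla F V' p u) (U p)
        + inner ℝ (V' p) (covDerivAlong J nabla F U p u) := by
    intro V V' U h h1
    have h2 : (fun q ↦ (inner ℝ (V' q) (U q) : ℝ)) =ᶠ[𝓝 p] fun q ↦ inner ℝ (V q) (U q) :=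
      h.mono fun q hq ↦ by simp only [hq]
    rw [covDerivAlong_congr nabla h, h.self_of_nhds, ← h1, mvfderiv_congr h2]
  have hswap : ∀ V U : (∀ q : N, TangentSpace I (F q)),
      mvfderiv J (fun q ↦ (inner ℝ (V q) (U q) : ℝ)) p u =
        inner ℝ (covDerivAlong J nabla F V p u) (U p)
        + inner ℝ (V p) (covDerivAlong J nabla F U p u) →
      mvfderiv J (fun q ↦ (inner ℝ (U q) (V q) : ℝ)) p u =
        inner ℝ (covDerivAlong J nabla F U p u) (V p)
        + inner ℝ (U p) (covDerivAlong J nabla F V p u) := by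
    intro V U h
    simp only [real_inner_comm] at h ⊢
    rw [h, add_comm]
  have hext (a : TangentSpace I (F p)) :
      DiffAlongAt I J F (fun q ↦ FiberBundle.extend E a (F q)) p :=
    DiffAlongAt.of_section hF (FiberBundle.mdifferentiableAt_extend I E a)
  refine hW.induction (P := fun V ↦ mvfderiv J (fun q ↦ (inner ℝ (V q) (W' q) : ℝ)) p u =
      inner ℝ (covDerivAlong J nabla F V p u) (W' p)
        + inner ℝ (V p) (covDerivAlong J nabla F W' p u)) ?_
    (fun V V' hV hV' h h' ↦ hadd V V' W' hV hV' hW' h h')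
    (fun c V hc hV h ↦ hsmul c V W' hc hV hW' h)
    (fun V V' _ hVV' h ↦ hcongr V V' W' hVV' h)
  intro a
  refine hswap _ _ (hW'.induction (P := fun V ↦
      mvfderiv J (fun q ↦ (inner ℝ (V q) (FiberBundle.extend E a (F q)) : ℝ)) p u =
      inner ℝ (covDerivAlong J nabla F V p u) (FiberBundle.extend E a (F p))
        + inner ℝ (V p) (covDerivAlong J nabla F (fun q ↦ FiberBundle.extend E a (F q)) p u)) ?_
    (fun V V' hV hV' h h' ↦ hadd V V' _ hV hV' (hext a) h h')
    (fun c V hc hV h ↦ hsmul c V _ hc hV (hext a) h)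
    (fun V V' _ hVV' h ↦ hcongr V V' _ hVV' h))
  intro b
  have ha := FiberBundle.mdifferentiableAt_extend I E a
  have hb := FiberBundle.mdifferentiableAt_extend I E b
  rw [covDerivAlong_extend nabla hF, covDerivAlong_extend nabla hF, ← hnabla.metric _ _ _ _ hb ha]
  exact mfderiv_comp_apply p (DiffAlongAt.inner (F := (id : M → M)) hb ha) hF u

variable {Phi : ∀ x : M, TangentSpace I x →L[ℝ] TangentSpace I x}
  {xi : ∀ x : M, TangentSpace I x} {eta : ∀ x : M, TangentSpace I x →L[ℝ] ℝ} {beta : M → ℝ}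

omit [FiniteDimensional ℝ E] [IsContMDiffRiemannianBundle I ∞ E (fun x : M ↦ TangentSpace I x)] in
theorem IsAlmostContactMetric.diffAlongAt_Phi (hM : IsAlmostContactMetric Phi xi eta)
    (hW : DiffAlongAt I J F W p) : DiffAlongAt I J F (fun q ↦ Phi (F q) (W q)) p := by
  have hF := (diffAlongAt_iff.1 hW).1
  have h1 := (hM.smooth_Phi.mdifferentiableAt (x := F p) (by simp)).comp p hF
  exact MDifferentiableAt.clm_bundle_apply (F₁ := E) (F₂ := E) h1 hW

omit [IsContMDiffRiemannianBundle I ∞ E (fun x : M ↦ TangentSpace I x)] in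
/-- The structure equation for `∇Φ`, along a map. -/
theorem IsLocConfAlmostCosymplectic.covDerivAlong_Phi
    (hM : IsLocConfAlmostCosymplectic nabla Phi xi eta beta)
    (hW : DiffAlongAt I J F W p) (u : TangentSpace J p) :
    covDerivAlong J nabla F (fun q ↦ Phi (F q) (W q)) p u =
      Phi (F p) (covDerivAlong J nabla F W p u) +
        beta (F p) • ((inner ℝ (Phi (F p) (mfderiv J I F p u)) (W p) : ℝ) • xi (F p)
          - eta (F p) (W p) • Phi (F p) (mfderiv J I F p u)) := by
  have hF := (diffAlongAt_iff.1 hW).1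
  refine hW.induction (P := fun W ↦ covDerivAlong J nabla F (fun q ↦ Phi (F q) (W q)) p u =
      Phi (F p) (covDerivAlong J nabla F W p u) +
        beta (F p) • ((inner ℝ (Phi (F p) (mfderiv J I F p u)) (W p) : ℝ) • xi (F p)
          - eta (F p) (W p) • Phi (F p) (mfderiv J I F p u))) ?_ ?_ ?_ ?_
  · intro a
    have ha := FiberBundle.mdifferentiableAt_extend I E a
    have h1 : MDifferentiableAt I (I.prod 𝓘(ℝ, E))
        (fun y ↦ TotalSpace.mk' E y (Phi y (FiberBundle.extend E a y))) (F p) :=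
      hM.diffAlongAt_Phi (F := (id : M → M)) ha
    rw [covDerivAlong_section nabla hF h1, covDerivAlong_extend nabla hF, ← hM.nabla_Phi _ _ _ ha]
    abel
  · intro V V' hV hV' h h'
    simp only [map_add]
    rw [covDerivAlong_add nabla (hM.diffAlongAt_Phi hV) (hM.diffAlongAt_Phi hV'), h, h',
      covDerivAlong_add nabla hV hV', map_add, inner_add_right]
    module
  · intro c V hc hV h
    simp only [map_smul]
    rw [covDerivAlong_smul nabla hc (hM.diffAlongAt_Phi hV), h, covDerivAlong_smul nabla hc hV,
      map_add, map_smul, map_smul, inner_smul_right, smul_eq_mul]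
    module
  · intro V V' hV hVV' h
    have h2 : ∀ᶠ q in 𝓝 p, Phi (F q) (V' q) = Phi (F q) (V q) :=
      hVV'.mono fun q hq ↦ by rw [hq]
    rw [covDerivAlong_congr nabla h2 u, h,
      covDerivAlong_congr nabla hVV' u, hVV'.self_of_nhds]

omit [IsContMDiffRiemannianBundle I ∞ E (fun x : M ↦ TangentSpace I x)] in
/-- The structure equation for `∇ξ`, along a map. -/
theorem IsLocConfAlmostCosymplectic.covDerivAlong_xi
    (hM : IsLocConfAlmostCosymplectic nabla Phi xi eta beta)
    (hF : MDifferentiableAt J I F p) (u : TangentSpace J p) :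
    covDerivAlong J nabla F (fun q ↦ xi (F q)) p u =
      beta (F p) • (mfderiv J I F p u - eta (F p) (mfderiv J I F p u) • xi (F p)) := by
  rw [covDerivAlong_section nabla hF (hM.smooth_xi.mdifferentiableAt (by simp)), hM.nabla_xi]

end Structures

end Along2

section Symmetry

open Filter Topology

variable {E : Type*} [NormedAddCommGroup E] [NormedSpace ℝ E]
  {H : Type*} [TopologicalSpace H] {I : ModelWithCorners ℝ E H}
  {M : Type*} [TopologicalSpace M] [ChartedSpace H M] [IsManifold I ∞ M]
  {E' : Type*} [NormedAddCommGroup E'] [NormedSpace ℝ E']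
  {H' : Type*} [TopologicalSpace H'] {J : ModelWithCorners ℝ E' H'}
  {N : Type*} [TopologicalSpace N] [ChartedSpace H' N] [IsManifold J ∞ N]
  {F : N → M} {p : N}

/-! ### Symmetry of the Hessian of a map -/

/-- The preferred trivialization around `x` is the identity on the fiber at `x`. -/
theorem trivializationAt_self {x : M} (a : TangentSpace I x) :
    ((trivializationAt E (TangentSpace I : M → Type _) x) (TotalSpace.mk' E x a)).2 = a :=
  (tangentBundleCore I M).coordChange_self (achart H x) x (mem_chart_source H x) a

theorem lieBracketWithin_const (a b : E) (s : Set E) (x : E) :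
    VectorField.lieBracketWithin ℝ (fun _ ↦ a) (fun _ ↦ b) s x = 0 := by
  simp [VectorField.lieBracketWithin]

theorem fderiv_fderiv_apply {f : E' → E} {y : E'} (hf : DifferentiableAt ℝ (fderiv ℝ f) y)
    (a b : E') : fderiv ℝ (fun z ↦ fderiv ℝ f z b) y a = fderiv ℝ (fderiv ℝ f) y a b := by
  rw [fderiv_clm_apply hf (differentiableAt_const b)]
  simp

/-- Coordinate fields commute. -/
theorem mlieBracket_extend {x : M} (a b : TangentSpace I x) :
    VectorField.mlieBracket I (FiberBundle.extend E a) (FiberBundle.extend E b) x = 0 := by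
  have key (a : TangentSpace I x) :
      VectorField.mpullbackWithin 𝓘(ℝ, E) I (extChartAt I x).symm (FiberBundle.extend E a)
        (Set.range I) =ᶠ[𝓝[Set.range I] (extChartAt I x x)] fun _ ↦ (a : E) := by
    filter_upwards [extChartAt_target_mem_nhdsWithin x] with y hy
    have hinv := isInvertible_mfderivWithin_extChartAt_symm (I := I) hy
    have hy' : (extChartAt I x).symm y ∈ (chartAt H x).source := by
      rw [← extChartAt_source I]
      exact (extChartAt I x).map_target hy
    rw [VectorField.mpullbackWithin_apply, extend_eq_symmL _ hy',
      TangentBundle.symmL_trivializationAt hy', trivializationAt_self]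
    have h1 : (extChartAt I x) ((extChartAt I x).symm y) = y := (extChartAt I x).right_inv hy
    have h2 : ∀ y', y' = y → ((mfderivWithin 𝓘(ℝ, E) I (extChartAt I x).symm (Set.range I) y
          ).inverse ((mfderivWithin 𝓘(ℝ, E) I (extChartAt I x).symm (Set.range I) y' :
            E →L[ℝ] E) a) : E) = a := by
      rintro y' rfl
      obtain ⟨L, hL⟩ := hinv
      rw [← hL, ContinuousLinearMap.inverse_equiv]
      exact L.symm_apply_apply a
    exact h2 _ h1
  rw [← VectorField.mlieBracketWithin_univ, VectorField.mlieBracketWithin_apply]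
  have h := (key a).lieBracketWithin_vectorField_eq_of_mem (𝕜 := ℝ) (key b) (Set.mem_range_self _)
  rw [Set.preimage_univ, Set.univ_inter, h]
  exact (congrArg _ (lieBracketWithin_const (E := E) a b _ _)).trans (map_zero _)

theorem nabla_extend_symm [FiniteDimensional ℝ E]
    [RiemannianBundle (fun x : M ↦ TangentSpace I x)]
    {nabla : CovariantDerivative I E (TangentSpace I : M → Type _)}
    (hnabla : IsLeviCivita nabla) {x : M} (a b : TangentSpace I x) :
    nabla (FiberBundle.extend E b) x a = nabla (FiberBundle.extend E a) x b := by
  have h := nabla.torsion_apply_eq_extend a b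
  rw [hnabla.torsionFree, mlieBracket_extend, FiberBundle.extend_apply_self,
    FiberBundle.extend_apply_self, sub_zero] at h
  exact (sub_eq_zero.1 h.symm)

variable (I J) in
/-- The map `F` read in the preferred charts at `p` and `F p`. -/
def chartExpr (F : N → M) (p : N) : E' → E :=
  fun y ↦ extChartAt I (F p) (F ((extChartAt J p).symm y))

variable [J.Boundaryless]

omit [IsManifold I ∞ M] [IsManifold J ∞ N] in
theorem contDiffAt_chartExpr (hF : ContMDiffAt J I ∞ F p) :
    ContDiffAt ℝ ∞ (chartExpr I J F p) (extChartAt J p p) := by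
  have h := (contMDiffAt_iff.1 hF).2
  rw [J.range_eq_univ, contDiffWithinAt_univ] at h
  exact h

/-- In the preferred charts, the components of `dF v` for a coordinate field `v` are the
derivative of the coordinate expression of `F` in the direction `v`. -/
theorem alongCoord_mfderiv_extend (hF : ContMDiff J I ∞ F) (v : TangentSpace J p) :
    alongCoord I F p (fun q ↦ mfderiv J I F q (FiberBundle.extend E' v q)) =ᶠ[𝓝 p]
      fun q ↦ fderiv ℝ (chartExpr I J F p) (extChartAt J p q) (v : E') := by
  filter_upwards [eventually_mem_baseSet (I := I) hF.continuous.continuousAt,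
    eventually_mem_baseSet_self (I := J) p] with q hFq hq
  have hdF : ∀ q, MDifferentiableAt J I F q := fun q ↦ hF.mdifferentiableAt (by simp)
  have hq' : q ∈ (extChartAt J p).source := by rw [extChartAt_source]; exact hq
  have hcl (w : TangentSpace I (F q)) :
      (trivializationAt E (TangentSpace I : M → Type _) (F p)).continuousLinearMapAt ℝ (F q) w =
        ((trivializationAt E (TangentSpace I : M → Type _) (F p))
          (TotalSpace.mk' E (F q) w)).2 := by
    rw [Trivialization.continuousLinearMapAt_apply, Trivialization.linearMapAt_apply, if_pos hFq]
  have h1 : alongCoord I F p (fun q ↦ mfderiv J I F q (FiberBundle.extend E' v q)) q =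
      (mfderiv I 𝓘(ℝ, E) (extChartAt I (F p)) (F q) (mfderiv J I F q
        (mfderivWithin 𝓘(ℝ, E') J (extChartAt J p).symm (Set.range J) (extChartAt J p q)
          (v : E'))) : E) := by
    rw [← TangentBundle.continuousLinearMapAt_trivializationAt hFq,
      ← TangentBundle.symmL_trivializationAt hq, alongCoord, extend_eq_symmL _ hq,
      trivializationAt_self]
    exact (hcl _).symm
  have h2 : (extChartAt J p).symm (extChartAt J p q) = q := (extChartAt J p).left_inv hq'
  have hsymm : MDifferentiableAt 𝓘(ℝ, E') J (extChartAt J p).symm (extChartAt J p q) := by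
    have := mdifferentiableWithinAt_extChartAt_symm (I := J) ((extChartAt J p).map_source hq')
    rwa [J.range_eq_univ, mdifferentiableWithinAt_univ] at this
  have h3 : fderiv ℝ (chartExpr I J F p) (extChartAt J p q) (v : E') =
      (mfderiv I 𝓘(ℝ, E) (extChartAt I (F p)) (F ((extChartAt J p).symm (extChartAt J p q)))
        (mfderiv J I F ((extChartAt J p).symm (extChartAt J p q))
        (mfderiv 𝓘(ℝ, E') J (extChartAt J p).symm (extChartAt J p q) (v : E'))) : E) := by
    rw [← mfderiv_eq_fderiv]
    have hc : MDifferentiableAt I 𝓘(ℝ, E) (extChartAt I (F p))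
        (F ((extChartAt J p).symm (extChartAt J p q))) :=
      mdifferentiableAt_extChartAt (by rw [h2]; exact hFq)
    have hG := (hdF ((extChartAt J p).symm (extChartAt J p q))).comp _ hsymm
    have e1 := mfderiv_comp_apply (extChartAt J p q) (hc) hG (v : E')
    have e2 := mfderiv_comp_apply (extChartAt J p q) (hdF _) hsymm (v : E')
    exact e1.trans (congrArg (mfderiv I 𝓘(ℝ, E) (extChartAt I (F p))
      (F ((extChartAt J p).symm (extChartAt J p q)))) e2)
  -- The fibers over `q` and over `q` read through the chart are equal, but not by definition.
  have h4 : ∀ q', q' = q → ∀ a : E',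
      (mfderiv I 𝓘(ℝ, E) (extChartAt I (F p)) (F q') (mfderiv J I F q' a) : E) =
      mfderiv I 𝓘(ℝ, E) (extChartAt I (F p)) (F q) (mfderiv J I F q a) := by
    rintro q' rfl a
    rfl
  rw [h1, h3, J.range_eq_univ, mfderivWithin_univ]
  exact (h4 _ h2 _).symm

omit [IsManifold I ∞ M] [IsManifold J ∞ N] in
theorem differentiableAt_fderiv_chartExpr (hF : ContMDiff J I ∞ F) :
    DifferentiableAt ℝ (fderiv ℝ (chartExpr I J F p)) (extChartAt J p p) :=
  (((contDiffAt_chartExpr (hF p)).of_le (m := 2) ENat.LEInfty.out).fderiv_right (m := 1)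
    one_add_one_eq_two.le).differentiableAt one_ne_zero

theorem diffAlongAt_mfderiv_extend (hF : ContMDiff J I ∞ F) (v : TangentSpace J p) :
    DiffAlongAt I J F (fun q ↦ mfderiv J I F q (FiberBundle.extend E' v q)) p := by
  refine diffAlongAt_iff.2 ⟨hF.mdifferentiableAt (by simp), ?_⟩
  refine MDifferentiableAt.congr_of_eventuallyEq ?_ (alongCoord_mfderiv_extend hF v)
  have h1 : DifferentiableAt ℝ (fun y ↦ fderiv ℝ (chartExpr I J F p) y (v : E'))
      (extChartAt J p p) := (differentiableAt_fderiv_chartExpr hF).clm_apply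
        (differentiableAt_const _)
  exact h1.mdifferentiableAt.comp p (mdifferentiableAt_extChartAt (mem_chart_source H' p))

/-- For coordinate fields `u`, `v` and a torsion-free connection,
`∇_u (dF v) = ∇_v (dF u)`. -/
theorem covDerivAlong_mfderiv_symm [FiniteDimensional ℝ E]
    [RiemannianBundle (fun x : M ↦ TangentSpace I x)]
    {nabla : CovariantDerivative I E (TangentSpace I : M → Type _)}
    (hnabla : IsLeviCivita nabla) (hF : ContMDiff J I ∞ F) (u v : TangentSpace J p) :
    covDerivAlong J nabla F (fun q ↦ mfderiv J I F q (FiberBundle.extend E' v q)) p u =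
      covDerivAlong J nabla F (fun q ↦ mfderiv J I F q (FiberBundle.extend E' u q)) p v := by
  have key (u v : TangentSpace J p) :
      mvfderiv J (alongCoord I F p (fun q ↦ mfderiv J I F q (FiberBundle.extend E' v q))) p u =
        fderiv ℝ (fderiv ℝ (chartExpr I J F p)) (extChartAt J p p) (u : E') (v : E') := by
    rw [mvfderiv_congr (alongCoord_mfderiv_extend hF v)]
    have h0 := differentiableAt_fderiv_chartExpr (p := p) hF
    have h1 : DifferentiableAt ℝ (fun y ↦ fderiv ℝ (chartExpr I J F p) y (v : E'))
      (extChartAt J p p) := h0.clm_apply (differentiableAt_const _)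
    have h2 := mfderiv_comp_apply p h1.mdifferentiableAt
      (mdifferentiableAt_extChartAt (I := J) (mem_chart_source H' p)) u
    rw [mfderiv_extChartAt_self, mfderiv_eq_fderiv] at h2
    refine h2.trans ?_
    exact fderiv_fderiv_apply h0 (u : E') (v : E')
  have hsymm : IsSymmSndFDerivAt ℝ (chartExpr I J F p) (extChartAt J p p) :=
    (contDiffAt_chartExpr (hF p)).isSymmSndFDerivAt (by simpa using ENat.LEInfty.out)
  rw [covDerivAlong_eq, covDerivAlong_eq, key, key, FiberBundle.extend_apply_self,
    FiberBundle.extend_apply_self, nabla_extend_symm hnabla]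
  exact congrArg (· + _) (congrArg _ (hsymm.eq (u : E') (v : E')))

end Symmetry

section Hessian

open Filter Topology

variable {E : Type*} [NormedAddCommGroup E] [NormedSpace ℝ E]
  {H : Type*} [TopologicalSpace H] {I : ModelWithCorners ℝ E H}
  {M : Type*} [TopologicalSpace M] [ChartedSpace H M] [IsManifold I ∞ M]
  {E' : Type*} [NormedAddCommGroup E'] [NormedSpace ℝ E']
  {H' : Type*} [TopologicalSpace H'] {J : ModelWithCorners ℝ E' H'}
  {N : Type*} [TopologicalSpace N] [ChartedSpace H' N] [IsManifold J ∞ N]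
  {F : N → M} {p : N}

/-! ### The second derivative of an immersion -/

variable (J) in
/-- The derivative `∇_u (dF v)` at `p`, for `v` extended to a coordinate field. When `∇` is the
Levi-Civita connection its component normal to `F` is the second fundamental form. -/
def mapHessian (nabla : CovariantDerivative I E (TangentSpace I : M → Type _))
    (F : N → M) (p : N) (u v : TangentSpace J p) : TangentSpace I (F p) :=
  covDerivAlong J nabla F (fun q ↦ mfderiv J I F q (FiberBundle.extend E' v q)) p u

variable [FiniteDimensional ℝ E] [J.Boundaryless]
    [RiemannianBundle (fun x : M ↦ TangentSpace I x)]
    {nabla : CovariantDerivative I E (TangentSpace I : M → Type _)}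

theorem mapHessian_symm (hnabla : IsLeviCivita nabla) (hF : ContMDiff J I ∞ F)
    (u v : TangentSpace J p) : mapHessian J nabla F p u v = mapHessian J nabla F p v u :=
  covDerivAlong_mfderiv_symm hnabla hF u v

omit [FiniteDimensional ℝ E] [J.Boundaryless] [RiemannianBundle (fun x : M ↦ TangentSpace I x)] in
theorem mapHessian_add_left (u u' v : TangentSpace J p) :
    mapHessian J nabla F p (u + u') v =
      mapHessian J nabla F p u v + mapHessian J nabla F p u' v := by
  simp only [mapHessian, covDerivAlong_eq, map_add]
  abel

omit [FiniteDimensional ℝ E] [J.Boundaryless] [RiemannianBundle (fun x : M ↦ TangentSpace I x)] in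
theorem mapHessian_smul_left (c : ℝ) (u v : TangentSpace J p) :
    mapHessian J nabla F p (c • u) v = c • mapHessian J nabla F p u v := by
  simp only [mapHessian, covDerivAlong_eq, map_smul, smul_add]

/-- `mapHessian` as a bilinear map: it is linear in the direction of differentiation, and
symmetric. -/
def mapHessianₗ (hnabla : IsLeviCivita nabla) (hF : ContMDiff J I ∞ F) (p : N) :
    TangentSpace J p →ₗ[ℝ] TangentSpace J p →ₗ[ℝ] TangentSpace I (F p) :=
  LinearMap.mk₂ ℝ (mapHessian J nabla F p) mapHessian_add_left mapHessian_smul_left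
    (fun u v v' ↦ by
      rw [mapHessian_symm hnabla hF, mapHessian_add_left, mapHessian_symm hnabla hF v,
        mapHessian_symm hnabla hF v'])
    (fun c u v ↦ by
      rw [mapHessian_symm hnabla hF, mapHessian_smul_left, mapHessian_symm hnabla hF v])

/-- The Koszul formula along an immersion, for coordinate fields. -/
theorem two_mul_inner_mapHessian
    [IsContMDiffRiemannianBundle I ∞ E (fun x : M ↦ TangentSpace I x)]
    (hnabla : IsLeviCivita nabla) (hF : ContMDiff J I ∞ F) (u v w : TangentSpace J p) :
    2 * (inner ℝ (mapHessian J nabla F p u v) (mfderiv J I F p w) : ℝ) =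
      mvfderiv J (fun q ↦ (inner ℝ (mfderiv J I F q (FiberBundle.extend E' v q))
        (mfderiv J I F q (FiberBundle.extend E' w q)) : ℝ)) p u
      + mvfderiv J (fun q ↦ (inner ℝ (mfderiv J I F q (FiberBundle.extend E' u q))
        (mfderiv J I F q (FiberBundle.extend E' w q)) : ℝ)) p v
      - mvfderiv J (fun q ↦ (inner ℝ (mfderiv J I F q (FiberBundle.extend E' u q))
        (mfderiv J I F q (FiberBundle.extend E' v q)) : ℝ)) p w := by
  have key (u v w : TangentSpace J p) :=
    mvfderiv_inner_along hnabla (diffAlongAt_mfderiv_extend hF v)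
      (diffAlongAt_mfderiv_extend hF w) u
  rw [key, key, key]
  change _ = inner ℝ (mapHessian J nabla F p u v) _ + inner ℝ _ (mapHessian J nabla F p u w)
    + (inner ℝ (mapHessian J nabla F p v u) _ + inner ℝ _ (mapHessian J nabla F p v w))
    - (inner ℝ (mapHessian J nabla F p w u) _ + inner ℝ _ (mapHessian J nabla F p w v))
  simp only [FiberBundle.extend_apply_self]
  rw [mapHessian_symm hnabla hF v u, mapHessian_symm hnabla hF w u, mapHessian_symm hnabla hF w v,
    real_inner_comm (mapHessian J nabla F p u w) (mfderiv J I F p v)]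
  ring

end Hessian

section Product

open Filter Topology

variable {E₁ : Type*} [NormedAddCommGroup E₁] [NormedSpace ℝ E₁]
  {H₁ : Type*} [TopologicalSpace H₁] {I₁ : ModelWithCorners ℝ E₁ H₁} [I₁.Boundaryless]
  {L₁ : Type*} [TopologicalSpace L₁] [ChartedSpace H₁ L₁] [IsManifold I₁ ∞ L₁]
  {E₂ : Type*} [NormedAddCommGroup E₂] [NormedSpace ℝ E₂]
  {H₂ : Type*} [TopologicalSpace H₂] {I₂ : ModelWithCorners ℝ E₂ H₂} [I₂.Boundaryless]
  {L₂ : Type*} [TopologicalSpace L₂] [ChartedSpace H₂ L₂] [IsManifold I₂ ∞ L₂]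

/-! ### Coordinate fields on a product -/

theorem tangentCoordChange_prod {p q z : L₁ × L₂}
    (h₁ : z.1 ∈ (extChartAt I₁ p.1).source ∩ (extChartAt I₁ q.1).source)
    (h₂ : z.2 ∈ (extChartAt I₂ p.2).source ∩ (extChartAt I₂ q.2).source) :
    tangentCoordChange (I₁.prod I₂) p q z =
      (tangentCoordChange I₁ p.1 q.1 z.1).prodMap (tangentCoordChange I₂ p.2 q.2 z.2) := by
  have h : z ∈ (extChartAt (I₁.prod I₂) p).source ∩ (extChartAt (I₁.prod I₂) q).source := by
    rw [extChartAt_prod, extChartAt_prod]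
    exact ⟨⟨h₁.1, h₂.1⟩, ⟨h₁.2, h₂.2⟩⟩
  have e := hasFDerivWithinAt_tangentCoordChange h
  have e₁ := hasFDerivWithinAt_tangentCoordChange h₁
  have e₂ := hasFDerivWithinAt_tangentCoordChange h₂
  rw [ModelWithCorners.range_eq_univ, hasFDerivWithinAt_univ] at e e₁ e₂
  have e' := HasFDerivAt.prodMap ((extChartAt I₁ p.1 z.1, extChartAt I₂ p.2 z.2) : E₁ × E₂) e₁ e₂
  have hz : extChartAt (I₁.prod I₂) p z = (extChartAt I₁ p.1 z.1, extChartAt I₂ p.2 z.2) := by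
    rw [extChartAt_prod]; rfl
  have hf : extChartAt (I₁.prod I₂) q ∘ (extChartAt (I₁.prod I₂) p).symm =
      Prod.map (extChartAt I₁ q.1 ∘ (extChartAt I₁ p.1).symm)
        (extChartAt I₂ q.2 ∘ (extChartAt I₂ p.2).symm) := by
    rw [extChartAt_prod, extChartAt_prod]; rfl
  rw [hz, hf] at e
  exact e.unique e'

omit [I₁.Boundaryless] in
theorem extend_eq_tangentCoordChange {x : L₁} (a : TangentSpace I₁ x) {y : L₁}
    (hy : y ∈ (trivializationAt E₁ (TangentSpace I₁ : L₁ → Type _) x).baseSet) :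
    FiberBundle.extend E₁ a y = tangentCoordChange I₁ x y y a := by
  rw [extend_eq_symmL _ hy, trivializationAt_self]
  exact congrArg (fun L : E₁ →L[ℝ] E₁ ↦ L a)
    (TangentBundle.symmL_trivializationAt_eq_core (I := I₁) hy)

/-- Coordinate fields of a product are pairs of coordinate fields. -/
theorem extend_prod (p : L₁ × L₂) (v : TangentSpace (I₁.prod I₂) p) :
    ∀ᶠ q in 𝓝 p, (FiberBundle.extend (E₁ × E₂) v q : E₁ × E₂) =
      ((FiberBundle.extend (B := L₁) (E := fun x ↦ TangentSpace I₁ x) (x := p.1) E₁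
          (v : E₁ × E₂).1 q.1 : E₁),
        (FiberBundle.extend (B := L₂) (E := fun x ↦ TangentSpace I₂ x) (x := p.2) E₂
          (v : E₁ × E₂).2 q.2 : E₂)) := by
  filter_upwards [continuousAt_fst.eventually (eventually_mem_baseSet_self (I := I₁) p.1),
    continuousAt_snd.eventually (eventually_mem_baseSet_self (I := I₂) p.2),
    eventually_mem_baseSet_self (I := I₁.prod I₂) p] with q h₁ h₂ h
  rw [extend_eq_tangentCoordChange _ h]
  refine Eq.trans ?_ (congrArg₂ Prod.mk (extend_eq_tangentCoordChange _ h₁).symm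
    (extend_eq_tangentCoordChange _ h₂).symm)
  exact congrArg (fun L : E₁ × E₂ →L[ℝ] E₁ × E₂ ↦ L v)
    (tangentCoordChange_prod (I₁ := I₁) (I₂ := I₂) (p := p) (q := q) (z := q)
    ⟨by rw [extChartAt_source]; exact h₁, mem_extChartAt_source q.1⟩
    ⟨by rw [extChartAt_source]; exact h₂, mem_extChartAt_source q.2⟩)

theorem mfderiv_fst_extend (p : L₁ × L₂) (v : TangentSpace (I₁.prod I₂) p) :
    ∀ᶠ q in 𝓝 p, mfderiv (I₁.prod I₂) I₁ Prod.fst q (FiberBundle.extend (E₁ × E₂) v q) =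
      FiberBundle.extend E₁ (mfderiv (I₁.prod I₂) I₁ Prod.fst p v) q.1 := by
  filter_upwards [extend_prod p v] with q hq
  rw [mfderiv_fst, mfderiv_fst]
  exact congrArg Prod.fst hq

theorem mfderiv_snd_extend (p : L₁ × L₂) (v : TangentSpace (I₁.prod I₂) p) :
    ∀ᶠ q in 𝓝 p, mfderiv (I₁.prod I₂) I₂ Prod.snd q (FiberBundle.extend (E₁ × E₂) v q) =
      FiberBundle.extend E₂ (mfderiv (I₁.prod I₂) I₂ Prod.snd p v) q.2 := by
  filter_upwards [extend_prod p v] with q hq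
  rw [mfderiv_snd, mfderiv_snd]
  exact congrArg Prod.snd hq

end Product

section Warped

open Filter Topology

variable {E₁ : Type*} [NormedAddCommGroup E₁] [NormedSpace ℝ E₁]
  {H₁ : Type*} [TopologicalSpace H₁] {I₁ : ModelWithCorners ℝ E₁ H₁}
  {L₁ : Type*} [TopologicalSpace L₁] [ChartedSpace H₁ L₁]
  {E₂ : Type*} [NormedAddCommGroup E₂] [NormedSpace ℝ E₂]
  {H₂ : Type*} [TopologicalSpace H₂] {I₂ : ModelWithCorners ℝ E₂ H₂}
  {L₂ : Type*} [TopologicalSpace L₂] [ChartedSpace H₂ L₂]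
  {E₃ : Type*} [NormedAddCommGroup E₃] [NormedSpace ℝ E₃]
  {H₃ : Type*} [TopologicalSpace H₃] {I₃ : ModelWithCorners ℝ E₃ H₃}
  {L₃ : Type*} [TopologicalSpace L₃] [ChartedSpace H₃ L₃]
  {p : L₁ × L₂ × L₃}

/-! ### Tangent vectors of a triple product -/

variable (I₁ I₂ I₃) in
/-- The tangent vector of `L₁ × L₂ × L₃` with given components. -/
def vec₃ (p : L₁ × L₂ × L₃) (a : TangentSpace I₁ p.1) (b : TangentSpace I₂ p.2.1)
    (c : TangentSpace I₃ p.2.2) : TangentSpace (model₃ I₁ I₂ I₃) p :=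
  ((a, b, c) : E₁ × E₂ × E₃)

theorem dpr₁_apply (u : TangentSpace (model₃ I₁ I₂ I₃) p) :
    dpr₁ I₁ I₂ I₃ p u = (u : E₁ × E₂ × E₃).1 :=
  congrArg (fun L : E₁ × E₂ × E₃ →L[ℝ] E₁ ↦ L u) (mfderiv_fst (I := I₁) (I' := I₂.prod I₃))

theorem dpr₂_eq_comp : dpr₂ I₁ I₂ I₃ p =
    (mfderiv (I₂.prod I₃) I₂ Prod.fst p.2).comp
      (mfderiv (I₁.prod (I₂.prod I₃)) (I₂.prod I₃) Prod.snd p) :=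
  mfderiv_comp p mdifferentiableAt_fst mdifferentiableAt_snd

theorem dpr₃_eq_comp : dpr₃ I₁ I₂ I₃ p =
    (mfderiv (I₂.prod I₃) I₃ Prod.snd p.2).comp
      (mfderiv (I₁.prod (I₂.prod I₃)) (I₂.prod I₃) Prod.snd p) :=
  mfderiv_comp p mdifferentiableAt_snd mdifferentiableAt_snd

theorem dpr₂_apply (u : TangentSpace (model₃ I₁ I₂ I₃) p) :
    dpr₂ I₁ I₂ I₃ p u = (u : E₁ × E₂ × E₃).2.1 := by
  rw [dpr₂_eq_comp, mfderiv_fst, mfderiv_snd]; rfl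

theorem dpr₃_apply (u : TangentSpace (model₃ I₁ I₂ I₃) p) :
    dpr₃ I₁ I₂ I₃ p u = (u : E₁ × E₂ × E₃).2.2 := by
  rw [dpr₃_eq_comp, mfderiv_snd, mfderiv_snd]; rfl

variable (a : TangentSpace I₁ p.1) (b : TangentSpace I₂ p.2.1) (c : TangentSpace I₃ p.2.2)

@[simp] theorem dpr₁_vec₃ : dpr₁ I₁ I₂ I₃ p (vec₃ I₁ I₂ I₃ p a b c) = a := dpr₁_apply _

@[simp] theorem dpr₂_vec₃ : dpr₂ I₁ I₂ I₃ p (vec₃ I₁ I₂ I₃ p a b c) = b := dpr₂_apply _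

@[simp] theorem dpr₃_vec₃ : dpr₃ I₁ I₂ I₃ p (vec₃ I₁ I₂ I₃ p a b c) = c := dpr₃_apply _

theorem vec₃_dpr (u : TangentSpace (model₃ I₁ I₂ I₃) p) :
    vec₃ I₁ I₂ I₃ p (dpr₁ I₁ I₂ I₃ p u) (dpr₂ I₁ I₂ I₃ p u) (dpr₃ I₁ I₂ I₃ p u) = u := by
  rw [dpr₁_apply, dpr₂_apply, dpr₃_apply]; rfl

theorem ext_dpr {u v : TangentSpace (model₃ I₁ I₂ I₃) p}
    (h₁ : dpr₁ I₁ I₂ I₃ p u = dpr₁ I₁ I₂ I₃ p v) (h₂ : dpr₂ I₁ I₂ I₃ p u = dpr₂ I₁ I₂ I₃ p v)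
    (h₃ : dpr₃ I₁ I₂ I₃ p u = dpr₃ I₁ I₂ I₃ p v) : u = v := by
  rw [← vec₃_dpr u, ← vec₃_dpr v, h₁, h₂, h₃]

theorem mem_dist₁_iff {u : TangentSpace (model₃ I₁ I₂ I₃) p} :
    u ∈ dist₁ I₁ I₂ I₃ p ↔ dpr₂ I₁ I₂ I₃ p u = 0 ∧ dpr₃ I₁ I₂ I₃ p u = 0 := Iff.rfl

theorem mem_dist₂_iff {u : TangentSpace (model₃ I₁ I₂ I₃) p} :
    u ∈ dist₂ I₁ I₂ I₃ p ↔ dpr₁ I₁ I₂ I₃ p u = 0 ∧ dpr₃ I₁ I₂ I₃ p u = 0 := Iff.rfl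

theorem mem_dist₃_iff {u : TangentSpace (model₃ I₁ I₂ I₃) p} :
    u ∈ dist₃ I₁ I₂ I₃ p ↔ dpr₁ I₁ I₂ I₃ p u = 0 ∧ dpr₂ I₁ I₂ I₃ p u = 0 := Iff.rfl

section Extend

variable [IsManifold I₁ ∞ L₁] [IsManifold I₂ ∞ L₂] [IsManifold I₃ ∞ L₃]
  [I₁.Boundaryless] [I₂.Boundaryless] [I₃.Boundaryless]

theorem dpr₁_extend (u : TangentSpace (model₃ I₁ I₂ I₃) p) :
    ∀ᶠ q in 𝓝 p, dpr₁ I₁ I₂ I₃ q (FiberBundle.extend (E₁ × E₂ × E₃) u q) =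
      FiberBundle.extend E₁ (dpr₁ I₁ I₂ I₃ p u) q.1 :=
  mfderiv_fst_extend p u

theorem dpr₂_extend (u : TangentSpace (model₃ I₁ I₂ I₃) p) :
    ∀ᶠ q in 𝓝 p, dpr₂ I₁ I₂ I₃ q (FiberBundle.extend (E₁ × E₂ × E₃) u q) =
      FiberBundle.extend E₂ (dpr₂ I₁ I₂ I₃ p u) q.2.1 := by
  filter_upwards [mfderiv_snd_extend (I₁ := I₁) (I₂ := I₂.prod I₃) p u,
    continuousAt_snd.eventually (mfderiv_fst_extend (I₁ := I₂) (I₂ := I₃) p.2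
      (mfderiv (I₁.prod (I₂.prod I₃)) (I₂.prod I₃) Prod.snd p u))] with q h h'
  rw [dpr₂_eq_comp, dpr₂_eq_comp]
  exact (congrArg _ h).trans h'

theorem dpr₃_extend (u : TangentSpace (model₃ I₁ I₂ I₃) p) :
    ∀ᶠ q in 𝓝 p, dpr₃ I₁ I₂ I₃ q (FiberBundle.extend (E₁ × E₂ × E₃) u q) =
      FiberBundle.extend E₃ (dpr₃ I₁ I₂ I₃ p u) q.2.2 := by
  filter_upwards [mfderiv_snd_extend (I₁ := I₁) (I₂ := I₂.prod I₃) p u,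
    continuousAt_snd.eventually (mfderiv_snd_extend (I₁ := I₂) (I₂ := I₃) p.2
      (mfderiv (I₁.prod (I₂.prod I₃)) (I₂.prod I₃) Prod.snd p u))] with q h h'
  rw [dpr₃_eq_comp, dpr₃_eq_comp]
  exact (congrArg _ h).trans h'

/-- The coordinate extension of a vector tangent to a copy of `L₁` stays tangent to the copies of
`L₁`. -/
theorem extend_mem_dist₁ {u : TangentSpace (model₃ I₁ I₂ I₃) p} (hu : u ∈ dist₁ I₁ I₂ I₃ p) :
    ∀ᶠ q in 𝓝 p, FiberBundle.extend (E₁ × E₂ × E₃) u q ∈ dist₁ I₁ I₂ I₃ q := by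
  filter_upwards [dpr₂_extend u, dpr₃_extend u,
    (continuous_fst.comp continuous_snd).continuousAt.eventually (extend_zero (I := I₂) p.2.1),
    (continuous_snd.comp continuous_snd).continuousAt.eventually (extend_zero (I := I₃) p.2.2)]
    with q h h' h₂ h₃
  rw [mem_dist₁_iff] at hu ⊢
  rw [h, h', hu.1, hu.2]
  exact ⟨h₂, h₃⟩

theorem extend_mem_dist₂ {u : TangentSpace (model₃ I₁ I₂ I₃) p} (hu : u ∈ dist₂ I₁ I₂ I₃ p) :
    ∀ᶠ q in 𝓝 p, FiberBundle.extend (E₁ × E₂ × E₃) u q ∈ dist₂ I₁ I₂ I₃ q := by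
  filter_upwards [dpr₁_extend u, dpr₃_extend u,
    continuous_fst.continuousAt.eventually (extend_zero (I := I₁) p.1),
    (continuous_snd.comp continuous_snd).continuousAt.eventually (extend_zero (I := I₃) p.2.2)]
    with q h h' h₂ h₃
  rw [mem_dist₂_iff] at hu ⊢
  rw [h, h', hu.1, hu.2]
  exact ⟨h₂, h₃⟩

theorem extend_mem_dist₃ {u : TangentSpace (model₃ I₁ I₂ I₃) p} (hu : u ∈ dist₃ I₁ I₂ I₃ p) :
    ∀ᶠ q in 𝓝 p, FiberBundle.extend (E₁ × E₂ × E₃) u q ∈ dist₃ I₁ I₂ I₃ q := by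
  filter_upwards [dpr₁_extend u, dpr₂_extend u,
    continuous_fst.continuousAt.eventually (extend_zero (I := I₁) p.1),
    (continuous_fst.comp continuous_snd).continuousAt.eventually (extend_zero (I := I₂) p.2.1)]
    with q h h' h₂ h₃
  rw [mem_dist₃_iff] at hu ⊢
  rw [h, h', hu.1, hu.2]
  exact ⟨h₂, h₃⟩

end Extend

end Warped

section WarpedMetric

open Filter Topology

variable {E₁ : Type*} [NormedAddCommGroup E₁] [NormedSpace ℝ E₁]
  {H₁ : Type*} [TopologicalSpace H₁] {I₁ : ModelWithCorners ℝ E₁ H₁}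
  {L₁ : Type*} [TopologicalSpace L₁] [ChartedSpace H₁ L₁] [IsManifold I₁ ∞ L₁]
  [RiemannianBundle (fun x : L₁ ↦ TangentSpace I₁ x)]
  {E₂ : Type*} [NormedAddCommGroup E₂] [NormedSpace ℝ E₂]
  {H₂ : Type*} [TopologicalSpace H₂] {I₂ : ModelWithCorners ℝ E₂ H₂}
  {L₂ : Type*} [TopologicalSpace L₂] [ChartedSpace H₂ L₂] [IsManifold I₂ ∞ L₂]
  [RiemannianBundle (fun x : L₂ ↦ TangentSpace I₂ x)]
  {E₃ : Type*} [NormedAddCommGroup E₃] [NormedSpace ℝ E₃]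
  {H₃ : Type*} [TopologicalSpace H₃] {I₃ : ModelWithCorners ℝ E₃ H₃}
  {L₃ : Type*} [TopologicalSpace L₃] [ChartedSpace H₃ L₃] [IsManifold I₃ ∞ L₃]
  [RiemannianBundle (fun x : L₃ ↦ TangentSpace I₃ x)]

/-! ### The derivative of a bi-warped product metric -/

/-- The derivative in the direction `u` of the inner product of the coordinate fields extending
`v` and `w`. -/
def metricDeriv {x : L₁} (u v w : TangentSpace I₁ x) : ℝ :=
  mvfderiv I₁ (fun y ↦ (inner ℝ (FiberBundle.extend E₁ v y) (FiberBundle.extend E₁ w y) : ℝ)) x u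

theorem mdifferentiableAt_inner_extend [FiniteDimensional ℝ E₁]
    [IsContMDiffRiemannianBundle I₁ ∞ E₁ (fun x : L₁ ↦ TangentSpace I₁ x)] {x : L₁}
    (v w : TangentSpace I₁ x) : MDifferentiableAt I₁ 𝓘(ℝ, ℝ)
      (fun y ↦ (inner ℝ (FiberBundle.extend E₁ v y) (FiberBundle.extend E₁ w y) : ℝ)) x :=
  DiffAlongAt.inner (F := (id : L₁ → L₁)) (FiberBundle.mdifferentiableAt_extend I₁ E₁ v)
    (FiberBundle.mdifferentiableAt_extend I₁ E₁ w)

@[simp] theorem metricDeriv_zero_left {x : L₁} (v w : TangentSpace I₁ x) :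
    metricDeriv 0 v w = 0 := by
  simp [metricDeriv]

@[simp] theorem metricDeriv_zero_middle {x : L₁} (u w : TangentSpace I₁ x) :
    metricDeriv u 0 w = 0 := by
  have h : (fun y ↦ (inner ℝ (FiberBundle.extend E₁ (0 : TangentSpace I₁ x) y)
      (FiberBundle.extend E₁ w y) : ℝ)) =ᶠ[𝓝 x] fun _ ↦ 0 := by
    filter_upwards [extend_zero (I := I₁) x] with y hy
    rw [hy, inner_zero_left]
  rw [metricDeriv, mvfderiv_congr h]
  exact congrArg (fun L : E₁ →L[ℝ] ℝ ↦ L u) mfderiv_const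

@[simp] theorem metricDeriv_zero_right {x : L₁} (u v : TangentSpace I₁ x) :
    metricDeriv u v 0 = 0 := by
  have h : (fun y ↦ (inner ℝ (FiberBundle.extend E₁ v y)
      (FiberBundle.extend E₁ (0 : TangentSpace I₁ x) y) : ℝ)) =ᶠ[𝓝 x] fun _ ↦ 0 := by
    filter_upwards [extend_zero (I := I₁) x] with y hy
    rw [hy, inner_zero_right]
  rw [metricDeriv, mvfderiv_congr h]
  exact congrArg (fun L : E₁ →L[ℝ] ℝ ↦ L u) mfderiv_const

omit [IsManifold I₁ ∞ L₁] [RiemannianBundle (fun x : L₁ ↦ TangentSpace I₁ x)] in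
/-- The logarithmic derivative of a squared warping function. -/
theorem mvfderiv_sq_eq_log {f : L₁ → ℝ} {x : L₁} (hf : MDifferentiableAt I₁ 𝓘(ℝ, ℝ) f x)
    (hpos : ∀ y, 0 < f y) (u : TangentSpace I₁ x) :
    mvfderiv I₁ (fun y ↦ f y ^ 2) x u =
      2 * f x ^ 2 * mvfderiv I₁ (fun y ↦ Real.log (f y)) x u := by
  have hlog : mvfderiv I₁ (fun y ↦ Real.log (f y)) x u = (f x)⁻¹ * mvfderiv I₁ f x u := by
    have h1 := (Real.hasDerivAt_log (hpos x).ne').hasFDerivAt.hasMFDerivAt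
    have h2 := (h1.comp x hf.hasMFDerivAt).mfderiv
    refine (congrArg (fun L : E₁ →L[ℝ] ℝ ↦ L u) h2).trans ?_
    exact (mul_comm _ _)
  have hsq : mvfderiv I₁ (fun y ↦ f y ^ 2) x u = 2 * f x * mvfderiv I₁ f x u := by
    simp only [pow_two]
    rw [mvfderiv_fun_mul hf hf, add_apply, smul_apply, smul_eq_mul]
    ring
  have := (hpos x).ne'
  rw [hsq, hlog]
  field_simp

variable [FiniteDimensional ℝ E₁] [FiniteDimensional ℝ E₂] [FiniteDimensional ℝ E₃]
  [IsContMDiffRiemannianBundle I₁ ∞ E₁ (fun x : L₁ ↦ TangentSpace I₁ x)]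
  [IsContMDiffRiemannianBundle I₂ ∞ E₂ (fun x : L₂ ↦ TangentSpace I₂ x)]
  [IsContMDiffRiemannianBundle I₃ ∞ E₃ (fun x : L₃ ↦ TangentSpace I₃ x)]
  [I₁.Boundaryless] [I₂.Boundaryless] [I₃.Boundaryless]
  {E : Type*} [NormedAddCommGroup E] [NormedSpace ℝ E]
  {H : Type*} [TopologicalSpace H] {I : ModelWithCorners ℝ E H}
  {M : Type*} [TopologicalSpace M] [ChartedSpace H M]
  [RiemannianBundle (fun x : M ↦ TangentSpace I x)]
  {f₁ f₂ : L₁ → ℝ} {F : L₁ × L₂ × L₃ → M} {p : L₁ × L₂ × L₃}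

/-- The derivative of the induced metric on coordinate fields. The coordinate fields of the product
are coordinate fields on each factor, so only the warping functions mix the factors. -/
theorem IsBiWarpedImmersion.mvfderiv_inner_mfderiv_extend
    (hF : IsBiWarpedImmersion I₁ I₂ I₃ I f₁ f₂ F) (u v w : TangentSpace (model₃ I₁ I₂ I₃) p) :
    mvfderiv (model₃ I₁ I₂ I₃) (fun q ↦ (inner ℝ
        (mfderiv (model₃ I₁ I₂ I₃) I F q (FiberBundle.extend (E₁ × E₂ × E₃) v q))
        (mfderiv (model₃ I₁ I₂ I₃) I F q (FiberBundle.extend (E₁ × E₂ × E₃) w q)) : ℝ)) p u =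
      metricDeriv (dpr₁ I₁ I₂ I₃ p u) (dpr₁ I₁ I₂ I₃ p v) (dpr₁ I₁ I₂ I₃ p w)
      + f₁ p.1 ^ 2 *
        (metricDeriv (dpr₂ I₁ I₂ I₃ p u) (dpr₂ I₁ I₂ I₃ p v) (dpr₂ I₁ I₂ I₃ p w)
          + 2 * mvfderiv I₁ (fun x ↦ Real.log (f₁ x)) p.1 (dpr₁ I₁ I₂ I₃ p u)
            * inner ℝ (dpr₂ I₁ I₂ I₃ p v) (dpr₂ I₁ I₂ I₃ p w))
      + f₂ p.1 ^ 2 *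
        (metricDeriv (dpr₃ I₁ I₂ I₃ p u) (dpr₃ I₁ I₂ I₃ p v) (dpr₃ I₁ I₂ I₃ p w)
          + 2 * mvfderiv I₁ (fun x ↦ Real.log (f₂ x)) p.1 (dpr₁ I₁ I₂ I₃ p u)
            * inner ℝ (dpr₃ I₁ I₂ I₃ p v) (dpr₃ I₁ I₂ I₃ p w)) := by
  have d₁ : MDifferentiableAt (model₃ I₁ I₂ I₃) I₁ (fun q : L₁ × L₂ × L₃ ↦ q.1) p :=
    mdifferentiableAt_fst
  have d₂ : MDifferentiableAt (model₃ I₁ I₂ I₃) I₂ (fun q : L₁ × L₂ × L₃ ↦ q.2.1) p :=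
    mdifferentiableAt_fst.comp p mdifferentiableAt_snd
  have d₃ : MDifferentiableAt (model₃ I₁ I₂ I₃) I₃ (fun q : L₁ × L₂ × L₃ ↦ q.2.2) p :=
    mdifferentiableAt_snd.comp p mdifferentiableAt_snd
  let g₁ : L₁ → ℝ := fun y ↦ inner ℝ (FiberBundle.extend E₁ (dpr₁ I₁ I₂ I₃ p v) y)
    (FiberBundle.extend E₁ (dpr₁ I₁ I₂ I₃ p w) y)
  let g₂ : L₂ → ℝ := fun y ↦ inner ℝ (FiberBundle.extend E₂ (dpr₂ I₁ I₂ I₃ p v) y)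
    (FiberBundle.extend E₂ (dpr₂ I₁ I₂ I₃ p w) y)
  let g₃ : L₃ → ℝ := fun y ↦ inner ℝ (FiberBundle.extend E₃ (dpr₃ I₁ I₂ I₃ p v) y)
    (FiberBundle.extend E₃ (dpr₃ I₁ I₂ I₃ p w) y)
  have hg₁ : MDifferentiableAt I₁ 𝓘(ℝ, ℝ) g₁ p.1 := mdifferentiableAt_inner_extend _ _
  have hg₂ : MDifferentiableAt I₂ 𝓘(ℝ, ℝ) g₂ p.2.1 := mdifferentiableAt_inner_extend _ _
  have hg₃ : MDifferentiableAt I₃ 𝓘(ℝ, ℝ) g₃ p.2.2 := mdifferentiableAt_inner_extend _ _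
  have hf₁ : MDifferentiableAt I₁ 𝓘(ℝ, ℝ) f₁ p.1 := hF.smooth_f₁.mdifferentiableAt (by simp)
  have hf₂ : MDifferentiableAt I₁ 𝓘(ℝ, ℝ) f₂ p.1 := hF.smooth_f₂.mdifferentiableAt (by simp)
  have hs₁ : MDifferentiableAt I₁ 𝓘(ℝ, ℝ) (fun x ↦ f₁ x ^ 2) p.1 := by
    simp only [pow_two]; exact hf₁.mul hf₁
  have hs₂ : MDifferentiableAt I₁ 𝓘(ℝ, ℝ) (fun x ↦ f₂ x ^ 2) p.1 := by
    simp only [pow_two]; exact hf₂.mul hf₂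
  have hev : (fun q ↦ (inner ℝ
      (mfderiv (model₃ I₁ I₂ I₃) I F q (FiberBundle.extend (E₁ × E₂ × E₃) v q))
      (mfderiv (model₃ I₁ I₂ I₃) I F q (FiberBundle.extend (E₁ × E₂ × E₃) w q)) : ℝ)) =ᶠ[𝓝 p]
      fun q ↦ g₁ q.1 + f₁ q.1 ^ 2 * g₂ q.2.1 + f₂ q.1 ^ 2 * g₃ q.2.2 := by
    filter_upwards [dpr₁_extend v, dpr₂_extend v, dpr₃_extend v,
      dpr₁_extend w, dpr₂_extend w, dpr₃_extend w] with q h1 h2 h3 h4 h5 h6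
    rw [hF.isometric, h1, h2, h3, h4, h5, h6]
  have c₁ : MDifferentiableAt (model₃ I₁ I₂ I₃) 𝓘(ℝ, ℝ)
    (fun q : L₁ × L₂ × L₃ ↦ g₁ q.1) p := MDifferentiableAt.comp p hg₁ d₁
  have c₂ : MDifferentiableAt (model₃ I₁ I₂ I₃) 𝓘(ℝ, ℝ)
    (fun q : L₁ × L₂ × L₃ ↦ g₂ q.2.1) p := MDifferentiableAt.comp p hg₂ d₂
  have c₃ : MDifferentiableAt (model₃ I₁ I₂ I₃) 𝓘(ℝ, ℝ)
    (fun q : L₁ × L₂ × L₃ ↦ g₃ q.2.2) p := MDifferentiableAt.comp p hg₃ d₃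
  have cs₁ : MDifferentiableAt (model₃ I₁ I₂ I₃) 𝓘(ℝ, ℝ)
    (fun q : L₁ × L₂ × L₃ ↦ f₁ q.1 ^ 2) p := MDifferentiableAt.comp p hs₁ d₁
  have cs₂ : MDifferentiableAt (model₃ I₁ I₂ I₃) 𝓘(ℝ, ℝ)
    (fun q : L₁ × L₂ × L₃ ↦ f₂ q.1 ^ 2) p := MDifferentiableAt.comp p hs₂ d₁
  have e₁ : mvfderiv (model₃ I₁ I₂ I₃) (fun q : L₁ × L₂ × L₃ ↦ g₁ q.1) p u =
    mvfderiv I₁ g₁ p.1 (dpr₁ I₁ I₂ I₃ p u) := mfderiv_comp_apply p hg₁ d₁ u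
  have e₂ : mvfderiv (model₃ I₁ I₂ I₃) (fun q : L₁ × L₂ × L₃ ↦ g₂ q.2.1) p u =
    mvfderiv I₂ g₂ p.2.1 (dpr₂ I₁ I₂ I₃ p u) := mfderiv_comp_apply (g := g₂) p hg₂ d₂ u
  have e₃ : mvfderiv (model₃ I₁ I₂ I₃) (fun q : L₁ × L₂ × L₃ ↦ g₃ q.2.2) p u =
    mvfderiv I₃ g₃ p.2.2 (dpr₃ I₁ I₂ I₃ p u) := mfderiv_comp_apply (g := g₃) p hg₃ d₃ u
  have es₁ : mvfderiv (model₃ I₁ I₂ I₃) (fun q : L₁ × L₂ × L₃ ↦ f₁ q.1 ^ 2) p u =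
    mvfderiv I₁ (fun x ↦ f₁ x ^ 2) p.1 (dpr₁ I₁ I₂ I₃ p u) := mfderiv_comp_apply p hs₁ d₁ u
  have es₂ : mvfderiv (model₃ I₁ I₂ I₃) (fun q : L₁ × L₂ × L₃ ↦ f₂ q.1 ^ 2) p u =
    mvfderiv I₁ (fun x ↦ f₂ x ^ 2) p.1 (dpr₁ I₁ I₂ I₃ p u) := mfderiv_comp_apply p hs₂ d₁ u
  rw [mvfderiv_sq_eq_log hf₁ hF.pos_f₁] at es₁
  rw [mvfderiv_sq_eq_log hf₂ hF.pos_f₂] at es₂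
  have t₂ : g₂ p.2.1 = inner ℝ (dpr₂ I₁ I₂ I₃ p v) (dpr₂ I₁ I₂ I₃ p w) := by
    simp only [g₂, FiberBundle.extend_apply_self]
  have t₃ : g₃ p.2.2 = inner ℝ (dpr₃ I₁ I₂ I₃ p v) (dpr₃ I₁ I₂ I₃ p w) := by
    simp only [g₃, FiberBundle.extend_apply_self]
  have m₁ : MDifferentiableAt (model₃ I₁ I₂ I₃) 𝓘(ℝ, ℝ)
    (fun q : L₁ × L₂ × L₃ ↦ f₁ q.1 ^ 2 * g₂ q.2.1) p := cs₁.mul c₂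
  have m₂ : MDifferentiableAt (model₃ I₁ I₂ I₃) 𝓘(ℝ, ℝ)
    (fun q : L₁ × L₂ × L₃ ↦ f₂ q.1 ^ 2 * g₃ q.2.2) p := cs₂.mul c₃
  have m₃ : MDifferentiableAt (model₃ I₁ I₂ I₃) 𝓘(ℝ, ℝ)
    (fun q : L₁ × L₂ × L₃ ↦ g₁ q.1 + f₁ q.1 ^ 2 * g₂ q.2.1) p := c₁.add m₁
  rw [mvfderiv_congr hev, mvfderiv_fun_add m₃ m₂, add_apply, mvfderiv_fun_add c₁ m₁, add_apply, mvfderiv_fun_mul cs₁ c₂, mvfderiv_fun_mul cs₂ c₃,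
    add_apply, add_apply, smul_apply, smul_apply, smul_apply, smul_apply, e₁, e₂, e₃, es₁, es₂,
    t₂, t₃]
  simp only [metricDeriv, smul_eq_mul, g₁, g₂, g₃]
  ring

end WarpedMetric

section WarpedHessian

variable {E₁ : Type*} [NormedAddCommGroup E₁] [NormedSpace ℝ E₁]
  {H₁ : Type*} [TopologicalSpace H₁] {I₁ : ModelWithCorners ℝ E₁ H₁}
  {L₁ : Type*} [TopologicalSpace L₁] [ChartedSpace H₁ L₁] [IsManifold I₁ ∞ L₁]
  [RiemannianBundle (fun x : L₁ ↦ TangentSpace I₁ x)]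
  {E₂ : Type*} [NormedAddCommGroup E₂] [NormedSpace ℝ E₂]
  {H₂ : Type*} [TopologicalSpace H₂] {I₂ : ModelWithCorners ℝ E₂ H₂}
  {L₂ : Type*} [TopologicalSpace L₂] [ChartedSpace H₂ L₂] [IsManifold I₂ ∞ L₂]
  [RiemannianBundle (fun x : L₂ ↦ TangentSpace I₂ x)]
  {E₃ : Type*} [NormedAddCommGroup E₃] [NormedSpace ℝ E₃]
  {H₃ : Type*} [TopologicalSpace H₃] {I₃ : ModelWithCorners ℝ E₃ H₃}
  {L₃ : Type*} [TopologicalSpace L₃] [ChartedSpace H₃ L₃] [IsManifold I₃ ∞ L₃]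
  [RiemannianBundle (fun x : L₃ ↦ TangentSpace I₃ x)]
  {E : Type*} [NormedAddCommGroup E] [NormedSpace ℝ E]
  {H : Type*} [TopologicalSpace H] {I : ModelWithCorners ℝ E H}
  {M : Type*} [TopologicalSpace M] [ChartedSpace H M] [IsManifold I ∞ M]
  [RiemannianBundle (fun x : M ↦ TangentSpace I x)]
  {f₁ f₂ : L₁ → ℝ} {F : L₁ × L₂ × L₃ → M} {p : L₁ × L₂ × L₃}

/-! ### The tangential part of the second derivative of a bi-warped immersion -/

omit [IsManifold I₁ ∞ L₁] [IsManifold I₂ ∞ L₂] [IsManifold I₃ ∞ L₃] [IsManifold I ∞ M] in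
theorem IsBiWarpedImmersion.inner_of_mem_dist₂
    (hF : IsBiWarpedImmersion I₁ I₂ I₃ I f₁ f₂ F) {u : TangentSpace (model₃ I₁ I₂ I₃) p}
    (hu : u ∈ dist₂ I₁ I₂ I₃ p) (w : TangentSpace (model₃ I₁ I₂ I₃) p) :
    (inner ℝ (mfderiv (model₃ I₁ I₂ I₃) I F p u) (mfderiv (model₃ I₁ I₂ I₃) I F p w) : ℝ) =
      f₁ p.1 ^ 2 * inner ℝ (dpr₂ I₁ I₂ I₃ p u) (dpr₂ I₁ I₂ I₃ p w) := by
  rw [mem_dist₂_iff] at hu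
  rw [hF.isometric, hu.1, hu.2]
  simp

omit [IsManifold I₁ ∞ L₁] [IsManifold I₂ ∞ L₂] [IsManifold I₃ ∞ L₃] [IsManifold I ∞ M] in
theorem IsBiWarpedImmersion.inner_of_mem_dist₃
    (hF : IsBiWarpedImmersion I₁ I₂ I₃ I f₁ f₂ F) {u : TangentSpace (model₃ I₁ I₂ I₃) p}
    (hu : u ∈ dist₃ I₁ I₂ I₃ p) (w : TangentSpace (model₃ I₁ I₂ I₃) p) :
    (inner ℝ (mfderiv (model₃ I₁ I₂ I₃) I F p u) (mfderiv (model₃ I₁ I₂ I₃) I F p w) : ℝ) =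
      f₂ p.1 ^ 2 * inner ℝ (dpr₃ I₁ I₂ I₃ p u) (dpr₃ I₁ I₂ I₃ p w) := by
  rw [mem_dist₃_iff] at hu
  rw [hF.isometric, hu.1, hu.2]
  simp

omit [IsManifold I₁ ∞ L₁] [IsManifold I₂ ∞ L₂] [IsManifold I₃ ∞ L₃] [IsManifold I ∞ M] in
theorem IsBiWarpedImmersion.inner_of_mem_dist₁
    (hF : IsBiWarpedImmersion I₁ I₂ I₃ I f₁ f₂ F) {u : TangentSpace (model₃ I₁ I₂ I₃) p}
    (hu : u ∈ dist₁ I₁ I₂ I₃ p) (w : TangentSpace (model₃ I₁ I₂ I₃) p) :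
    (inner ℝ (mfderiv (model₃ I₁ I₂ I₃) I F p u) (mfderiv (model₃ I₁ I₂ I₃) I F p w) : ℝ) =
      inner ℝ (dpr₁ I₁ I₂ I₃ p u) (dpr₁ I₁ I₂ I₃ p w) := by
  rw [mem_dist₁_iff] at hu
  rw [hF.isometric, hu.1, hu.2]
  simp

variable [FiniteDimensional ℝ E₁] [FiniteDimensional ℝ E₂] [FiniteDimensional ℝ E₃]
  [FiniteDimensional ℝ E]
  [IsContMDiffRiemannianBundle I₁ ∞ E₁ (fun x : L₁ ↦ TangentSpace I₁ x)]
  [IsContMDiffRiemannianBundle I₂ ∞ E₂ (fun x : L₂ ↦ TangentSpace I₂ x)]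
  [IsContMDiffRiemannianBundle I₃ ∞ E₃ (fun x : L₃ ↦ TangentSpace I₃ x)]
  [IsContMDiffRiemannianBundle I ∞ E (fun x : M ↦ TangentSpace I x)]
  [I₁.Boundaryless] [I₂.Boundaryless] [I₃.Boundaryless]
  {nabla : CovariantDerivative I E (TangentSpace I : M → Type _)}
  {x x' v v' w : TangentSpace (model₃ I₁ I₂ I₃) p}

/-- Differentiating a vector of the third factor along the first one multiplies it, up to normal
terms, by the logarithmic derivative of the warping function. -/
theorem IsBiWarpedImmersion.inner_mapHessian₁₃ (hF : IsBiWarpedImmersion I₁ I₂ I₃ I f₁ f₂ F)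
    (hnabla : IsLeviCivita nabla) (hx : x ∈ dist₁ I₁ I₂ I₃ p) (hv : v ∈ dist₃ I₁ I₂ I₃ p)
    (w : TangentSpace (model₃ I₁ I₂ I₃) p) :
    (inner ℝ (mapHessian (model₃ I₁ I₂ I₃) nabla F p x v)
        (mfderiv (model₃ I₁ I₂ I₃) I F p w) : ℝ) =
      mvfderiv I₁ (fun x ↦ Real.log (f₂ x)) p.1 (dpr₁ I₁ I₂ I₃ p x) *
        inner ℝ (mfderiv (model₃ I₁ I₂ I₃) I F p v) (mfderiv (model₃ I₁ I₂ I₃) I F p w) := by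
  have key := two_mul_inner_mapHessian hnabla hF.smooth x v w
  rw [hF.inner_of_mem_dist₃ hv]
  rw [mem_dist₁_iff] at hx
  rw [mem_dist₃_iff] at hv
  rw [hF.mvfderiv_inner_mfderiv_extend, hF.mvfderiv_inner_mfderiv_extend,
    hF.mvfderiv_inner_mfderiv_extend, hx.1, hx.2, hv.1, hv.2] at key
  simp at key
  linarith

/-- The slices of the first factor are totally geodesic in the product. -/
theorem IsBiWarpedImmersion.inner_mapHessian₁₁ (hF : IsBiWarpedImmersion I₁ I₂ I₃ I f₁ f₂ F)
    (hnabla : IsLeviCivita nabla) (hx : x ∈ dist₁ I₁ I₂ I₃ p) (hx' : x' ∈ dist₁ I₁ I₂ I₃ p)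
    (hw : dpr₁ I₁ I₂ I₃ p w = 0) :
    (inner ℝ (mapHessian (model₃ I₁ I₂ I₃) nabla F p x x')
        (mfderiv (model₃ I₁ I₂ I₃) I F p w) : ℝ) = 0 := by
  have key := two_mul_inner_mapHessian hnabla hF.smooth x x' w
  rw [mem_dist₁_iff] at hx hx'
  rw [hF.mvfderiv_inner_mfderiv_extend, hF.mvfderiv_inner_mfderiv_extend,
    hF.mvfderiv_inner_mfderiv_extend, hx.1, hx.2, hx'.1, hx'.2, hw] at key
  simpa using key

/-- The slices of the second factor are totally umbilical in the product, with mean curvature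
`-∇ ln f₁`. -/
theorem IsBiWarpedImmersion.inner_mapHessian₂₂ (hF : IsBiWarpedImmersion I₁ I₂ I₃ I f₁ f₂ F)
    (hnabla : IsLeviCivita nabla) (hv : v ∈ dist₂ I₁ I₂ I₃ p) (hv' : v' ∈ dist₂ I₁ I₂ I₃ p)
    (hw : dpr₂ I₁ I₂ I₃ p w = 0) :
    (inner ℝ (mapHessian (model₃ I₁ I₂ I₃) nabla F p v v')
        (mfderiv (model₃ I₁ I₂ I₃) I F p w) : ℝ) =
      -mvfderiv I₁ (fun x ↦ Real.log (f₁ x)) p.1 (dpr₁ I₁ I₂ I₃ p w) *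
        inner ℝ (mfderiv (model₃ I₁ I₂ I₃) I F p v) (mfderiv (model₃ I₁ I₂ I₃) I F p v') := by
  have key := two_mul_inner_mapHessian hnabla hF.smooth v v' w
  rw [hF.inner_of_mem_dist₂ hv]
  rw [mem_dist₂_iff] at hv hv'
  rw [hF.mvfderiv_inner_mfderiv_extend, hF.mvfderiv_inner_mfderiv_extend,
    hF.mvfderiv_inner_mfderiv_extend, hv.1, hv.2, hv'.1, hv'.2, hw] at key
  simp at key
  linarith

/-- The slices of the third factor are totally umbilical in the product, with mean curvature
`-∇ ln f₂`. -/
theorem IsBiWarpedImmersion.inner_mapHessian₃₃ (hF : IsBiWarpedImmersion I₁ I₂ I₃ I f₁ f₂ F)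
    (hnabla : IsLeviCivita nabla) (hv : v ∈ dist₃ I₁ I₂ I₃ p) (hv' : v' ∈ dist₃ I₁ I₂ I₃ p)
    (hw : dpr₃ I₁ I₂ I₃ p w = 0) :
    (inner ℝ (mapHessian (model₃ I₁ I₂ I₃) nabla F p v v')
        (mfderiv (model₃ I₁ I₂ I₃) I F p w) : ℝ) =
      -mvfderiv I₁ (fun x ↦ Real.log (f₂ x)) p.1 (dpr₁ I₁ I₂ I₃ p w) *
        inner ℝ (mfderiv (model₃ I₁ I₂ I₃) I F p v) (mfderiv (model₃ I₁ I₂ I₃) I F p v') := by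
  have key := two_mul_inner_mapHessian hnabla hF.smooth v v' w
  rw [hF.inner_of_mem_dist₃ hv]
  rw [mem_dist₃_iff] at hv hv'
  rw [hF.mvfderiv_inner_mfderiv_extend, hF.mvfderiv_inner_mfderiv_extend,
    hF.mvfderiv_inner_mfderiv_extend, hv.1, hv.2, hv'.1, hv'.2, hw] at key
  simp at key
  linarith

end WarpedHessian

section Contact

open Filter Topology

variable {E : Type*} [NormedAddCommGroup E] [NormedSpace ℝ E]
  {H : Type*} [TopologicalSpace H] {I : ModelWithCorners ℝ E H}
  {M : Type*} [TopologicalSpace M] [ChartedSpace H M] [IsManifold I ∞ M]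
  [RiemannianBundle (fun x : M ↦ TangentSpace I x)]
  {Phi : ∀ x : M, TangentSpace I x →L[ℝ] TangentSpace I x}
  {xi : ∀ x : M, TangentSpace I x} {eta : ∀ x : M, TangentSpace I x →L[ℝ] ℝ} {beta : M → ℝ}

/-! ### Almost contact metric algebra, and its derivative along an immersion -/

namespace IsAlmostContactMetric

variable (hM : IsAlmostContactMetric Phi xi eta)
include hM

theorem eta_eq_inner (x : M) (X : TangentSpace I x) : eta x X = inner ℝ (xi x) X := by
  have h := hM.inner_Phi x (xi x) X
  rw [hM.Phi_xi, inner_zero_left, hM.eta_xi] at h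
  linarith

theorem inner_Phi_left (x : M) (X Y : TangentSpace I x) :
    (inner ℝ (Phi x X) Y : ℝ) = -inner ℝ X (Phi x Y) := by
  have h := hM.inner_Phi x X (Phi x Y)
  rw [hM.Phi_sq, hM.eta_Phi, inner_add_right, inner_neg_right, inner_smul_right,
    real_inner_comm (xi x), ← hM.eta_eq_inner, hM.eta_Phi, real_inner_comm Y] at h
  rw [real_inner_comm]
  linarith

theorem norm_sq_Phi (x : M) (X : TangentSpace I x) :
    ‖Phi x X‖ ^ 2 = ‖X‖ ^ 2 - inner ℝ (xi x) X ^ 2 := by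
  rw [← real_inner_self_eq_norm_sq, hM.inner_Phi, real_inner_self_eq_norm_sq, hM.eta_eq_inner]
  ring

theorem norm_sq_xi (x : M) : ‖xi x‖ ^ 2 = 1 := by
  rw [← real_inner_self_eq_norm_sq, ← hM.eta_eq_inner, hM.eta_xi]

end IsAlmostContactMetric

variable {E' : Type*} [NormedAddCommGroup E'] [NormedSpace ℝ E'] [FiniteDimensional ℝ E]
  [IsContMDiffRiemannianBundle I ∞ E (fun x : M ↦ TangentSpace I x)]
  {H' : Type*} [TopologicalSpace H'] {J : ModelWithCorners ℝ E' H'} [J.Boundaryless]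
  {N : Type*} [TopologicalSpace N] [ChartedSpace H' N] [IsManifold J ∞ N]
  {F : N → M} {p : N} {nabla : CovariantDerivative I E (TangentSpace I : M → Type _)}

namespace IsLocConfAlmostCosymplectic

/-- The derivative of the relation `⟪Φ X, W⟫ = 0` between coordinate fields. -/
theorem inner_mapHessian_Phi (hM : IsLocConfAlmostCosymplectic nabla Phi xi eta beta)
    (hnabla : IsLeviCivita nabla) (hF : ContMDiff J I ∞ F) (v : TangentSpace J p)
    {x w : TangentSpace J p}
    (h : ∀ᶠ q in 𝓝 p, (inner ℝ (Phi (F q) (mfderiv J I F q (FiberBundle.extend E' x q)))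
      (mfderiv J I F q (FiberBundle.extend E' w q)) : ℝ) = 0) :
    (inner ℝ (mapHessian J nabla F p v x) (Phi (F p) (mfderiv J I F p w)) : ℝ) =
      inner ℝ (Phi (F p) (mfderiv J I F p x)) (mapHessian J nabla F p v w)
      + beta (F p) * (inner ℝ (Phi (F p) (mfderiv J I F p v)) (mfderiv J I F p x)
            * inner ℝ (xi (F p)) (mfderiv J I F p w)
          - inner ℝ (xi (F p)) (mfderiv J I F p x)
            * inner ℝ (Phi (F p) (mfderiv J I F p v)) (mfderiv J I F p w)) := by
  have hx := diffAlongAt_mfderiv_extend (I := I) hF x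
  have key := mvfderiv_inner_along hnabla (hM.diffAlongAt_Phi hx)
    (diffAlongAt_mfderiv_extend (I := I) hF w) v
  have h0 : mvfderiv J (fun q ↦ (inner ℝ
      (Phi (F q) (mfderiv J I F q (FiberBundle.extend E' x q)))
      (mfderiv J I F q (FiberBundle.extend E' w q)) : ℝ)) p v = 0 := by
    rw [mvfderiv_congr (g' := fun _ ↦ (0 : ℝ)) h]
    exact congrArg (fun L : E' →L[ℝ] ℝ ↦ L v) mfderiv_const
  rw [h0, hM.covDerivAlong_Phi hx] at key
  change 0 = inner ℝ (Phi (F p) (mapHessian J nabla F p v x) + _) _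
    + inner ℝ _ (mapHessian J nabla F p v w) at key
  simp only [FiberBundle.extend_apply_self] at key
  rw [inner_add_left, hM.inner_Phi_left, real_inner_smul_left, inner_sub_left,
    real_inner_smul_left, real_inner_smul_left, hM.eta_eq_inner] at key
  linarith

/-- The derivative of the relation `⟪ξ, W⟫ = 0`. -/
theorem inner_mapHessian_xi (hM : IsLocConfAlmostCosymplectic nabla Phi xi eta beta)
    (hnabla : IsLeviCivita nabla) (hF : ContMDiff J I ∞ F) (v : TangentSpace J p)
    {w : TangentSpace J p}
    (h : ∀ᶠ q in 𝓝 p, (inner ℝ (xi (F q))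
      (mfderiv J I F q (FiberBundle.extend E' w q)) : ℝ) = 0) :
    (inner ℝ (xi (F p)) (mapHessian J nabla F p v w) : ℝ) =
      -(beta (F p) * inner ℝ (mfderiv J I F p v) (mfderiv J I F p w)) := by
  have hFp : MDifferentiableAt J I F p := hF.mdifferentiableAt (by simp)
  have key := mvfderiv_inner_along hnabla
    (DiffAlongAt.of_section hFp (hM.smooth_xi.mdifferentiableAt (by simp)))
    (diffAlongAt_mfderiv_extend (I := I) hF w) v
  have h0 : mvfderiv J (fun q ↦ (inner ℝ (xi (F q))
      (mfderiv J I F q (FiberBundle.extend E' w q)) : ℝ)) p v = 0 := by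
    rw [mvfderiv_congr (g' := fun _ ↦ (0 : ℝ)) h]
    exact congrArg (fun L : E' →L[ℝ] ℝ ↦ L v) mfderiv_const
  have h1 := h.self_of_nhds
  rw [h0, hM.covDerivAlong_xi hFp] at key
  change 0 = _ + inner ℝ _ (mapHessian J nabla F p v w) at key
  simp only [FiberBundle.extend_apply_self] at key h1
  rw [real_inner_smul_left, inner_sub_left, real_inner_smul_left, h1] at key
  linarith

end IsLocConfAlmostCosymplectic

omit [IsManifold I ∞ M] [IsContMDiffRiemannianBundle I ∞ E (fun x : M ↦ TangentSpace I x)] in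
theorem inner_riemGrad (f : M → ℝ) (x : M) (v : TangentSpace I x) :
    (inner ℝ (riemGrad f x) v : ℝ) = mvfderiv I f x v := by
  have : FiniteDimensional ℝ (TangentSpace I x) := inferInstanceAs (FiniteDimensional ℝ E)
  have : CompleteSpace (TangentSpace I x) := FiniteDimensional.complete ℝ _
  exact InnerProductSpace.toDual_symm_apply

end Contact

section LinearAlgebra

open Module Submodule

variable {V : Type*} [NormedAddCommGroup V] [InnerProductSpace ℝ V] [FiniteDimensional ℝ V]

/-! ### Sums of squares over orthonormal bases -/

theorem sum_norm_sq_apply_eq_of_orthonormalBasis {S W ι κ : Type*} [NormedAddCommGroup S]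
    [InnerProductSpace ℝ S] [NormedAddCommGroup W] [InnerProductSpace ℝ W] [Fintype ι] [Fintype κ]
    (e : OrthonormalBasis ι ℝ S) (f : OrthonormalBasis κ ℝ S) (L : S →ₗ[ℝ] W) :
    ∑ i, ‖L (e i)‖ ^ 2 = ∑ k, ‖L (f k)‖ ^ 2 := by
  have h (i : ι) : ‖L (e i)‖ ^ 2 =
      ∑ k, ∑ l, inner ℝ (f k) (e i) * inner ℝ (e i) (f l) * inner ℝ (L (f k)) (L (f l)) := by
    conv_lhs => rw [← real_inner_self_eq_norm_sq, ← f.sum_repr' (e i)]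
    simp only [map_sum, map_smul, sum_inner, inner_sum, real_inner_smul_left,
      real_inner_smul_right]
    refine Finset.sum_congr rfl fun k _ ↦ Finset.sum_congr rfl fun l _ ↦ ?_
    rw [real_inner_comm (e i) (f l), real_inner_comm (L (f k)) (L (f l))]
    ring
  simp only [h]
  rw [Finset.sum_comm]
  refine Finset.sum_congr rfl fun k _ ↦ ?_
  rw [Finset.sum_comm]
  simp only [← Finset.sum_mul, e.sum_inner_mul_inner]
  classical
  simp only [orthonormal_iff_ite.1 f.orthonormal]
  simp

/-- The sum of the squares of a linear map over an orthonormal family only depends on its span. -/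
theorem sum_norm_sq_stdOrthonormalBasis {W ι : Type*} [NormedAddCommGroup W]
    [InnerProductSpace ℝ W] [Fintype ι] {S : Submodule ℝ V} {e : ι → V} (he : Orthonormal ℝ e)
    (hS : span ℝ (Set.range e) = S) (L : V →ₗ[ℝ] W) :
    ∑ i, ‖L (stdOrthonormalBasis ℝ S i)‖ ^ 2 = ∑ i, ‖L (e i)‖ ^ 2 := by
  have hmem (i : ι) : e i ∈ S := hS ▸ subset_span ⟨i, rfl⟩
  let e' : ι → S := fun i ↦ ⟨e i, hmem i⟩
  have hon : Orthonormal ℝ e' := he.codRestrict S hmem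
  have hsp : ⊤ ≤ span ℝ (Set.range e') := by
    rw [← map_le_map_iff_of_injective S.injective_subtype, map_span, ← Set.range_comp]
    change map S.subtype ⊤ ≤ span ℝ (Set.range e)
    rw [hS, Submodule.map_top, range_subtype]
  have := sum_norm_sq_apply_eq_of_orthonormalBasis (stdOrthonormalBasis ℝ S)
    (OrthonormalBasis.mk hon hsp) (L ∘ₗ S.subtype)
  simpa [e'] using this

/-- The sum of the squared norms of the values of a bilinear map on orthonormal bases of two
subspaces. -/
def formNormSq (h : V →ₗ[ℝ] V →ₗ[ℝ] V) (A B : Submodule ℝ V) : ℝ :=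
  ∑ i, ∑ j, ‖h (stdOrthonormalBasis ℝ A i) (stdOrthonormalBasis ℝ B j)‖ ^ 2

variable {h : V →ₗ[ℝ] V →ₗ[ℝ] V} {A B C : Submodule ℝ V}

theorem formNormSq_nonneg (h : V →ₗ[ℝ] V →ₗ[ℝ] V) (A B : Submodule ℝ V) :
    0 ≤ formNormSq h A B :=
  Finset.sum_nonneg fun _ _ ↦ Finset.sum_nonneg fun _ _ ↦ sq_nonneg _

theorem formNormSq_comm (hs : ∀ a ∈ A, ∀ b ∈ B, h a b = h b a) :
    formNormSq h A B = formNormSq h B A := by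
  rw [formNormSq, Finset.sum_comm]
  refine Finset.sum_congr rfl fun j _ ↦ Finset.sum_congr rfl fun i _ ↦ ?_
  rw [hs _ (SetLike.coe_mem _) _ (SetLike.coe_mem _)]

theorem formNormSq_eq_zero_iff :
    formNormSq h A B = 0 ↔ ∀ a ∈ A, ∀ b ∈ B, h a b = 0 := by
  constructor
  · intro h0
    have h1 (i) (j) : h (stdOrthonormalBasis ℝ A i) (stdOrthonormalBasis ℝ B j) = 0 := by
      have h2 := (Finset.sum_eq_zero_iff_of_nonneg fun i _ ↦
        Finset.sum_nonneg fun j _ ↦ sq_nonneg _).1 h0 i (Finset.mem_univ _)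
      have h3 := (Finset.sum_eq_zero_iff_of_nonneg fun j _ ↦ sq_nonneg _).1 h2 j (Finset.mem_univ _)
      simpa using h3
    intro a ha b hb
    have ea := congrArg Subtype.val ((stdOrthonormalBasis ℝ A).sum_repr ⟨a, ha⟩)
    have eb := congrArg Subtype.val ((stdOrthonormalBasis ℝ B).sum_repr ⟨b, hb⟩)
    simp only [coe_sum, coe_smul] at ea eb
    rw [← ea, ← eb]
    simp [h1]
  · intro h0
    simp [formNormSq, h0 _ (SetLike.coe_mem _) _ (SetLike.coe_mem _)]

theorem formNormSq_sup_left (hAB : A ⟂ B) :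
    formNormSq h (A ⊔ B) C = formNormSq h A C + formNormSq h B C := by
  let a : Fin (finrank ℝ A) → V := fun i ↦ stdOrthonormalBasis ℝ A i
  let b : Fin (finrank ℝ B) → V := fun i ↦ stdOrthonormalBasis ℝ B i
  have ha : Orthonormal ℝ a :=
    (stdOrthonormalBasis ℝ A).orthonormal.comp_linearIsometry A.subtypeₗᵢ
  have hb : Orthonormal ℝ b :=
    (stdOrthonormalBasis ℝ B).orthonormal.comp_linearIsometry B.subtypeₗᵢ
  have hab (i j) : inner ℝ (a i) (b j) = (0 : ℝ) :=
    isOrtho_iff_inner_eq.1 hAB _ (SetLike.coe_mem _) _ (SetLike.coe_mem _)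
  have he : Orthonormal ℝ (Sum.elim a b) := by
    refine ⟨?_, ?_⟩
    · rintro (i | i)
      · exact ha.1 i
      · exact hb.1 i
    · rintro (i | i) (j | j) hij
      · exact ha.2 (fun h ↦ hij (by rw [h]))
      · exact hab i j
      · rw [Sum.elim_inl, Sum.elim_inr, real_inner_comm]; exact hab j i
      · exact hb.2 (fun h ↦ hij (by rw [h]))
  have hspan : ∀ S : Submodule ℝ V,
      span ℝ (Set.range fun i ↦ (stdOrthonormalBasis ℝ S i : V)) = S := by
    intro S
    have h1 := congrArg (map S.subtype) (stdOrthonormalBasis ℝ S).toBasis.span_eq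
    rw [map_span, ← Set.range_comp, Submodule.map_top, range_subtype] at h1
    simpa [Function.comp_def] using h1
  have hS : span ℝ (Set.range (Sum.elim a b)) = A ⊔ B := by
    rw [Set.Sum.elim_range, span_union]
    exact congrArg₂ (· ⊔ ·) (hspan A) (hspan B)
  have key (j) := sum_norm_sq_stdOrthonormalBasis he hS (h.flip (stdOrthonormalBasis ℝ C j))
  simp only [LinearMap.flip_apply, Fintype.sum_sum_type, Sum.elim_inl, Sum.elim_inr] at key
  rw [formNormSq, Finset.sum_comm, Finset.sum_congr rfl fun j _ ↦ key j,
    Finset.sum_add_distrib, formNormSq, formNormSq]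
  exact congrArg₂ (· + ·) Finset.sum_comm Finset.sum_comm

/-- A bilinear map that is symmetric on a sum of three pairwise orthogonal subspaces: its squared
norm splits into blocks. -/
theorem formNormSq_sup_three (hAB : A ⟂ B) (hAC : A ⟂ C) (hBC : B ⟂ C)
    (hs : ∀ a ∈ A ⊔ B ⊔ C, ∀ b ∈ A ⊔ B ⊔ C, h a b = h b a) :
    formNormSq h (A ⊔ B ⊔ C) (A ⊔ B ⊔ C) =
      formNormSq h A A + formNormSq h B B + formNormSq h C C
        + 2 * formNormSq h A B + 2 * formNormSq h A C + 2 * formNormSq h B C := by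
  have hA : A ≤ A ⊔ B ⊔ C := le_sup_left.trans le_sup_left
  have hB : B ≤ A ⊔ B ⊔ C := le_sup_right.trans le_sup_left
  have hC : C ≤ A ⊔ B ⊔ C := le_sup_right
  have split (S : Submodule ℝ V) : formNormSq h (A ⊔ B ⊔ C) S =
      formNormSq h A S + formNormSq h B S + formNormSq h C S := by
    rw [formNormSq_sup_left (isOrtho_sup_left.2 ⟨hAC, hBC⟩), formNormSq_sup_left hAB]
  have comm {S T : Submodule ℝ V} (hS : S ≤ A ⊔ B ⊔ C) (hT : T ≤ A ⊔ B ⊔ C) :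
      formNormSq h S T = formNormSq h T S :=
    formNormSq_comm fun a ha b hb ↦ hs a (hS ha) b (hT hb)
  rw [split, comm hA le_rfl, comm hB le_rfl, comm hC le_rfl, split, split, split, comm hB hA,
    comm hC hA, comm hC hB]
  ring

theorem sum_inner_sq_stdOrthonormalBasis {x : V} (hx : x ∈ A) :
    ∑ i, (inner ℝ x (stdOrthonormalBasis ℝ A i : V) : ℝ) ^ 2 = ‖x‖ ^ 2 := by
  have := (stdOrthonormalBasis ℝ A).sum_sq_norm_inner_left ⟨x, hx⟩
  simpa using this

end LinearAlgebra

section Blocks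

open Module Submodule

variable {V : Type*} [NormedAddCommGroup V] [InnerProductSpace ℝ V] [FiniteDimensional ℝ V]
  {h : V →ₗ[ℝ] V →ₗ[ℝ] V} {D D' : Submodule ℝ V} {Phi P : V →ₗ[ℝ] V} {n n' : V}

/-! ### Lower bounds for the mixed blocks -/

/-- The normal vectors `Φ w`, `w ∈ D'`, detect only the diagonal components of `h`, and these are
given by a fixed linear form. -/
theorem le_formNormSq_of_antiInvariant
    (hskew : ∀ x y, (inner ℝ (Phi x) y : ℝ) = -inner ℝ x (Phi y))
    (hiso : ∀ x ∈ D', ∀ y ∈ D', (inner ℝ (Phi x) (Phi y) : ℝ) = inner ℝ x y)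
    (hn : Phi n ∈ D)
    (key : ∀ x ∈ D, ∀ v ∈ D', ∀ w ∈ D',
      (inner ℝ (h x v) (Phi w) : ℝ) = -inner ℝ n (Phi x) * inner ℝ v w) :
    finrank ℝ D' * ‖Phi n‖ ^ 2 ≤ formNormSq h D D' := by
  let a : Fin (finrank ℝ D) → V := fun i ↦ stdOrthonormalBasis ℝ D i
  let b : Fin (finrank ℝ D') → V := fun i ↦ stdOrthonormalBasis ℝ D' i
  have hb : Orthonormal ℝ b :=
    (stdOrthonormalBasis ℝ D').orthonormal.comp_linearIsometry D'.subtypeₗᵢ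
  have hbm (j) : b j ∈ D' := SetLike.coe_mem _
  have hE : Orthonormal ℝ fun k ↦ Phi (b k) := by
    rw [orthonormal_iff_ite] at hb ⊢
    intro i j
    rw [hiso _ (hbm i) _ (hbm j), hb i j]
  have hterm (i j) : (inner ℝ (Phi n) (a i) : ℝ) ^ 2 ≤ ‖h (a i) (b j)‖ ^ 2 := by
    have bessel := hE.sum_inner_products_le (h (a i) (b j)) (s := {j})
    rw [Finset.sum_singleton, real_inner_comm, key _ (SetLike.coe_mem _) _ (hbm j) _ (hbm j),
      real_inner_self_eq_norm_sq, hb.1 j, ← hskew] at bessel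
    simpa using bessel
  calc finrank ℝ D' * ‖Phi n‖ ^ 2
      = ∑ i, ∑ _j : Fin (finrank ℝ D'), (inner ℝ (Phi n) (a i) : ℝ) ^ 2 := by
        rw [← sum_inner_sq_stdOrthonormalBasis hn, Finset.mul_sum]
        simp [a]
    _ ≤ formNormSq h D D' :=
        Finset.sum_le_sum fun i _ ↦ Finset.sum_le_sum fun j _ ↦ hterm i j

/-- For slant vectors the normal vectors `(Φ - P) w` detect the diagonal components of `h` and
those along `P`; the two kinds are orthogonal because `P` is skew. -/
theorem le_formNormSq_of_slant {c s : ℝ} (hs : s ≠ 0)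
    (hskew : ∀ x y, (inner ℝ (Phi x) y : ℝ) = -inner ℝ x (Phi y))
    (hQ : ∀ x ∈ D', ∀ y ∈ D', (inner ℝ (Phi x - P x) (Phi y - P y) : ℝ) = s ^ 2 * inner ℝ x y)
    (hPmem : ∀ x ∈ D', P x ∈ D') (hPskew : ∀ x ∈ D', (inner ℝ (P x) x : ℝ) = 0)
    (hP : ∀ x ∈ D', ‖P x‖ ^ 2 = c ^ 2 * ‖x‖ ^ 2) (hn : Phi n ∈ D) (hn' : n' ∈ D)
    (key : ∀ x ∈ D, ∀ v ∈ D', ∀ w ∈ D', (inner ℝ (h x v) (Phi w - P w) : ℝ) =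
      inner ℝ n' x * inner ℝ (P v) w - inner ℝ n (Phi x) * inner ℝ v w) :
    finrank ℝ D' * (s⁻¹ ^ 2 * (c ^ 2 * ‖n'‖ ^ 2 + ‖Phi n‖ ^ 2)) ≤ formNormSq h D D' := by
  let a : Fin (finrank ℝ D) → V := fun i ↦ stdOrthonormalBasis ℝ D i
  let b : Fin (finrank ℝ D') → V := fun i ↦ stdOrthonormalBasis ℝ D' i
  have hb : Orthonormal ℝ b :=
    (stdOrthonormalBasis ℝ D').orthonormal.comp_linearIsometry D'.subtypeₗᵢ
  have hbm (j) : b j ∈ D' := SetLike.coe_mem _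
  have hE : Orthonormal ℝ fun k ↦ s⁻¹ • (Phi (b k) - P (b k)) := by
    rw [orthonormal_iff_ite] at hb ⊢
    intro i j
    rw [real_inner_smul_left, real_inner_smul_right, hQ _ (hbm i) _ (hbm j), hb i j]
    field_simp
  have hterm (i j) : s⁻¹ ^ 2 *
      (c ^ 2 * (inner ℝ n' (a i) : ℝ) ^ 2 + (inner ℝ (Phi n) (a i) : ℝ) ^ 2) ≤
        ‖h (a i) (b j)‖ ^ 2 := by
    -- The cross terms of the expanded squares add up to a multiple of `⟪P b_j, b_j⟫ = 0`.
    refine le_trans (le_of_eq ?_)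
      (hE.sum_inner_products_le (h (a i) (b j)) (s := Finset.univ))
    have hk (k) : ‖(inner ℝ (s⁻¹ • (Phi (b k) - P (b k))) (h (a i) (b j)) : ℝ)‖ ^ 2 =
        s⁻¹ ^ 2 * (inner ℝ n' (a i) ^ 2 * inner ℝ (P (b j)) (b k) ^ 2
          + 2 * inner ℝ n' (a i) * inner ℝ (Phi n) (a i) *
            (inner ℝ (P (b j)) (b k) * inner ℝ (b j) (b k))
          + inner ℝ (Phi n) (a i) ^ 2 * inner ℝ (b j) (b k) ^ 2) := by
      rw [Real.norm_eq_abs, sq_abs, real_inner_smul_left, real_inner_comm,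
        key _ (SetLike.coe_mem _) _ (hbm j) _ (hbm k), hskew n]
      ring
    have hb' := orthonormal_iff_ite.1 hb
    have h1 : ∑ k, (inner ℝ (P (b j)) (b k) : ℝ) ^ 2 = c ^ 2 := by
      rw [sum_inner_sq_stdOrthonormalBasis (hPmem _ (hbm j)), hP _ (hbm j), hb.1 j]
      ring
    have h2 : ∑ k, (inner ℝ (P (b j)) (b k) : ℝ) * inner ℝ (b j) (b k) = 0 := by
      simp [hb', hPskew _ (hbm j)]
    have h3 : ∑ k, (inner ℝ (b j) (b k) : ℝ) ^ 2 = 1 := by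
      simp [hb']
    rw [Finset.sum_congr rfl fun k _ ↦ hk k, ← Finset.mul_sum, Finset.sum_add_distrib,
      Finset.sum_add_distrib, ← Finset.mul_sum, ← Finset.mul_sum, ← Finset.mul_sum, h1, h2, h3]
    ring
  calc finrank ℝ D' * (s⁻¹ ^ 2 * (c ^ 2 * ‖n'‖ ^ 2 + ‖Phi n‖ ^ 2))
      = ∑ i, ∑ _j : Fin (finrank ℝ D'), s⁻¹ ^ 2 *
          (c ^ 2 * (inner ℝ n' (a i) : ℝ) ^ 2 + (inner ℝ (Phi n) (a i) : ℝ) ^ 2) := by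
        rw [← sum_inner_sq_stdOrthonormalBasis hn, ← sum_inner_sq_stdOrthonormalBasis hn',
          Finset.mul_sum, ← Finset.sum_add_distrib, Finset.mul_sum, Finset.mul_sum]
        simp [a]
    _ ≤ formNormSq h D D' :=
        Finset.sum_le_sum fun i _ ↦ Finset.sum_le_sum fun j _ ↦ hterm i j

omit [FiniteDimensional ℝ V] in
/-- A linear map that preserves the ratio of norms preserves inner products up to the factor. -/
theorem inner_map_eq_of_norm_sq_eq {W : Submodule ℝ V} {L : V →ₗ[ℝ] V} {k : ℝ}
    (hL : ∀ x ∈ W, ‖L x‖ ^ 2 = k * ‖x‖ ^ 2) {x y : V} (hx : x ∈ W) (hy : y ∈ W) :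
    (inner ℝ (L x) (L y) : ℝ) = k * inner ℝ x y := by
  have h1 := hL (x + y) (W.add_mem hx hy)
  rw [map_add, norm_add_sq_real, norm_add_sq_real, hL x hx, hL y hy] at h1
  linarith

/-- If `Φ x` makes the angle `θ` with its projection to `D`, the projection has norm
`cos θ * ‖Φ x‖`. -/
theorem norm_starProjection_of_angle {θ : ℝ} (hθ : Real.cos θ ≠ 0) {x : V}
    (hx : InnerProductGeometry.angle x (D.starProjection x) = θ) :
    ‖D.starProjection x‖ = Real.cos θ * ‖x‖ := by
  have h1 := InnerProductGeometry.cos_angle_mul_norm_mul_norm x (D.starProjection x)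
  have h2 : (inner ℝ x (D.starProjection x) : ℝ) = ‖D.starProjection x‖ ^ 2 := by
    rw [← real_inner_self_eq_norm_sq, ← sub_eq_zero, ← inner_sub_left]
    exact D.starProjection_inner_eq_zero x _ (D.starProjection_apply_mem x)
  rw [h2, hx] at h1
  by_cases h0 : ‖D.starProjection x‖ = 0
  · -- A zero projection would give the angle `π / 2`.
    rw [norm_eq_zero] at h0
    rw [h0, InnerProductGeometry.angle_zero_right] at hx
    exact absurd (hx ▸ Real.cos_pi_div_two) hθ
  · have h3 : ‖D.starProjection x‖ * (‖D.starProjection x‖ - Real.cos θ * ‖x‖) = 0 := by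
      linear_combination -h1
    rcases mul_eq_zero.1 h3 with h4 | h4
    · exact absurd h4 h0
    · linarith

end Blocks

section PointwiseInequality

open Module Submodule

variable {V : Type*} [NormedAddCommGroup V] [InnerProductSpace ℝ V] [FiniteDimensional ℝ V]

/-! ### The inequality at a point -/

/-- The pointwise form of the inequality. Here `D₁`, `D₂`, `D₃` are the invariant, anti-invariant and
slant parts of the tangent space of the submanifold, `h` is the second fundamental form, and `n₁`,
`n₂` are the gradients of the logarithms of the warping functions. The last term of the lower bound
consists of the three blocks that the method gives no information about. -/
theorem formNormSq_ge_of_contact {h : V →ₗ[ℝ] V →ₗ[ℝ] V} {D₁ D₂ D₃ : Submodule ℝ V}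
    {Phi : V →ₗ[ℝ] V} {xi n₁ n₂ : V} {b nu : ℝ}
    (h₁₂ : D₁ ⟂ D₂) (h₁₃ : D₁ ⟂ D₃) (h₂₃ : D₂ ⟂ D₃)
    (hskew : ∀ x y, (inner ℝ (Phi x) y : ℝ) = -inner ℝ x (Phi y))
    (hPhi : ∀ x, ‖Phi x‖ ^ 2 = ‖x‖ ^ 2 - inner ℝ xi x ^ 2) (hxi : ‖xi‖ ^ 2 = 1)
    (hxi₁ : xi ∈ D₁) (hinv : ∀ x ∈ D₁, Phi x ∈ D₁)
    (hanti : ∀ x ∈ D₂, ∀ y ∈ D₁ ⊔ D₂ ⊔ D₃, (inner ℝ (Phi x) y : ℝ) = 0)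
    (hsin : Real.sin nu ≠ 0) (hcos : Real.cos nu ≠ 0)
    (hangle : ∀ z ∈ D₃, z ≠ 0 →
      InnerProductGeometry.angle (Phi z) (D₃.starProjection (Phi z)) = nu)
    (hn₁ : n₁ ∈ D₁) (hn₂ : n₂ ∈ D₁) (hb₁ : (inner ℝ n₁ xi : ℝ) = b)
    (hb₂ : (inner ℝ n₂ xi : ℝ) = b)
    (hs : ∀ x ∈ D₁ ⊔ D₂ ⊔ D₃, ∀ y ∈ D₁ ⊔ D₂ ⊔ D₃, h x y = h y x)
    (hmixed : ∀ x ∈ D₂, ∀ y ∈ D₃, h x y = 0)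
    (key₂ : ∀ x ∈ D₁, ∀ v ∈ D₂, ∀ w ∈ D₂,
      (inner ℝ (h x v) (Phi w) : ℝ) = -inner ℝ n₁ (Phi x) * inner ℝ v w)
    (key₃ : ∀ x ∈ D₁, ∀ v ∈ D₃, ∃ c : V,
      (∀ m, (∀ y ∈ D₁ ⊔ D₂ ⊔ D₃, (inner ℝ m y : ℝ) = 0) →
        (inner ℝ (h x v) m : ℝ) = inner ℝ c m) ∧
      (∀ w ∈ D₃, (inner ℝ c w : ℝ) = inner ℝ n₂ x * inner ℝ v w) ∧
      ∀ w ∈ D₃, (inner ℝ c (Phi w) : ℝ) =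
        -inner ℝ n₂ (Phi x) * inner ℝ v w - b * inner ℝ xi x * inner ℝ (Phi v) w) :
    2 * finrank ℝ D₂ * (‖n₁‖ ^ 2 - b ^ 2)
      + 2 * finrank ℝ D₃ * (1 / Real.sin nu) ^ 2 * (Real.sin nu ^ 2 + 2 * Real.cos nu ^ 2)
        * (‖n₂‖ ^ 2 - b ^ 2)
      + (formNormSq h D₁ D₁ + formNormSq h D₂ D₂ + formNormSq h D₃ D₃) ≤
    formNormSq h (D₁ ⊔ D₂ ⊔ D₃) (D₁ ⊔ D₂ ⊔ D₃) := by
  have o₁₂ : ∀ x ∈ D₁, ∀ y ∈ D₂, (inner ℝ x y : ℝ) = 0 := isOrtho_iff_inner_eq.1 h₁₂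
  have o₁₃ : ∀ x ∈ D₁, ∀ y ∈ D₃, (inner ℝ x y : ℝ) = 0 := isOrtho_iff_inner_eq.1 h₁₃
  have o₂₃ : ∀ x ∈ D₂, ∀ y ∈ D₃, (inner ℝ x y : ℝ) = 0 := isOrtho_iff_inner_eq.1 h₂₃
  have hiso (S : Submodule ℝ V) (hS : ∀ x ∈ S, (inner ℝ xi x : ℝ) = 0) :
      ∀ x ∈ S, ‖Phi x‖ ^ 2 = 1 * ‖x‖ ^ 2 := fun x hx ↦ by
    rw [hPhi, hS x hx]; ring
  have i₂ := hiso D₂ (o₁₂ xi hxi₁)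
  have i₃ := hiso D₃ (o₁₃ xi hxi₁)
  have hPn₁ : ‖Phi n₁‖ ^ 2 = ‖n₁‖ ^ 2 - b ^ 2 := by rw [hPhi, real_inner_comm, hb₁]
  have hPn₂ : ‖Phi n₂‖ ^ 2 = ‖n₂‖ ^ 2 - b ^ 2 := by rw [hPhi, real_inner_comm, hb₂]
  have hn' : ‖n₂ - b • xi‖ ^ 2 = ‖n₂‖ ^ 2 - b ^ 2 := by
    rw [norm_sub_sq_real, real_inner_smul_right, hb₂, norm_smul, mul_pow, hxi, Real.norm_eq_abs,
      sq_abs]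
    ring
  have b₁₂ : finrank ℝ D₂ * ‖Phi n₁‖ ^ 2 ≤ formNormSq h D₁ D₂ := by
    refine le_formNormSq_of_antiInvariant hskew (fun x hx y hy ↦ ?_) (hinv _ hn₁) key₂
    rw [inner_map_eq_of_norm_sq_eq i₂ hx hy, one_mul]
  -- `P` is the component of `Φ` in `D₃`; the slant condition makes it `cos ν` times an isometry.
  let P : V →ₗ[ℝ] V := D₃.starProjection.toLinearMap ∘ₗ Phi
  have hPmem : ∀ x, P x ∈ D₃ := fun x ↦ D₃.starProjection_apply_mem _
  have hPinner : ∀ x, ∀ y ∈ D₃, (inner ℝ (P x) y : ℝ) = inner ℝ (Phi x) y := fun x y hy ↦ by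
    have := D₃.starProjection_inner_eq_zero (Phi x) y hy
    rw [inner_sub_left] at this
    exact (sub_eq_zero.1 this).symm
  have hP : ∀ x ∈ D₃, ‖P x‖ ^ 2 = Real.cos nu ^ 2 * ‖x‖ ^ 2 := fun x hx ↦ by
    rcases eq_or_ne x 0 with rfl | h0
    · simp
    · have := norm_starProjection_of_angle hcos (hangle x hx h0)
      rw [show P x = D₃.starProjection (Phi x) from rfl, this, mul_pow, i₃ x hx, one_mul]
  have hQ : ∀ x ∈ D₃, ∀ y ∈ D₃,
      (inner ℝ (Phi x - P x) (Phi y - P y) : ℝ) = Real.sin nu ^ 2 * inner ℝ x y := by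
    intro x hx y hy
    have a₁ := hPinner x _ (hPmem y)
    have a₂ := hPinner y _ (hPmem x)
    have a₃ := inner_map_eq_of_norm_sq_eq i₃ hx hy
    have a₄ := inner_map_eq_of_norm_sq_eq hP hx hy
    rw [real_inner_comm, real_inner_comm (P x)] at a₂
    rw [inner_sub_left, inner_sub_right, inner_sub_right, a₃, ← a₁, a₄, Real.sin_sq]
    linear_combination a₂ - a₄
  -- `Φ - P` maps `D₃` into the normal space: `Φ D₁ ⊆ D₁` and `Φ D₂` is normal, so skewness of `Φ`
  -- leaves only the component in `D₃`, which `P` removes.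
  have hQn : ∀ w ∈ D₃, ∀ y ∈ D₁ ⊔ D₂ ⊔ D₃, (inner ℝ (Phi w - P w) y : ℝ) = 0 := by
    intro w hw y hy
    obtain ⟨y', hy', y₃, hy₃, rfl⟩ := mem_sup.1 hy
    obtain ⟨y₁, hy₁, y₂, hy₂, rfl⟩ := mem_sup.1 hy'
    rw [inner_add_right, inner_add_right, inner_sub_left, inner_sub_left, inner_sub_left,
      hPinner w _ hy₃, hskew w y₁, hskew w y₂, real_inner_comm _ w, real_inner_comm _ w,
      o₁₃ _ (hinv _ hy₁) _ hw, hanti _ hy₂ _ (mem_sup_right hw), real_inner_comm y₁,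
      real_inner_comm y₂, o₁₃ _ hy₁ _ (hPmem w), o₂₃ _ hy₂ _ (hPmem w)]
    ring
  have b₁₃ := le_formNormSq_of_slant (h := h) (D := D₁) (D' := D₃) (n := n₂) (n' := n₂ - b • xi)
    (c := Real.cos nu) hsin hskew hQ (fun x _ ↦ hPmem x)
    (fun x hx ↦ by
      have := hskew x x
      rw [real_inner_comm] at this
      rw [hPinner x x hx, real_inner_comm]
      linarith)
    hP (hinv _ hn₂) (D₁.sub_mem hn₂ (D₁.smul_mem _ hxi₁))
    (fun x hx v hv w hw ↦ by
      obtain ⟨c, hc, hc₁, hc₂⟩ := key₃ x hx v hv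
      have h1 : (inner ℝ v (P w) : ℝ) = -inner ℝ (Phi v) w := by
        rw [real_inner_comm, hPinner w v hv, hskew, real_inner_comm]
      rw [hc _ (hQn w hw), inner_sub_right, hc₁ _ (hPmem w), hc₂ _ hw, h1, hPinner v w hw,
        inner_sub_left, real_inner_smul_left]
      ring)
  have h0 : formNormSq h D₂ D₃ = 0 := formNormSq_eq_zero_iff.2 hmixed
  rw [formNormSq_sup_three h₁₂ h₁₃ h₂₃ hs, h0]
  rw [hPn₁] at b₁₂
  rw [hPn₂, hn'] at b₁₃
  -- The two kinds of components along `Φ - P` contribute `cos² ν` and `1`, and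
  -- `1 + cos² ν = sin² ν + 2 cos² ν`.
  have e : (1 / Real.sin nu) ^ 2 * (Real.sin nu ^ 2 + 2 * Real.cos nu ^ 2) =
      (Real.sin nu)⁻¹ ^ 2 * (1 + Real.cos nu ^ 2) := by
    rw [one_div, Real.sin_sq]; ring
  have e' : 2 * finrank ℝ D₃ * (1 / Real.sin nu) ^ 2 * (Real.sin nu ^ 2 + 2 * Real.cos nu ^ 2)
        * (‖n₂‖ ^ 2 - b ^ 2) = 2 * (finrank ℝ D₃ * ((Real.sin nu)⁻¹ ^ 2 *
          (Real.cos nu ^ 2 * (‖n₂‖ ^ 2 - b ^ 2) + (‖n₂‖ ^ 2 - b ^ 2)))) := by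
    linear_combination (2 * finrank ℝ D₃ * (‖n₂‖ ^ 2 - b ^ 2)) * e
  rw [e']
  linarith

end PointwiseInequality

section Inclusions

variable {E₁ : Type*} [NormedAddCommGroup E₁] [NormedSpace ℝ E₁]
  {H₁ : Type*} [TopologicalSpace H₁] {I₁ : ModelWithCorners ℝ E₁ H₁}
  {L₁ : Type*} [TopologicalSpace L₁] [ChartedSpace H₁ L₁]
  {E₂ : Type*} [NormedAddCommGroup E₂] [NormedSpace ℝ E₂]
  {H₂ : Type*} [TopologicalSpace H₂] {I₂ : ModelWithCorners ℝ E₂ H₂}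
  {L₂ : Type*} [TopologicalSpace L₂] [ChartedSpace H₂ L₂]
  {E₃ : Type*} [NormedAddCommGroup E₃] [NormedSpace ℝ E₃]
  {H₃ : Type*} [TopologicalSpace H₃] {I₃ : ModelWithCorners ℝ E₃ H₃}
  {L₃ : Type*} [TopologicalSpace L₃] [ChartedSpace H₃ L₃]
  {p : L₁ × L₂ × L₃}

/-! ### Orthogonal decomposition of the tangent space -/

variable (I₁ I₂ I₃ p) in
/-- Vectors tangent to the copy of `L₁` through `p`, as tangent vectors of the product. -/
def incl₁ : TangentSpace I₁ p.1 →ₗ[ℝ] TangentSpace (model₃ I₁ I₂ I₃) p where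
  toFun a := vec₃ I₁ I₂ I₃ p a 0 0
  map_add' _ _ := ext_dpr (by simp) (by simp) (by simp)
  map_smul' _ _ := ext_dpr (by simp) (by simp) (by simp)

variable (I₁ I₂ I₃ p) in
/-- Vectors tangent to the copy of `L₂` through `p`, as tangent vectors of the product. -/
def incl₂ : TangentSpace I₂ p.2.1 →ₗ[ℝ] TangentSpace (model₃ I₁ I₂ I₃) p where
  toFun b := vec₃ I₁ I₂ I₃ p 0 b 0
  map_add' _ _ := ext_dpr (by simp) (by simp) (by simp)
  map_smul' _ _ := ext_dpr (by simp) (by simp) (by simp)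

variable (I₁ I₂ I₃ p) in
/-- Vectors tangent to the copy of `L₃` through `p`, as tangent vectors of the product. -/
def incl₃ : TangentSpace I₃ p.2.2 →ₗ[ℝ] TangentSpace (model₃ I₁ I₂ I₃) p where
  toFun c := vec₃ I₁ I₂ I₃ p 0 0 c
  map_add' _ _ := ext_dpr (by simp) (by simp) (by simp)
  map_smul' _ _ := ext_dpr (by simp) (by simp) (by simp)

theorem incl₁_apply (a : TangentSpace I₁ p.1) :
    incl₁ I₁ I₂ I₃ p a = vec₃ I₁ I₂ I₃ p a 0 0 := rfl

theorem incl₂_apply (b : TangentSpace I₂ p.2.1) :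
    incl₂ I₁ I₂ I₃ p b = vec₃ I₁ I₂ I₃ p 0 b 0 := rfl

theorem incl₃_apply (c : TangentSpace I₃ p.2.2) :
    incl₃ I₁ I₂ I₃ p c = vec₃ I₁ I₂ I₃ p 0 0 c := rfl

theorem incl₁_mem (a : TangentSpace I₁ p.1) : incl₁ I₁ I₂ I₃ p a ∈ dist₁ I₁ I₂ I₃ p := by
  simp [mem_dist₁_iff, incl₁_apply]

theorem incl₂_mem (b : TangentSpace I₂ p.2.1) : incl₂ I₁ I₂ I₃ p b ∈ dist₂ I₁ I₂ I₃ p := by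
  simp [mem_dist₂_iff, incl₂_apply]

theorem incl₃_mem (c : TangentSpace I₃ p.2.2) : incl₃ I₁ I₂ I₃ p c ∈ dist₃ I₁ I₂ I₃ p := by
  simp [mem_dist₃_iff, incl₃_apply]

theorem range_incl₂ : LinearMap.range (incl₂ I₁ I₂ I₃ p) = dist₂ I₁ I₂ I₃ p := by
  refine le_antisymm (LinearMap.range_le_iff_comap.2 (by ext; simp [incl₂_mem])) fun u hu ↦ ?_
  rw [mem_dist₂_iff] at hu
  exact ⟨dpr₂ I₁ I₂ I₃ p u, ext_dpr (by simp [incl₂_apply, hu.1]) (by simp [incl₂_apply])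
    (by simp [incl₂_apply, hu.2])⟩

theorem range_incl₃ : LinearMap.range (incl₃ I₁ I₂ I₃ p) = dist₃ I₁ I₂ I₃ p := by
  refine le_antisymm (LinearMap.range_le_iff_comap.2 (by ext; simp [incl₃_mem])) fun u hu ↦ ?_
  rw [mem_dist₃_iff] at hu
  exact ⟨dpr₃ I₁ I₂ I₃ p u, ext_dpr (by simp [incl₃_apply, hu.1]) (by simp [incl₃_apply, hu.2])
    (by simp [incl₃_apply])⟩

theorem incl₂_injective : Function.Injective (incl₂ I₁ I₂ I₃ p) := fun b b' h ↦ by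
  simpa [incl₂_apply] using congrArg (dpr₂ I₁ I₂ I₃ p) h

theorem incl₃_injective : Function.Injective (incl₃ I₁ I₂ I₃ p) := fun b b' h ↦ by
  simpa [incl₃_apply] using congrArg (dpr₃ I₁ I₂ I₃ p) h

theorem dist_sup_eq_top : dist₁ I₁ I₂ I₃ p ⊔ dist₂ I₁ I₂ I₃ p ⊔ dist₃ I₁ I₂ I₃ p = ⊤ := by
  refine eq_top_iff.2 fun u _ ↦ ?_
  have : u = incl₁ I₁ I₂ I₃ p (dpr₁ I₁ I₂ I₃ p u) + incl₂ I₁ I₂ I₃ p (dpr₂ I₁ I₂ I₃ p u)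
      + incl₃ I₁ I₂ I₃ p (dpr₃ I₁ I₂ I₃ p u) :=
    ext_dpr (by simp [incl₁_apply, incl₂_apply, incl₃_apply])
      (by simp [incl₁_apply, incl₂_apply, incl₃_apply])
      (by simp [incl₁_apply, incl₂_apply, incl₃_apply])
  rw [this]
  exact Submodule.add_mem_sup (Submodule.add_mem_sup (incl₁_mem _) (incl₂_mem _)) (incl₃_mem _)

variable {E : Type*} [NormedAddCommGroup E] [NormedSpace ℝ E]
  {H : Type*} [TopologicalSpace H] {I : ModelWithCorners ℝ E H}
  {M : Type*} [TopologicalSpace M] [ChartedSpace H M]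
  [RiemannianBundle (fun x : M ↦ TangentSpace I x)]
  [RiemannianBundle (fun x : L₁ ↦ TangentSpace I₁ x)]
  [RiemannianBundle (fun x : L₂ ↦ TangentSpace I₂ x)]
  [RiemannianBundle (fun x : L₃ ↦ TangentSpace I₃ x)]
  {f₁ f₂ : L₁ → ℝ} {F : L₁ × L₂ × L₃ → M} {u v : TangentSpace (model₃ I₁ I₂ I₃) p}

namespace IsBiWarpedImmersion

variable (hF : IsBiWarpedImmersion I₁ I₂ I₃ I f₁ f₂ F)
include hF

theorem mfderiv_injective : Function.Injective (mfderiv (model₃ I₁ I₂ I₃) I F p) := by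
  refine (injective_iff_map_eq_zero _).2 fun u hu ↦ ?_
  have h := hF.isometric p u u
  rw [hu, inner_zero_left, real_inner_self_eq_norm_sq, real_inner_self_eq_norm_sq,
    real_inner_self_eq_norm_sq] at h
  have p₁ := pow_pos (hF.pos_f₁ p.1) 2
  have p₂ := pow_pos (hF.pos_f₂ p.1) 2
  have n₁ := sq_nonneg ‖dpr₁ I₁ I₂ I₃ p u‖
  have n₂ := mul_nonneg p₁.le (sq_nonneg ‖dpr₂ I₁ I₂ I₃ p u‖)
  have n₃ := mul_nonneg p₂.le (sq_nonneg ‖dpr₃ I₁ I₂ I₃ p u‖)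
  have z₁ : ‖dpr₁ I₁ I₂ I₃ p u‖ ^ 2 = 0 := by linarith
  have z₂ : f₁ p.1 ^ 2 * ‖dpr₂ I₁ I₂ I₃ p u‖ ^ 2 = 0 := by linarith
  have z₃ : f₂ p.1 ^ 2 * ‖dpr₃ I₁ I₂ I₃ p u‖ ^ 2 = 0 := by linarith
  refine ext_dpr ?_ ?_ ?_
  · simpa using z₁
  · simpa [p₁.ne', (hF.pos_f₁ p.1).ne'] using z₂
  · simpa [p₂.ne', (hF.pos_f₂ p.1).ne'] using z₃

theorem inner_eq_zero₁₂ (hu : u ∈ dist₁ I₁ I₂ I₃ p) (hv : v ∈ dist₂ I₁ I₂ I₃ p) :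
    (inner ℝ (mfderiv (model₃ I₁ I₂ I₃) I F p u) (mfderiv (model₃ I₁ I₂ I₃) I F p v) : ℝ) = 0 := by
  rw [hF.inner_of_mem_dist₁ hu, (mem_dist₂_iff.1 hv).1, inner_zero_right]

theorem inner_eq_zero₁₃ (hu : u ∈ dist₁ I₁ I₂ I₃ p) (hv : v ∈ dist₃ I₁ I₂ I₃ p) :
    (inner ℝ (mfderiv (model₃ I₁ I₂ I₃) I F p u) (mfderiv (model₃ I₁ I₂ I₃) I F p v) : ℝ) = 0 := by
  rw [hF.inner_of_mem_dist₁ hu, (mem_dist₃_iff.1 hv).1, inner_zero_right]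

theorem inner_eq_zero₂₃ (hu : u ∈ dist₂ I₁ I₂ I₃ p) (hv : v ∈ dist₃ I₁ I₂ I₃ p) :
    (inner ℝ (mfderiv (model₃ I₁ I₂ I₃) I F p u) (mfderiv (model₃ I₁ I₂ I₃) I F p v) : ℝ) = 0 := by
  rw [hF.inner_of_mem_dist₂ hu, (mem_dist₃_iff.1 hv).2, inner_zero_right, mul_zero]

theorem finrank_map_dist₂ : Module.finrank ℝ
    ((dist₂ I₁ I₂ I₃ p).map (mfderiv (model₃ I₁ I₂ I₃) I F p).toLinearMap) =
      Module.finrank ℝ E₂ := by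
  rw [← range_incl₂, ← LinearMap.range_comp]
  exact LinearMap.finrank_range_of_inj (hF.mfderiv_injective.comp incl₂_injective)

theorem finrank_map_dist₃ : Module.finrank ℝ
    ((dist₃ I₁ I₂ I₃ p).map (mfderiv (model₃ I₁ I₂ I₃) I F p).toLinearMap) =
      Module.finrank ℝ E₃ := by
  rw [← range_incl₃, ← LinearMap.range_comp]
  exact LinearMap.finrank_range_of_inj (hF.mfderiv_injective.comp incl₃_injective)

/-- The image of the gradient of `f` represents the differential of `f ∘ π₁` on the submanifold. -/
theorem inner_mfderiv_riemGrad [FiniteDimensional ℝ E₁] (f : L₁ → ℝ)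
    (w : TangentSpace (model₃ I₁ I₂ I₃) p) :
    (inner ℝ (mfderiv (model₃ I₁ I₂ I₃) I F p (incl₁ I₁ I₂ I₃ p (riemGrad f p.1)))
      (mfderiv (model₃ I₁ I₂ I₃) I F p w) : ℝ) = mvfderiv I₁ f p.1 (dpr₁ I₁ I₂ I₃ p w) := by
  rw [hF.inner_of_mem_dist₁ (incl₁_mem _), incl₁_apply, dpr₁_vec₃, inner_riemGrad]

theorem norm_sq_mfderiv_incl₁ (a : TangentSpace I₁ p.1) :
    ‖mfderiv (model₃ I₁ I₂ I₃) I F p (incl₁ I₁ I₂ I₃ p a)‖ ^ 2 = ‖a‖ ^ 2 := by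
  rw [← real_inner_self_eq_norm_sq, hF.inner_of_mem_dist₁ (incl₁_mem _), incl₁_apply, dpr₁_vec₃,
    real_inner_self_eq_norm_sq]

end IsBiWarpedImmersion

end Inclusions

section SecondFF

variable {E : Type*} [NormedAddCommGroup E] [NormedSpace ℝ E] [FiniteDimensional ℝ E]
  {H : Type*} [TopologicalSpace H] {I : ModelWithCorners ℝ E H}
  {M : Type*} [TopologicalSpace M] [ChartedSpace H M] [IsManifold I ∞ M]
  {E' : Type*} [NormedAddCommGroup E'] [NormedSpace ℝ E'] [FiniteDimensional ℝ E']
  {H' : Type*} [TopologicalSpace H'] {J : ModelWithCorners ℝ E' H'} [J.Boundaryless]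
  {N : Type*} [TopologicalSpace N] [ChartedSpace H' N] [IsManifold J ∞ N]
  [RiemannianBundle (fun x : M ↦ TangentSpace I x)]
  {F : N → M} {p : N} {nabla : CovariantDerivative I E (TangentSpace I : M → Type _)}

/-! ### The second fundamental form as a bilinear form -/

omit [FiniteDimensional ℝ E] [J.Boundaryless] in
theorem secondFF_eq (u v : TangentSpace J p) :
    secondFF J nabla F p u v = mapHessian J nabla F p u v -
      (immTangent (I := I) J F p).starProjection (mapHessian J nabla F p u v) := rfl

omit [FiniteDimensional ℝ E] [J.Boundaryless] in
theorem inner_secondFF_of_normal {n : TangentSpace I (F p)}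
    (hn : ∀ w : TangentSpace J p, (inner ℝ n (mfderiv J I F p w) : ℝ) = 0)
    (u v : TangentSpace J p) :
    (inner ℝ (secondFF J nabla F p u v) n : ℝ) = inner ℝ (mapHessian J nabla F p u v) n := by
  obtain ⟨w, hw⟩ := (immTangent (I := I) J F p).starProjection_apply_mem
    (mapHessian J nabla F p u v)
  rw [secondFF_eq, inner_sub_left, ← hw]
  exact (congrArg _ ((real_inner_comm _ _).trans (hn w))).trans (sub_zero _)

theorem secondFF_symm (hnabla : IsLeviCivita nabla) (hF : ContMDiff J I ∞ F)
    (u v : TangentSpace J p) : secondFF J nabla F p u v = secondFF J nabla F p v u := by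
  rw [secondFF_eq, secondFF_eq, mapHessian_symm hnabla hF]

omit [FiniteDimensional ℝ E] [IsManifold I ∞ M] [IsManifold J ∞ N] [J.Boundaryless] in
theorem mfderiv_tangentFrame (i : Fin (Module.finrank ℝ (immTangent (I := I) J F p))) :
    mfderiv J I F p (tangentFrame (I := I) J F p i) =
      (stdOrthonormalBasis ℝ (immTangent (I := I) J F p) i : TangentSpace I (F p)) :=
  (stdOrthonormalBasis ℝ (immTangent (I := I) J F p) i).2.choose_spec

/-- The second fundamental form of an immersion, transported to the tangent space of the ambient
manifold and extended to a bilinear map on all of it. -/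
theorem exists_bilinear_secondFF (hnabla : IsLeviCivita nabla) (hF : ContMDiff J I ∞ F)
    (hinj : Function.Injective (mfderiv J I F p)) :
    ∃ h : TangentSpace I (F p) →ₗ[ℝ] TangentSpace I (F p) →ₗ[ℝ] TangentSpace I (F p),
      ∀ u v, h (mfderiv J I F p u) (mfderiv J I F p v) = secondFF J nabla F p u v := by
  obtain ⟨g, hg⟩ := (mfderiv J I F p).toLinearMap.exists_leftInverse_of_injective
    (LinearMap.ker_eq_bot.2 hinj)
  have hg' (u) : g (mfderiv J I F p u) = u := LinearMap.congr_fun hg u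
  refine ⟨((mapHessianₗ hnabla hF p).compr₂ (LinearMap.id -
    (immTangent (I := I) J F p).starProjection.toLinearMap)).compl₁₂ g g, fun u v ↦ ?_⟩
  rw [LinearMap.compl₁₂_apply, hg', hg']
  rfl

end SecondFF

section Pointwise

open Filter Topology

variable {E₁ : Type*} [NormedAddCommGroup E₁] [NormedSpace ℝ E₁]
  {H₁ : Type*} [TopologicalSpace H₁] {I₁ : ModelWithCorners ℝ E₁ H₁}
  {L₁ : Type*} [TopologicalSpace L₁] [ChartedSpace H₁ L₁]
  [RiemannianBundle (fun x : L₁ ↦ TangentSpace I₁ x)]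
  {E₂ : Type*} [NormedAddCommGroup E₂] [NormedSpace ℝ E₂]
  {H₂ : Type*} [TopologicalSpace H₂] {I₂ : ModelWithCorners ℝ E₂ H₂}
  {L₂ : Type*} [TopologicalSpace L₂] [ChartedSpace H₂ L₂]
  [RiemannianBundle (fun x : L₂ ↦ TangentSpace I₂ x)]
  {E₃ : Type*} [NormedAddCommGroup E₃] [NormedSpace ℝ E₃]
  {H₃ : Type*} [TopologicalSpace H₃] {I₃ : ModelWithCorners ℝ E₃ H₃}
  {L₃ : Type*} [TopologicalSpace L₃] [ChartedSpace H₃ L₃]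
  [RiemannianBundle (fun x : L₃ ↦ TangentSpace I₃ x)]
  {E : Type*} [NormedAddCommGroup E] [NormedSpace ℝ E]
  {H : Type*} [TopologicalSpace H] {I : ModelWithCorners ℝ E H}
  {M : Type*} [TopologicalSpace M] [ChartedSpace H M]
  [RiemannianBundle (fun x : M ↦ TangentSpace I x)]
  {Phi : ∀ x : M, TangentSpace I x →L[ℝ] TangentSpace I x}
  {xi : ∀ x : M, TangentSpace I x} {eta : ∀ x : M, TangentSpace I x →L[ℝ] ℝ} {beta : M → ℝ}
  {f₁ f₂ : L₁ → ℝ} {F : L₁ × L₂ × L₃ → M} {p : L₁ × L₂ × L₃}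
  {x v w : TangentSpace (model₃ I₁ I₂ I₃) p}

/-! ### The second fundamental form of the bi-warped submanifold on mixed vectors -/

namespace IsBiWarpedImmersion

variable (hF : IsBiWarpedImmersion I₁ I₂ I₃ I f₁ f₂ F)
  (hxi : IsTangent₁ I₁ I₂ I₃ I xi F)
include hF

include hxi

theorem inner_xi_of_mem_dist₂ (hw : w ∈ dist₂ I₁ I₂ I₃ p) :
    (inner ℝ (xi (F p)) (mfderiv (model₃ I₁ I₂ I₃) I F p w) : ℝ) = 0 := by
  obtain ⟨u, hu, h⟩ := hxi p
  rw [← h, hF.inner_eq_zero₁₂ hu hw]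

theorem inner_xi_of_mem_dist₃ (hw : w ∈ dist₃ I₁ I₂ I₃ p) :
    (inner ℝ (xi (F p)) (mfderiv (model₃ I₁ I₂ I₃) I F p w) : ℝ) = 0 := by
  obtain ⟨u, hu, h⟩ := hxi p
  rw [← h, hF.inner_eq_zero₁₃ hu hw]

variable [FiniteDimensional ℝ E₁] [FiniteDimensional ℝ E₂] [FiniteDimensional ℝ E₃]
  [FiniteDimensional ℝ E] [I₁.Boundaryless] [I₂.Boundaryless] [I₃.Boundaryless]
  [IsManifold I₁ ∞ L₁] [IsManifold I₂ ∞ L₂] [IsManifold I₃ ∞ L₃] [IsManifold I ∞ M]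
  [IsContMDiffRiemannianBundle I₁ ∞ E₁ (fun x : L₁ ↦ TangentSpace I₁ x)]
  [IsContMDiffRiemannianBundle I₂ ∞ E₂ (fun x : L₂ ↦ TangentSpace I₂ x)]
  [IsContMDiffRiemannianBundle I₃ ∞ E₃ (fun x : L₃ ↦ TangentSpace I₃ x)]
  [IsContMDiffRiemannianBundle I ∞ E (fun x : M ↦ TangentSpace I x)]
  {nabla : CovariantDerivative I E (TangentSpace I : M → Type _)}
  (hnabla : IsLeviCivita nabla) (hM : IsLocConfAlmostCosymplectic nabla Phi xi eta beta)
include hnabla hM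

/-- The derivative of `ln f₁` in the direction of `ξ` is `β`. -/
theorem inner_riemGrad_log_xi₂ (hdim : 0 < Module.finrank ℝ E₂) :
    (inner ℝ (mfderiv (model₃ I₁ I₂ I₃) I F p
      (incl₁ I₁ I₂ I₃ p (riemGrad (fun x ↦ Real.log (f₁ x)) p.1))) (xi (F p)) : ℝ) =
      beta (F p) := by
  have : Nontrivial E₂ := Module.finrank_pos_iff.1 hdim
  obtain ⟨b, hb⟩ : ∃ b : TangentSpace I₂ p.2.1, b ≠ 0 := exists_ne (0 : E₂)
  set v := incl₂ I₁ I₂ I₃ p b with hv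
  have hvm : v ∈ dist₂ I₁ I₂ I₃ p := incl₂_mem b
  have hv0 : mfderiv (model₃ I₁ I₂ I₃) I F p v ≠ 0 := fun h ↦
    hb (incl₂_injective (hF.mfderiv_injective (by rw [← hv, h]; simp)))
  obtain ⟨u, hu, h⟩ := hxi p
  -- The component of `B(v, v)` along `ξ` is computed from `∇ξ` and from the warped metric.
  have key := hM.inner_mapHessian_xi hnabla hF.smooth v (w := v)
    ((extend_mem_dist₂ hvm).mono fun q hq ↦ hF.inner_xi_of_mem_dist₂ hxi hq)
  rw [← h, real_inner_comm, hF.inner_mapHessian₂₂ hnabla hvm hvm (mem_dist₁_iff.1 hu).1] at key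
  rw [← h, hF.inner_mfderiv_riemGrad]
  have h2 : (inner ℝ (mfderiv (model₃ I₁ I₂ I₃) I F p v)
      (mfderiv (model₃ I₁ I₂ I₃) I F p v) : ℝ) ≠ 0 := inner_self_ne_zero.2 hv0
  refine mul_right_cancel₀ h2 ?_
  linarith

/-- The derivative of `ln f₂` in the direction of `ξ` is `β`. -/
theorem inner_riemGrad_log_xi₃ (hdim : 0 < Module.finrank ℝ E₃) :
    (inner ℝ (mfderiv (model₃ I₁ I₂ I₃) I F p
      (incl₁ I₁ I₂ I₃ p (riemGrad (fun x ↦ Real.log (f₂ x)) p.1))) (xi (F p)) : ℝ) =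
      beta (F p) := by
  have : Nontrivial E₃ := Module.finrank_pos_iff.1 hdim
  obtain ⟨b, hb⟩ : ∃ b : TangentSpace I₃ p.2.2, b ≠ 0 := exists_ne (0 : E₃)
  set v := incl₃ I₁ I₂ I₃ p b with hv
  have hvm : v ∈ dist₃ I₁ I₂ I₃ p := incl₃_mem b
  have hv0 : mfderiv (model₃ I₁ I₂ I₃) I F p v ≠ 0 := fun h ↦
    hb (incl₃_injective (hF.mfderiv_injective (by rw [← hv, h]; simp)))
  obtain ⟨u, hu, h⟩ := hxi p
  -- The component of `B(v, v)` along `ξ` is computed from `∇ξ` and from the warped metric.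
  have key := hM.inner_mapHessian_xi hnabla hF.smooth v (w := v)
    ((extend_mem_dist₃ hvm).mono fun q hq ↦ hF.inner_xi_of_mem_dist₃ hxi hq)
  rw [← h, real_inner_comm, hF.inner_mapHessian₃₃ hnabla hvm hvm (mem_dist₁_iff.1 hu).2] at key
  rw [← h, hF.inner_mfderiv_riemGrad]
  have h2 : (inner ℝ (mfderiv (model₃ I₁ I₂ I₃) I F p v)
      (mfderiv (model₃ I₁ I₂ I₃) I F p v) : ℝ) ≠ 0 := inner_self_ne_zero.2 hv0
  refine mul_right_cancel₀ h2 ?_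
  linarith

variable (hinv : IsInvariant₁ I₁ I₂ I₃ I Phi F)
include hinv

/-- The derivative of `⟪Φ X, W⟫ = 0` along `V`, for `X` tangent to the first factor and `V`, `W`
tangent to the second one. -/
theorem inner_mapHessian_Phi₂ (hx : x ∈ dist₁ I₁ I₂ I₃ p) (hv : v ∈ dist₂ I₁ I₂ I₃ p)
    (hw : w ∈ dist₂ I₁ I₂ I₃ p) :
    (inner ℝ (mapHessian (model₃ I₁ I₂ I₃) nabla F p x v)
        (Phi (F p) (mfderiv (model₃ I₁ I₂ I₃) I F p w)) : ℝ) =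
      -inner ℝ (mfderiv (model₃ I₁ I₂ I₃) I F p
          (incl₁ I₁ I₂ I₃ p (riemGrad (fun x ↦ Real.log (f₁ x)) p.1)))
          (Phi (F p) (mfderiv (model₃ I₁ I₂ I₃) I F p x))
        * inner ℝ (mfderiv (model₃ I₁ I₂ I₃) I F p v) (mfderiv (model₃ I₁ I₂ I₃) I F p w)
      - beta (F p) * inner ℝ (xi (F p)) (mfderiv (model₃ I₁ I₂ I₃) I F p x)
        * inner ℝ (Phi (F p) (mfderiv (model₃ I₁ I₂ I₃) I F p v))
          (mfderiv (model₃ I₁ I₂ I₃) I F p w) := by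
  have hperp : ∀ᶠ q in 𝓝 p, (inner ℝ (Phi (F q) (mfderiv (model₃ I₁ I₂ I₃) I F q
      (FiberBundle.extend (E₁ × E₂ × E₃) x q))) (mfderiv (model₃ I₁ I₂ I₃) I F q
      (FiberBundle.extend (E₁ × E₂ × E₃) w q)) : ℝ) = 0 := by
    filter_upwards [extend_mem_dist₁ hx, extend_mem_dist₂ hw] with q hq hq'
    obtain ⟨y, hy, h⟩ := hinv q _ hq
    rw [h, hF.inner_eq_zero₁₂ hy hq']
  have key := hM.inner_mapHessian_Phi hnabla hF.smooth v hperp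
  obtain ⟨y, hy, h⟩ := hinv p _ hx
  rw [mapHessian_symm hnabla hF.smooth, key, hF.inner_xi_of_mem_dist₂ hxi hw, h,
    real_inner_comm, hF.inner_mapHessian₂₂ hnabla hv hw (mem_dist₁_iff.1 hy).1,
    hF.inner_mfderiv_riemGrad]
  ring

/-- The derivative of `⟪Φ X, W⟫ = 0` along `V`, for `X` tangent to the first factor and `V`, `W`
tangent to the third one. -/
theorem inner_mapHessian_Phi₃ (hx : x ∈ dist₁ I₁ I₂ I₃ p) (hv : v ∈ dist₃ I₁ I₂ I₃ p)
    (hw : w ∈ dist₃ I₁ I₂ I₃ p) :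
    (inner ℝ (mapHessian (model₃ I₁ I₂ I₃) nabla F p x v)
        (Phi (F p) (mfderiv (model₃ I₁ I₂ I₃) I F p w)) : ℝ) =
      -inner ℝ (mfderiv (model₃ I₁ I₂ I₃) I F p
          (incl₁ I₁ I₂ I₃ p (riemGrad (fun x ↦ Real.log (f₂ x)) p.1)))
          (Phi (F p) (mfderiv (model₃ I₁ I₂ I₃) I F p x))
        * inner ℝ (mfderiv (model₃ I₁ I₂ I₃) I F p v) (mfderiv (model₃ I₁ I₂ I₃) I F p w)
      - beta (F p) * inner ℝ (xi (F p)) (mfderiv (model₃ I₁ I₂ I₃) I F p x)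
        * inner ℝ (Phi (F p) (mfderiv (model₃ I₁ I₂ I₃) I F p v))
          (mfderiv (model₃ I₁ I₂ I₃) I F p w) := by
  have hperp : ∀ᶠ q in 𝓝 p, (inner ℝ (Phi (F q) (mfderiv (model₃ I₁ I₂ I₃) I F q
      (FiberBundle.extend (E₁ × E₂ × E₃) x q))) (mfderiv (model₃ I₁ I₂ I₃) I F q
      (FiberBundle.extend (E₁ × E₂ × E₃) w q)) : ℝ) = 0 := by
    filter_upwards [extend_mem_dist₁ hx, extend_mem_dist₃ hw] with q hq hq'
    obtain ⟨y, hy, h⟩ := hinv q _ hq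
    rw [h, hF.inner_eq_zero₁₃ hy hq']
  have key := hM.inner_mapHessian_Phi hnabla hF.smooth v hperp
  obtain ⟨y, hy, h⟩ := hinv p _ hx
  rw [mapHessian_symm hnabla hF.smooth, key, hF.inner_xi_of_mem_dist₃ hxi hw, h,
    real_inner_comm, hF.inner_mapHessian₃₃ hnabla hv hw (mem_dist₁_iff.1 hy).2,
    hF.inner_mfderiv_riemGrad]
  ring

end IsBiWarpedImmersion

end Pointwise

section Inequality

open Filter Topology

variable {E₁ : Type*} [NormedAddCommGroup E₁] [NormedSpace ℝ E₁] [FiniteDimensional ℝ E₁]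
  {H₁ : Type*} [TopologicalSpace H₁] {I₁ : ModelWithCorners ℝ E₁ H₁} [I₁.Boundaryless]
  {L₁ : Type*} [TopologicalSpace L₁] [ChartedSpace H₁ L₁] [IsManifold I₁ ∞ L₁]
  [RiemannianBundle (fun x : L₁ ↦ TangentSpace I₁ x)]
  [IsContMDiffRiemannianBundle I₁ ∞ E₁ (fun x : L₁ ↦ TangentSpace I₁ x)]
  {E₂ : Type*} [NormedAddCommGroup E₂] [NormedSpace ℝ E₂] [FiniteDimensional ℝ E₂]
  {H₂ : Type*} [TopologicalSpace H₂] {I₂ : ModelWithCorners ℝ E₂ H₂} [I₂.Boundaryless]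
  {L₂ : Type*} [TopologicalSpace L₂] [ChartedSpace H₂ L₂] [IsManifold I₂ ∞ L₂]
  [RiemannianBundle (fun x : L₂ ↦ TangentSpace I₂ x)]
  [IsContMDiffRiemannianBundle I₂ ∞ E₂ (fun x : L₂ ↦ TangentSpace I₂ x)]
  {E₃ : Type*} [NormedAddCommGroup E₃] [NormedSpace ℝ E₃] [FiniteDimensional ℝ E₃]
  {H₃ : Type*} [TopologicalSpace H₃] {I₃ : ModelWithCorners ℝ E₃ H₃} [I₃.Boundaryless]
  {L₃ : Type*} [TopologicalSpace L₃] [ChartedSpace H₃ L₃] [IsManifold I₃ ∞ L₃]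
  [RiemannianBundle (fun x : L₃ ↦ TangentSpace I₃ x)]
  [IsContMDiffRiemannianBundle I₃ ∞ E₃ (fun x : L₃ ↦ TangentSpace I₃ x)]
  {E : Type*} [NormedAddCommGroup E] [NormedSpace ℝ E] [FiniteDimensional ℝ E]
  {H : Type*} [TopologicalSpace H] {I : ModelWithCorners ℝ E H}
  {M : Type*} [TopologicalSpace M] [ChartedSpace H M] [IsManifold I ∞ M]
  [RiemannianBundle (fun x : M ↦ TangentSpace I x)]
  [IsContMDiffRiemannianBundle I ∞ E (fun x : M ↦ TangentSpace I x)]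
  {nabla : CovariantDerivative I E (TangentSpace I : M → Type _)}
  {Phi : ∀ x : M, TangentSpace I x →L[ℝ] TangentSpace I x}
  {xi : ∀ x : M, TangentSpace I x} {eta : ∀ x : M, TangentSpace I x →L[ℝ] ℝ} {beta : M → ℝ}
  {f₁ f₂ : L₁ → ℝ} {F : L₁ × L₂ × L₃ → M} {p : L₁ × L₂ × L₃}

/-! ### The inequality, and the case of equality -/

/-- The inequality for the squared norm of the second fundamental form of a bi-warped submanifold
with invariant, anti-invariant and slant factors, with the squared norms `S₁`, `S₂`, `S₃` of the
diagonal blocks kept in the lower bound: they vanish in the case of equality. -/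
theorem IsBiWarpedImmersion.secondFFNormSq_ge (hF : IsBiWarpedImmersion I₁ I₂ I₃ I f₁ f₂ F)
    (hnabla : IsLeviCivita nabla) (hM : IsLocConfAlmostCosymplectic nabla Phi xi eta beta)
    (hxi : IsTangent₁ I₁ I₂ I₃ I xi F) (hinv : IsInvariant₁ I₁ I₂ I₃ I Phi F)
    (hanti : IsAntiInvariant₂ I₁ I₂ I₃ I Phi F) {nu : ℝ} (hnu₀ : 0 < nu) (hnu₁ : nu < Real.pi / 2)
    (hslant : IsSlant₃ I₁ I₂ I₃ I Phi nu F)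
    (hmixed : ∀ u ∈ dist₂ I₁ I₂ I₃ p, ∀ v ∈ dist₃ I₁ I₂ I₃ p,
      secondFF (model₃ I₁ I₂ I₃) nabla F p u v = 0)
    (hdim₂ : 0 < Module.finrank ℝ E₂) (hdim₃ : 0 < Module.finrank ℝ E₃) :
    ∃ S₁ S₂ S₃ : ℝ, 0 ≤ S₁ ∧ 0 ≤ S₂ ∧ 0 ≤ S₃ ∧
      (S₁ = 0 → ∀ u ∈ dist₁ I₁ I₂ I₃ p, ∀ v ∈ dist₁ I₁ I₂ I₃ p,
        secondFF (model₃ I₁ I₂ I₃) nabla F p u v = 0) ∧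
      (S₂ = 0 → ∀ u ∈ dist₂ I₁ I₂ I₃ p, ∀ v ∈ dist₂ I₁ I₂ I₃ p,
        secondFF (model₃ I₁ I₂ I₃) nabla F p u v = 0) ∧
      (S₃ = 0 → ∀ u ∈ dist₃ I₁ I₂ I₃ p, ∀ v ∈ dist₃ I₁ I₂ I₃ p,
        secondFF (model₃ I₁ I₂ I₃) nabla F p u v = 0) ∧
      2 * Module.finrank ℝ E₂ *
          (‖riemGrad (I := I₁) (fun x ↦ Real.log (f₁ x)) p.1‖ ^ 2 - beta (F p) ^ 2)
        + 2 * Module.finrank ℝ E₃ * (1 / Real.sin nu) ^ 2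
          * (Real.sin nu ^ 2 + 2 * Real.cos nu ^ 2)
          * (‖riemGrad (I := I₁) (fun x ↦ Real.log (f₂ x)) p.1‖ ^ 2 - beta (F p) ^ 2)
        + (S₁ + S₂ + S₃) ≤
      secondFFNormSq (model₃ I₁ I₂ I₃) nabla F p := by
  have : FiniteDimensional ℝ (TangentSpace I (F p)) := inferInstanceAs (FiniteDimensional ℝ E)
  have hsin : Real.sin nu ≠ 0 :=
    (Real.sin_pos_of_pos_of_lt_pi hnu₀ (hnu₁.trans (half_lt_self Real.pi_pos))).ne'
  have hcos : Real.cos nu ≠ 0 :=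
    (Real.cos_pos_of_mem_Ioo ⟨by linarith [Real.pi_pos], hnu₁⟩).ne'
  obtain ⟨h, hh⟩ := exists_bilinear_secondFF hnabla hF.smooth (hF.mfderiv_injective (p := p))
  set d := (mfderiv (model₃ I₁ I₂ I₃) I F p).toLinearMap with hd
  set D₁ := (dist₁ I₁ I₂ I₃ p).map d with hD₁
  set D₂ := (dist₂ I₁ I₂ I₃ p).map d with hD₂
  set D₃ := (dist₃ I₁ I₂ I₃ p).map d with hD₃
  have hsup : D₁ ⊔ D₂ ⊔ D₃ = immTangent (I := I) (model₃ I₁ I₂ I₃) F p := by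
    rw [hD₁, hD₂, hD₃, ← Submodule.map_sup, ← Submodule.map_sup, dist_sup_eq_top,
      Submodule.map_top]
    rfl
  have hnorm : secondFFNormSq (model₃ I₁ I₂ I₃) nabla F p =
      formNormSq h (D₁ ⊔ D₂ ⊔ D₃) (D₁ ⊔ D₂ ⊔ D₃) := by
    rw [hsup, secondFFNormSq, formNormSq]
    refine Finset.sum_congr rfl fun i _ ↦ Finset.sum_congr rfl fun j _ ↦ ?_
    rw [real_inner_self_eq_norm_sq, ← hh, mfderiv_tangentFrame, mfderiv_tangentFrame]
  have hvanish {A B : Submodule ℝ (TangentSpace (model₃ I₁ I₂ I₃) p)}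
      (h0 : formNormSq h (A.map d) (B.map d) = 0) : ∀ u ∈ A, ∀ v ∈ B,
      secondFF (model₃ I₁ I₂ I₃) nabla F p u v = 0 := fun u hu v hv ↦ by
    rw [← hh]
    exact formNormSq_eq_zero_iff.1 h0 _ (Submodule.mem_map_of_mem hu) _
      (Submodule.mem_map_of_mem hv)
  refine ⟨formNormSq h D₁ D₁, formNormSq h D₂ D₂, formNormSq h D₃ D₃, formNormSq_nonneg _ _ _,
    formNormSq_nonneg _ _ _, formNormSq_nonneg _ _ _, hvanish, hvanish, hvanish, ?_⟩
  have hmain := formNormSq_ge_of_contact (h := h) (D₁ := D₁) (D₂ := D₂) (D₃ := D₃)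
    (Phi := (Phi (F p)).toLinearMap) (xi := xi (F p))
    (n₁ := d (incl₁ I₁ I₂ I₃ p (riemGrad (fun x ↦ Real.log (f₁ x)) p.1)))
    (n₂ := d (incl₁ I₁ I₂ I₃ p (riemGrad (fun x ↦ Real.log (f₂ x)) p.1)))
    (b := beta (F p)) (nu := nu)
    (Submodule.isOrtho_iff_inner_eq.2 <| by
      rintro _ ⟨u, hu, rfl⟩ _ ⟨v, hv, rfl⟩; exact hF.inner_eq_zero₁₂ hu hv)
    (Submodule.isOrtho_iff_inner_eq.2 <| by
      rintro _ ⟨u, hu, rfl⟩ _ ⟨v, hv, rfl⟩; exact hF.inner_eq_zero₁₃ hu hv)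
    (Submodule.isOrtho_iff_inner_eq.2 <| by
      rintro _ ⟨u, hu, rfl⟩ _ ⟨v, hv, rfl⟩; exact hF.inner_eq_zero₂₃ hu hv)
    (hM.inner_Phi_left (F p)) (hM.norm_sq_Phi (F p)) (hM.norm_sq_xi (F p))
    (by obtain ⟨u, hu, h⟩ := hxi p; exact ⟨u, hu, h⟩)
    (by
      rintro _ ⟨u, hu, rfl⟩
      obtain ⟨w, hw, h⟩ := hinv p u hu
      exact ⟨w, hw, h.symm⟩)
    (by
      rw [hsup]
      rintro _ ⟨u, hu, rfl⟩ _ ⟨w, rfl⟩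
      exact hanti p u hu w)
    hsin hcos
    (by
      rintro _ ⟨u, hu, rfl⟩ h0
      exact hslant p u hu (fun h ↦ h0 (by rw [h, map_zero])))
    ⟨_, incl₁_mem _, rfl⟩ ⟨_, incl₁_mem _, rfl⟩
    (hF.inner_riemGrad_log_xi₂ hxi hnabla hM hdim₂) (hF.inner_riemGrad_log_xi₃ hxi hnabla hM hdim₃)
    (by
      rw [hsup]
      rintro _ ⟨u, rfl⟩ _ ⟨v, rfl⟩
      exact (hh u v).trans ((secondFF_symm hnabla hF.smooth u v).trans (hh v u).symm))
    (by
      rintro _ ⟨u, hu, rfl⟩ _ ⟨v, hv, rfl⟩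
      exact (hh u v).trans (hmixed u hu v hv))
    (by
      rintro _ ⟨u, hu, rfl⟩ _ ⟨v, hv, rfl⟩ _ ⟨w, hw, rfl⟩
      have h1 := inner_secondFF_of_normal (nabla := nabla) (hanti p w hw) u v
      have h2 := hF.inner_mapHessian_Phi₂ hxi hnabla hM hinv hu hv hw
      rw [hanti p v hv w, mul_zero, sub_zero, ← h1, ← hh] at h2
      exact h2)
    (by
      rintro _ ⟨u, hu, rfl⟩ _ ⟨v, hv, rfl⟩
      refine ⟨mapHessian (model₃ I₁ I₂ I₃) nabla F p u v, fun m hm ↦ ?_, ?_, ?_⟩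
      · refine (congrArg (fun z ↦ (inner ℝ z m : ℝ)) (hh u v)).trans ?_
        refine inner_secondFF_of_normal (fun w ↦ hm _ ?_) u v
        rw [hsup]
        exact ⟨w, rfl⟩
      · rintro _ ⟨w, hw, rfl⟩
        refine (hF.inner_mapHessian₁₃ hnabla hu hv w).trans ?_
        rw [← hF.inner_mfderiv_riemGrad]
        rfl
      · rintro _ ⟨w, hw, rfl⟩
        exact hF.inner_mapHessian_Phi₃ hxi hnabla hM hinv hu hv hw)
  rw [hnorm]
  have r₂ : Module.finrank ℝ D₂ = Module.finrank ℝ E₂ := hF.finrank_map_dist₂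
  have r₃ : Module.finrank ℝ D₃ = Module.finrank ℝ E₃ := hF.finrank_map_dist₃
  have g₁ := hF.norm_sq_mfderiv_incl₁ (riemGrad (fun x ↦ Real.log (f₁ x)) p.1)
  have g₂ := hF.norm_sq_mfderiv_incl₁ (riemGrad (fun x ↦ Real.log (f₂ x)) p.1)
  rw [r₂, r₃] at hmain
  rw [← g₁, ← g₂]
  exact hmain

end Inequality

section Slices

open Filter Topology

variable {E : Type*} [NormedAddCommGroup E] [NormedSpace ℝ E]
  {H : Type*} [TopologicalSpace H] {I : ModelWithCorners ℝ E H}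
  {M : Type*} [TopologicalSpace M] [ChartedSpace H M] [IsManifold I ∞ M]
  {E' : Type*} [NormedAddCommGroup E'] [NormedSpace ℝ E']
  {H' : Type*} [TopologicalSpace H'] {J : ModelWithCorners ℝ E' H'}
  {N : Type*} [TopologicalSpace N] [ChartedSpace H' N] [IsManifold J ∞ N]
  {E'' : Type*} [NormedAddCommGroup E''] [NormedSpace ℝ E'']
  {H'' : Type*} [TopologicalSpace H''] {K : ModelWithCorners ℝ E'' H''}
  {N' : Type*} [TopologicalSpace N'] [ChartedSpace H'' N'] [IsManifold K ∞ N']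
  {F : N → M} {j : N' → N} {p : N'}

/-! ### Second fundamental forms of slices -/

omit [IsManifold J ∞ N] [IsManifold K ∞ N'] in
/-- The chain rule for the covariant derivative along a map. -/
theorem covDerivAlong_comp (nabla : CovariantDerivative I E (TangentSpace I : M → Type _))
    {W : ∀ q : N, TangentSpace I (F q)} (hW : DiffAlongAt I J F W (j p))
    (hj : MDifferentiableAt K J j p) (u : TangentSpace K p) :
    covDerivAlong K nabla (fun q ↦ F (j q)) (fun q ↦ W (j q)) p u =
      covDerivAlong J nabla F W (j p) (mfderiv K J j p u) := by
  obtain ⟨hF, hc⟩ := diffAlongAt_iff.1 hW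
  have h1 : mfderiv K I (fun q ↦ F (j q)) p u = mfderiv J I F (j p) (mfderiv K J j p u) :=
    mfderiv_comp_apply p hF hj u
  have h2 : mvfderiv K (fun q ↦ alongCoord I F (j p) W (j q)) p u =
      mvfderiv J (alongCoord I F (j p) W) (j p) (mfderiv K J j p u) :=
    mfderiv_comp_apply p hc hj u
  rw [covDerivAlong_eq, covDerivAlong_eq, h1]
  exact congrArg₂ (· + ·) (congrArg _ h2) rfl

/-- The second derivative of the restriction of `F` to a submanifold whose coordinate fields extend
to coordinate fields. -/
theorem mapHessian_comp [J.Boundaryless] [FiniteDimensional ℝ E]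
    (nabla : CovariantDerivative I E (TangentSpace I : M → Type _)) (hF : ContMDiff J I ∞ F)
    (hj : ContMDiff K J ∞ j) (u v : TangentSpace K p)
    (hv : ∀ᶠ q in 𝓝 p, mfderiv K J j q (FiberBundle.extend E'' v q) =
      FiberBundle.extend E' (mfderiv K J j p v) (j q)) :
    mapHessian K nabla (fun q ↦ F (j q)) p u v =
      mapHessian J nabla F (j p) (mfderiv K J j p u) (mfderiv K J j p v) := by
  have hjd (q : N') : MDifferentiableAt K J j q := hj.mdifferentiableAt (by simp)
  rw [mapHessian, mapHessian, ← covDerivAlong_comp nabla (diffAlongAt_mfderiv_extend hF _) (hjd p)]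
  refine covDerivAlong_congr nabla (hv.mono fun q hq ↦ ?_) u
  rw [← hq]
  exact mfderiv_comp_apply q (hF.mdifferentiableAt (by simp)) (hjd q) _

variable [FiniteDimensional ℝ E''] [RiemannianBundle (fun x : M ↦ TangentSpace I x)]
  {nabla : CovariantDerivative I E (TangentSpace I : M → Type _)} {G : N' → M}

/-- If the second derivative is the sum of a tangential vector and a normal one, the latter is the
second fundamental form. -/
theorem secondFF_eq_of_mapHessian {u v w : TangentSpace K p} {m : TangentSpace I (G p)}
    (h : mapHessian K nabla G p u v = mfderiv K I G p w + m)
    (hm : ∀ w' : TangentSpace K p, (inner ℝ m (mfderiv K I G p w') : ℝ) = 0) :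
    secondFF K nabla G p u v = m := by
  have h1 : (immTangent (I := I) K G p).starProjection (mfderiv K I G p w) = mfderiv K I G p w :=
    Submodule.starProjection_eq_self_iff.2 ⟨w, rfl⟩
  have h2 : (immTangent (I := I) K G p).starProjection m = 0 := by
    refine (Submodule.starProjection_apply_eq_zero_iff _).2 ?_
    rintro _ ⟨w', rfl⟩
    exact (real_inner_comm _ _).trans (hm w')
  rw [secondFF_eq, h, map_add, h1, h2]
  abel

/-- An immersion whose second fundamental form is proportional to the metric is totally umbilical,
and the factor is the mean curvature vector. -/
theorem meanCurvature_eq_of_secondFF {m : TangentSpace I (G p)}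
    (hdim : Module.finrank ℝ (immTangent (I := I) K G p) ≠ 0)
    (h : ∀ u v : TangentSpace K p, secondFF K nabla G p u v =
      (inner ℝ (mfderiv K I G p u) (mfderiv K I G p v) : ℝ) • m) :
    meanCurvature K nabla G p = m := by
  have h1 (i) : secondFF K nabla G p (tangentFrame (I := I) K G p i)
      (tangentFrame (I := I) K G p i) = m := by
    rw [h, mfderiv_tangentFrame, ← Submodule.coe_inner, real_inner_self_eq_norm_sq,
      (stdOrthonormalBasis ℝ _).norm_eq_one]
    simp
  rw [meanCurvature, Finset.sum_congr rfl fun i _ ↦ h1 i]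
  simp [← Nat.cast_smul_eq_nsmul ℝ, smul_smul, hdim]

end Slices

section SliceMaps

open Filter Topology

variable {E₁ : Type*} [NormedAddCommGroup E₁] [NormedSpace ℝ E₁]
  {H₁ : Type*} [TopologicalSpace H₁] {I₁ : ModelWithCorners ℝ E₁ H₁}
  {L₁ : Type*} [TopologicalSpace L₁] [ChartedSpace H₁ L₁]
  {E₂ : Type*} [NormedAddCommGroup E₂] [NormedSpace ℝ E₂]
  {H₂ : Type*} [TopologicalSpace H₂] {I₂ : ModelWithCorners ℝ E₂ H₂}
  {L₂ : Type*} [TopologicalSpace L₂] [ChartedSpace H₂ L₂]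
  {E₃ : Type*} [NormedAddCommGroup E₃] [NormedSpace ℝ E₃]
  {H₃ : Type*} [TopologicalSpace H₃] {I₃ : ModelWithCorners ℝ E₃ H₃}
  {L₃ : Type*} [TopologicalSpace L₃] [ChartedSpace H₃ L₃]
  {x : L₁} {y : L₂} {z : L₃}

theorem contMDiff_slice₁ :
    ContMDiff I₁ (model₃ I₁ I₂ I₃) ∞ fun x : L₁ ↦ ((x, y, z) : L₁ × L₂ × L₃) :=
  contMDiff_id.prodMk contMDiff_const

theorem contMDiff_slice₂ :
    ContMDiff I₂ (model₃ I₁ I₂ I₃) ∞ fun y : L₂ ↦ ((x, y, z) : L₁ × L₂ × L₃) :=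
  contMDiff_const.prodMk (contMDiff_id.prodMk contMDiff_const)

theorem contMDiff_slice₃ :
    ContMDiff I₃ (model₃ I₁ I₂ I₃) ∞ fun z : L₃ ↦ ((x, y, z) : L₁ × L₂ × L₃) :=
  contMDiff_const.prodMk (contMDiff_const.prodMk contMDiff_id)

theorem mfderiv_slice₁ (a : TangentSpace I₁ x) :
    mfderiv I₁ (model₃ I₁ I₂ I₃) (fun x : L₁ ↦ ((x, y, z) : L₁ × L₂ × L₃)) x a =
      incl₁ I₁ I₂ I₃ (x, y, z) a :=
  congrArg (fun L : E₁ →L[ℝ] E₁ × E₂ × E₃ ↦ L a)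
    (mfderiv_prod_left (I := I₁) (I' := I₂.prod I₃) (x₀ := x) (y₀ := (y, z)))

theorem mfderiv_slice₂ (b : TangentSpace I₂ y) :
    mfderiv I₂ (model₃ I₁ I₂ I₃) (fun y : L₂ ↦ ((x, y, z) : L₁ × L₂ × L₃)) y b =
      incl₂ I₁ I₂ I₃ (x, y, z) b := by
  have h₁ : MDifferentiableAt I₂ (I₂.prod I₃) (fun y : L₂ ↦ (y, z)) y :=
    mdifferentiableAt_id.prodMk mdifferentiableAt_const
  have h₂ : MDifferentiableAt (I₂.prod I₃) (model₃ I₁ I₂ I₃) (fun q : L₂ × L₃ ↦ (x, q)) (y, z) :=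
    mdifferentiableAt_const.prodMk mdifferentiableAt_id
  refine (mfderiv_comp_apply (g := fun q : L₂ × L₃ ↦ (x, q)) y h₂ h₁ b).trans ?_
  rw [mfderiv_prod_left, mfderiv_prod_right]
  rfl

theorem mfderiv_slice₃ (c : TangentSpace I₃ z) :
    mfderiv I₃ (model₃ I₁ I₂ I₃) (fun z : L₃ ↦ ((x, y, z) : L₁ × L₂ × L₃)) z c =
      incl₃ I₁ I₂ I₃ (x, y, z) c := by
  have h₁ : MDifferentiableAt I₃ (I₂.prod I₃) (fun z : L₃ ↦ (y, z)) z :=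
    mdifferentiableAt_const.prodMk mdifferentiableAt_id
  have h₂ : MDifferentiableAt (I₂.prod I₃) (model₃ I₁ I₂ I₃) (fun q : L₂ × L₃ ↦ (x, q)) (y, z) :=
    mdifferentiableAt_const.prodMk mdifferentiableAt_id
  refine (mfderiv_comp_apply (g := fun q : L₂ × L₃ ↦ (x, q)) z h₂ h₁ c).trans ?_
  rw [mfderiv_prod_right, mfderiv_prod_right]
  rfl

variable [IsManifold I₁ ∞ L₁] [IsManifold I₂ ∞ L₂] [IsManifold I₃ ∞ L₃]
  [I₁.Boundaryless] [I₂.Boundaryless] [I₃.Boundaryless]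

/-- Coordinate fields of a slice extend to coordinate fields of the product. -/
theorem mfderiv_slice₁_extend (a : TangentSpace I₁ x) :
    ∀ᶠ q in 𝓝 x, mfderiv I₁ (model₃ I₁ I₂ I₃) (fun x : L₁ ↦ ((x, y, z) : L₁ × L₂ × L₃)) q
        (FiberBundle.extend E₁ a q) =
      FiberBundle.extend (E₁ × E₂ × E₃)
        (mfderiv I₁ (model₃ I₁ I₂ I₃) (fun x : L₁ ↦ ((x, y, z) : L₁ × L₂ × L₃)) x a)
        ((q, y, z) : L₁ × L₂ × L₃) := by
  rw [mfderiv_slice₁]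
  have hc : ContinuousAt (fun x : L₁ ↦ ((x, y, z) : L₁ × L₂ × L₃)) x :=
    (contMDiff_slice₁ (I₁ := I₁) (I₂ := I₂) (I₃ := I₃)).continuous.continuousAt
  filter_upwards [hc.eventually (dpr₁_extend (incl₁ I₁ I₂ I₃ (x, y, z) a)),
    hc.eventually (extend_mem_dist₁ (incl₁_mem (I₁ := I₁) (I₂ := I₂) (I₃ := I₃) (p := (x, y, z)) a))]
    with q h₁ h
  rw [mem_dist₁_iff] at h
  rw [mfderiv_slice₁, incl₁_apply]
  refine ext_dpr ?_ ?_ ?_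
  · rw [h₁, dpr₁_vec₃, incl₁_apply, dpr₁_vec₃]
  · rw [h.1, dpr₂_vec₃]
  · rw [h.2, dpr₃_vec₃]

theorem mfderiv_slice₂_extend (b : TangentSpace I₂ y) :
    ∀ᶠ q in 𝓝 y, mfderiv I₂ (model₃ I₁ I₂ I₃) (fun y : L₂ ↦ ((x, y, z) : L₁ × L₂ × L₃)) q
        (FiberBundle.extend E₂ b q) =
      FiberBundle.extend (E₁ × E₂ × E₃)
        (mfderiv I₂ (model₃ I₁ I₂ I₃) (fun y : L₂ ↦ ((x, y, z) : L₁ × L₂ × L₃)) y b)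
        ((x, q, z) : L₁ × L₂ × L₃) := by
  rw [mfderiv_slice₂]
  have hc : ContinuousAt (fun y : L₂ ↦ ((x, y, z) : L₁ × L₂ × L₃)) y :=
    (contMDiff_slice₂ (I₁ := I₁) (I₂ := I₂) (I₃ := I₃)).continuous.continuousAt
  filter_upwards [hc.eventually (dpr₂_extend (incl₂ I₁ I₂ I₃ (x, y, z) b)),
    hc.eventually (extend_mem_dist₂ (incl₂_mem (I₁ := I₁) (I₂ := I₂) (I₃ := I₃) (p := (x, y, z)) b))]
    with q h₁ h
  rw [mem_dist₂_iff] at h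
  rw [mfderiv_slice₂, incl₂_apply]
  refine ext_dpr ?_ ?_ ?_
  · rw [h.1, dpr₁_vec₃]
  · rw [h₁, dpr₂_vec₃, incl₂_apply, dpr₂_vec₃]
  · rw [h.2, dpr₃_vec₃]

theorem mfderiv_slice₃_extend (c : TangentSpace I₃ z) :
    ∀ᶠ q in 𝓝 z, mfderiv I₃ (model₃ I₁ I₂ I₃) (fun z : L₃ ↦ ((x, y, z) : L₁ × L₂ × L₃)) q
        (FiberBundle.extend E₃ c q) =
      FiberBundle.extend (E₁ × E₂ × E₃)
        (mfderiv I₃ (model₃ I₁ I₂ I₃) (fun z : L₃ ↦ ((x, y, z) : L₁ × L₂ × L₃)) z c)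
        ((x, y, q) : L₁ × L₂ × L₃) := by
  rw [mfderiv_slice₃]
  have hc : ContinuousAt (fun z : L₃ ↦ ((x, y, z) : L₁ × L₂ × L₃)) z :=
    (contMDiff_slice₃ (I₁ := I₁) (I₂ := I₂) (I₃ := I₃)).continuous.continuousAt
  filter_upwards [hc.eventually (dpr₃_extend (incl₃ I₁ I₂ I₃ (x, y, z) c)),
    hc.eventually (extend_mem_dist₃ (incl₃_mem (I₁ := I₁) (I₂ := I₂) (I₃ := I₃) (p := (x, y, z)) c))]
    with q h₁ h
  rw [mem_dist₃_iff] at h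
  rw [mfderiv_slice₃, incl₃_apply]
  refine ext_dpr ?_ ?_ ?_
  · rw [h.1, dpr₁_vec₃]
  · rw [h.2, dpr₂_vec₃]
  · rw [h₁, dpr₃_vec₃, incl₃_apply, dpr₃_vec₃]

end SliceMaps

section SliceGeometry

variable {E₁ : Type*} [NormedAddCommGroup E₁] [NormedSpace ℝ E₁]
  {H₁ : Type*} [TopologicalSpace H₁] {I₁ : ModelWithCorners ℝ E₁ H₁}
  {L₁ : Type*} [TopologicalSpace L₁] [ChartedSpace H₁ L₁]
  [RiemannianBundle (fun x : L₁ ↦ TangentSpace I₁ x)]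
  {E₂ : Type*} [NormedAddCommGroup E₂] [NormedSpace ℝ E₂]
  {H₂ : Type*} [TopologicalSpace H₂] {I₂ : ModelWithCorners ℝ E₂ H₂}
  {L₂ : Type*} [TopologicalSpace L₂] [ChartedSpace H₂ L₂]
  [RiemannianBundle (fun x : L₂ ↦ TangentSpace I₂ x)]
  {E₃ : Type*} [NormedAddCommGroup E₃] [NormedSpace ℝ E₃]
  {H₃ : Type*} [TopologicalSpace H₃] {I₃ : ModelWithCorners ℝ E₃ H₃}
  {L₃ : Type*} [TopologicalSpace L₃] [ChartedSpace H₃ L₃]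
  [RiemannianBundle (fun x : L₃ ↦ TangentSpace I₃ x)]
  {E : Type*} [NormedAddCommGroup E] [NormedSpace ℝ E]
  {H : Type*} [TopologicalSpace H] {I : ModelWithCorners ℝ E H}
  {M : Type*} [TopologicalSpace M] [ChartedSpace H M]
  [RiemannianBundle (fun x : M ↦ TangentSpace I x)]
  {f₁ f₂ : L₁ → ℝ} {F : L₁ × L₂ × L₃ → M} {x : L₁} {y : L₂} {z : L₃}

/-! ### Slices of a bi-warped submanifold -/

namespace IsBiWarpedImmersion

variable {p : L₁ × L₂ × L₃} {u : TangentSpace (model₃ I₁ I₂ I₃) p}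
  (hF : IsBiWarpedImmersion I₁ I₂ I₃ I f₁ f₂ F)
include hF

/-- A tangent vector orthogonal to the other two factors is tangent to the first one. -/
theorem eq_incl₁_of_inner_eq_zero
    (h : ∀ w : TangentSpace (model₃ I₁ I₂ I₃) p, dpr₁ I₁ I₂ I₃ p w = 0 →
      (inner ℝ (mfderiv (model₃ I₁ I₂ I₃) I F p u) (mfderiv (model₃ I₁ I₂ I₃) I F p w) : ℝ) = 0) :
    u = incl₁ I₁ I₂ I₃ p (dpr₁ I₁ I₂ I₃ p u) := by
  have hw : dpr₁ I₁ I₂ I₃ p (u - incl₁ I₁ I₂ I₃ p (dpr₁ I₁ I₂ I₃ p u)) = 0 := by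
    rw [map_sub, incl₁_apply, dpr₁_vec₃, sub_self]
  refine sub_eq_zero.1 (hF.mfderiv_injective ?_)
  rw [map_zero, ← inner_self_eq_zero (𝕜 := ℝ)]
  conv_lhs => enter [2]; rw [map_sub]
  rw [inner_sub_left, h _ hw, hF.inner_of_mem_dist₁ (incl₁_mem _), hw, inner_zero_right, sub_zero]

theorem eq_incl₂_of_inner_eq_zero
    (h : ∀ w : TangentSpace (model₃ I₁ I₂ I₃) p, dpr₂ I₁ I₂ I₃ p w = 0 →
      (inner ℝ (mfderiv (model₃ I₁ I₂ I₃) I F p u) (mfderiv (model₃ I₁ I₂ I₃) I F p w) : ℝ) = 0) :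
    u = incl₂ I₁ I₂ I₃ p (dpr₂ I₁ I₂ I₃ p u) := by
  have hw : dpr₂ I₁ I₂ I₃ p (u - incl₂ I₁ I₂ I₃ p (dpr₂ I₁ I₂ I₃ p u)) = 0 := by
    rw [map_sub, incl₂_apply, dpr₂_vec₃, sub_self]
  refine sub_eq_zero.1 (hF.mfderiv_injective ?_)
  rw [map_zero, ← inner_self_eq_zero (𝕜 := ℝ)]
  conv_lhs => enter [2]; rw [map_sub]
  rw [inner_sub_left, h _ hw, hF.inner_of_mem_dist₂ (incl₂_mem _), hw, inner_zero_right, mul_zero,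
    sub_zero]

theorem eq_incl₃_of_inner_eq_zero
    (h : ∀ w : TangentSpace (model₃ I₁ I₂ I₃) p, dpr₃ I₁ I₂ I₃ p w = 0 →
      (inner ℝ (mfderiv (model₃ I₁ I₂ I₃) I F p u) (mfderiv (model₃ I₁ I₂ I₃) I F p w) : ℝ) = 0) :
    u = incl₃ I₁ I₂ I₃ p (dpr₃ I₁ I₂ I₃ p u) := by
  have hw : dpr₃ I₁ I₂ I₃ p (u - incl₃ I₁ I₂ I₃ p (dpr₃ I₁ I₂ I₃ p u)) = 0 := by
    rw [map_sub, incl₃_apply, dpr₃_vec₃, sub_self]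
  refine sub_eq_zero.1 (hF.mfderiv_injective ?_)
  rw [map_zero, ← inner_self_eq_zero (𝕜 := ℝ)]
  conv_lhs => enter [2]; rw [map_sub]
  rw [inner_sub_left, h _ hw, hF.inner_of_mem_dist₃ (incl₃_mem _), hw, inner_zero_right, mul_zero,
    sub_zero]

theorem mfderiv_slice₁ (a : TangentSpace I₁ x) :
    mfderiv I₁ I (fun x ↦ F (x, y, z)) x a =
      mfderiv (model₃ I₁ I₂ I₃) I F (x, y, z) (incl₁ I₁ I₂ I₃ (x, y, z) a) := by
  rw [← _root_.mfderiv_slice₁]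
  exact mfderiv_comp_apply (g := F) x (hF.smooth.mdifferentiableAt (by simp))
    (contMDiff_slice₁.mdifferentiableAt (by simp)) a

theorem mfderiv_slice₂ (b : TangentSpace I₂ y) :
    mfderiv I₂ I (fun y ↦ F (x, y, z)) y b =
      mfderiv (model₃ I₁ I₂ I₃) I F (x, y, z) (incl₂ I₁ I₂ I₃ (x, y, z) b) := by
  rw [← _root_.mfderiv_slice₂]
  exact mfderiv_comp_apply (g := F) y (hF.smooth.mdifferentiableAt (by simp))
    (contMDiff_slice₂.mdifferentiableAt (by simp)) b

theorem mfderiv_slice₃ (c : TangentSpace I₃ z) :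
    mfderiv I₃ I (fun z ↦ F (x, y, z)) z c =
      mfderiv (model₃ I₁ I₂ I₃) I F (x, y, z) (incl₃ I₁ I₂ I₃ (x, y, z) c) := by
  rw [← _root_.mfderiv_slice₃]
  exact mfderiv_comp_apply (g := F) z (hF.smooth.mdifferentiableAt (by simp))
    (contMDiff_slice₃.mdifferentiableAt (by simp)) c

theorem finrank_immTangent_slice₂ :
    Module.finrank ℝ (immTangent (I := I) I₂ (fun y ↦ F (x, y, z)) y) = Module.finrank ℝ E₂ := by
  refine LinearMap.finrank_range_of_inj fun b b' h ↦ ?_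
  refine incl₂_injective (I₁ := I₁) (I₃ := I₃) (p := (x, y, z)) (hF.mfderiv_injective ?_)
  exact (hF.mfderiv_slice₂ b).symm.trans (h.trans (hF.mfderiv_slice₂ b'))

theorem finrank_immTangent_slice₃ :
    Module.finrank ℝ (immTangent (I := I) I₃ (fun z ↦ F (x, y, z)) z) = Module.finrank ℝ E₃ := by
  refine LinearMap.finrank_range_of_inj fun c c' h ↦ ?_
  refine incl₃_injective (I₁ := I₁) (I₂ := I₂) (p := (x, y, z)) (hF.mfderiv_injective ?_)
  exact (hF.mfderiv_slice₃ c).symm.trans (h.trans (hF.mfderiv_slice₃ c'))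

variable [FiniteDimensional ℝ E₁] [FiniteDimensional ℝ E₂] [FiniteDimensional ℝ E₃]
  [FiniteDimensional ℝ E] [I₁.Boundaryless] [I₂.Boundaryless] [I₃.Boundaryless]
  [IsManifold I₁ ∞ L₁] [IsManifold I₂ ∞ L₂] [IsManifold I₃ ∞ L₃] [IsManifold I ∞ M]
  [IsContMDiffRiemannianBundle I₁ ∞ E₁ (fun x : L₁ ↦ TangentSpace I₁ x)]
  [IsContMDiffRiemannianBundle I₂ ∞ E₂ (fun x : L₂ ↦ TangentSpace I₂ x)]
  [IsContMDiffRiemannianBundle I₃ ∞ E₃ (fun x : L₃ ↦ TangentSpace I₃ x)]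
  [IsContMDiffRiemannianBundle I ∞ E (fun x : M ↦ TangentSpace I x)]
  {nabla : CovariantDerivative I E (TangentSpace I : M → Type _)}
  (hnabla : IsLeviCivita nabla)
include hnabla

/-- Where the second fundamental form of the submanifold vanishes on the first factor, so does the
second fundamental form of the slice. -/
theorem secondFF_slice₁_eq_zero
    (h : ∀ u ∈ dist₁ I₁ I₂ I₃ (x, y, z), ∀ v ∈ dist₁ I₁ I₂ I₃ (x, y, z),
      secondFF (model₃ I₁ I₂ I₃) nabla F (x, y, z) u v = 0) (a a' : TangentSpace I₁ x) :
    secondFF I₁ nabla (fun x ↦ F (x, y, z)) x a a' = 0 := by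
  have ha := incl₁_mem (I₁ := I₁) (I₂ := I₂) (I₃ := I₃) (p := (x, y, z)) a
  have ha' := incl₁_mem (I₁ := I₁) (I₂ := I₂) (I₃ := I₃) (p := (x, y, z)) a'
  have hB := mapHessian_comp nabla hF.smooth contMDiff_slice₁ a a' (mfderiv_slice₁_extend
    (I₁ := I₁) (I₂ := I₂) (I₃ := I₃) (y := y) (z := z) a')
  rw [_root_.mfderiv_slice₁, _root_.mfderiv_slice₁] at hB
  obtain ⟨w, hw⟩ := Submodule.starProjection_eq_self_iff.1 (sub_eq_zero.1 (h _ ha _ ha')).symm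
  have hw' : mfderiv (model₃ I₁ I₂ I₃) I F (x, y, z) w =
      mapHessian (model₃ I₁ I₂ I₃) nabla F (x, y, z) _ _ := hw
  have hin := hF.eq_incl₁_of_inner_eq_zero (u := w) fun w' h' ↦ by
    rw [hw']; exact hF.inner_mapHessian₁₁ hnabla ha ha' h'
  refine secondFF_eq_of_mapHessian (w := dpr₁ I₁ I₂ I₃ (x, y, z) w) ?_ fun _ ↦ inner_zero_left _
  rw [add_zero, hF.mfderiv_slice₁]
  refine hB.trans (hw'.symm.trans ?_)
  exact congrArg (mfderiv (model₃ I₁ I₂ I₃) I F (x, y, z)) hin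

/-- Where the second fundamental form of the submanifold vanishes on the second factor, the slice
of this factor is umbilical in the ambient manifold with the mean curvature that it has in the
warped product. -/
theorem secondFF_slice₂
    (h : ∀ u ∈ dist₂ I₁ I₂ I₃ (x, y, z), ∀ v ∈ dist₂ I₁ I₂ I₃ (x, y, z),
      secondFF (model₃ I₁ I₂ I₃) nabla F (x, y, z) u v = 0) (b b' : TangentSpace I₂ y) :
    secondFF I₂ nabla (fun y ↦ F (x, y, z)) y b b' =
      (inner ℝ (mfderiv I₂ I (fun y ↦ F (x, y, z)) y b)
        (mfderiv I₂ I (fun y ↦ F (x, y, z)) y b') : ℝ) •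
      -mfderiv I₁ I (fun x ↦ F (x, y, z)) x (riemGrad (fun x ↦ Real.log (f₁ x)) x) := by
  have hb := incl₂_mem (I₁ := I₁) (I₂ := I₂) (I₃ := I₃) (p := (x, y, z)) b
  have hb' := incl₂_mem (I₁ := I₁) (I₂ := I₂) (I₃ := I₃) (p := (x, y, z)) b'
  have hB := mapHessian_comp nabla hF.smooth contMDiff_slice₂ b b' (mfderiv_slice₂_extend
    (I₁ := I₁) (I₂ := I₂) (I₃ := I₃) (x := x) (z := z) b')
  rw [_root_.mfderiv_slice₂, _root_.mfderiv_slice₂] at hB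
  obtain ⟨w, hw⟩ := Submodule.starProjection_eq_self_iff.1 (sub_eq_zero.1 (h _ hb _ hb')).symm
  have hw' : mfderiv (model₃ I₁ I₂ I₃) I F (x, y, z) w =
      mapHessian (model₃ I₁ I₂ I₃) nabla F (x, y, z) _ _ := hw
  rw [hF.mfderiv_slice₂, hF.mfderiv_slice₂, hF.mfderiv_slice₁]
  set k : ℝ := inner ℝ
    (mfderiv (model₃ I₁ I₂ I₃) I F (x, y, z) (incl₂ I₁ I₂ I₃ (x, y, z) b))
    (mfderiv (model₃ I₁ I₂ I₃) I F (x, y, z) (incl₂ I₁ I₂ I₃ (x, y, z) b')) with hk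
  set g := incl₁ I₁ I₂ I₃ (x, y, z) (riemGrad (fun x ↦ Real.log (f₁ x)) x) with hg
  have hgi (w') : (inner ℝ (mfderiv (model₃ I₁ I₂ I₃) I F (x, y, z) g)
      (mfderiv (model₃ I₁ I₂ I₃) I F (x, y, z) w') : ℝ) =
      mvfderiv I₁ (fun x ↦ Real.log (f₁ x)) x (dpr₁ I₁ I₂ I₃ (x, y, z) w') :=
    hF.inner_mfderiv_riemGrad (p := (x, y, z)) _ w'
  have hin := hF.eq_incl₂_of_inner_eq_zero (u := w + k • g) fun w' h' ↦ by
    rw [map_add, map_smul, hw', inner_add_left, real_inner_smul_left, hgi,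
      hF.inner_mapHessian₂₂ hnabla hb hb' h', ← hk]
    ring
  refine secondFF_eq_of_mapHessian (w := dpr₂ I₁ I₂ I₃ (x, y, z) (w + k • g)) ?_ fun b₀ ↦ ?_
  · rw [hF.mfderiv_slice₂]
    refine hB.trans (hw'.symm.trans ?_)
    rw [← hin, map_add, map_smul]
    module
  · rw [hF.mfderiv_slice₂]
    refine (real_inner_smul_left _ _ _).trans ?_
    rw [inner_neg_left]
    have := hF.inner_eq_zero₁₂ (u := g) (incl₁_mem _) (incl₂_mem b₀)
    simp [this]

theorem secondFF_slice₃
    (h : ∀ u ∈ dist₃ I₁ I₂ I₃ (x, y, z), ∀ v ∈ dist₃ I₁ I₂ I₃ (x, y, z),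
      secondFF (model₃ I₁ I₂ I₃) nabla F (x, y, z) u v = 0) (c c' : TangentSpace I₃ z) :
    secondFF I₃ nabla (fun z ↦ F (x, y, z)) z c c' =
      (inner ℝ (mfderiv I₃ I (fun z ↦ F (x, y, z)) z c)
        (mfderiv I₃ I (fun z ↦ F (x, y, z)) z c') : ℝ) •
      -mfderiv I₁ I (fun x ↦ F (x, y, z)) x (riemGrad (fun x ↦ Real.log (f₂ x)) x) := by
  have hc := incl₃_mem (I₁ := I₁) (I₂ := I₂) (I₃ := I₃) (p := (x, y, z)) c
  have hc' := incl₃_mem (I₁ := I₁) (I₂ := I₂) (I₃ := I₃) (p := (x, y, z)) c'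
  have hB := mapHessian_comp nabla hF.smooth contMDiff_slice₃ c c' (mfderiv_slice₃_extend
    (I₁ := I₁) (I₂ := I₂) (I₃ := I₃) (x := x) (y := y) c')
  rw [_root_.mfderiv_slice₃, _root_.mfderiv_slice₃] at hB
  obtain ⟨w, hw⟩ := Submodule.starProjection_eq_self_iff.1 (sub_eq_zero.1 (h _ hc _ hc')).symm
  have hw' : mfderiv (model₃ I₁ I₂ I₃) I F (x, y, z) w =
      mapHessian (model₃ I₁ I₂ I₃) nabla F (x, y, z) _ _ := hw
  rw [hF.mfderiv_slice₃, hF.mfderiv_slice₃, hF.mfderiv_slice₁]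
  set k : ℝ := inner ℝ
    (mfderiv (model₃ I₁ I₂ I₃) I F (x, y, z) (incl₃ I₁ I₂ I₃ (x, y, z) c))
    (mfderiv (model₃ I₁ I₂ I₃) I F (x, y, z) (incl₃ I₁ I₂ I₃ (x, y, z) c')) with hk
  set g := incl₁ I₁ I₂ I₃ (x, y, z) (riemGrad (fun x ↦ Real.log (f₂ x)) x) with hg
  have hgi (w') : (inner ℝ (mfderiv (model₃ I₁ I₂ I₃) I F (x, y, z) g)
      (mfderiv (model₃ I₁ I₂ I₃) I F (x, y, z) w') : ℝ) =
      mvfderiv I₁ (fun x ↦ Real.log (f₂ x)) x (dpr₁ I₁ I₂ I₃ (x, y, z) w') :=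
    hF.inner_mfderiv_riemGrad (p := (x, y, z)) _ w'
  have hin := hF.eq_incl₃_of_inner_eq_zero (u := w + k • g) fun w' h' ↦ by
    rw [map_add, map_smul, hw', inner_add_left, real_inner_smul_left, hgi,
      hF.inner_mapHessian₃₃ hnabla hc hc' h', ← hk]
    ring
  refine secondFF_eq_of_mapHessian (w := dpr₃ I₁ I₂ I₃ (x, y, z) (w + k • g)) ?_ fun c₀ ↦ ?_
  · rw [hF.mfderiv_slice₃]
    refine hB.trans (hw'.symm.trans ?_)
    rw [← hin, map_add, map_smul]
    module
  · rw [hF.mfderiv_slice₃]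
    refine (real_inner_smul_left _ _ _).trans ?_
    rw [inner_neg_left]
    have := hF.inner_eq_zero₁₃ (u := g) (incl₁_mem _) (incl₃_mem c₀)
    simp [this]

theorem isTotallyUmbilical_slice₂ (hdim : 0 < Module.finrank ℝ E₂)
    (h : ∀ y, ∀ u ∈ dist₂ I₁ I₂ I₃ (x, y, z), ∀ v ∈ dist₂ I₁ I₂ I₃ (x, y, z),
      secondFF (model₃ I₁ I₂ I₃) nabla F (x, y, z) u v = 0) :
    IsTotallyUmbilical I₂ nabla (fun y ↦ F (x, y, z)) ∧
      ∀ y, meanCurvature I₂ nabla (fun y ↦ F (x, y, z)) y =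
        -mfderiv I₁ I (fun x ↦ F (x, y, z)) x (riemGrad (fun x ↦ Real.log (f₁ x)) x) := by
  have hfin (y) :
      Module.finrank ℝ (immTangent (I := I) I₂ (fun y ↦ F (x, y, z)) y) ≠ 0 := by
    rw [hF.finrank_immTangent_slice₂]
    exact hdim.ne'
  have hmean (y) : meanCurvature I₂ nabla (fun y ↦ F (x, y, z)) y =
      -mfderiv I₁ I (fun x ↦ F (x, y, z)) x (riemGrad (fun x ↦ Real.log (f₁ x)) x) :=
    meanCurvature_eq_of_secondFF (G := fun y ↦ F (x, y, z)) (hfin y)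
      (hF.secondFF_slice₂ hnabla (h y))
  refine ⟨fun y u v ↦ ?_, hmean⟩
  rw [hmean y]
  exact hF.secondFF_slice₂ hnabla (h y) u v

theorem isTotallyUmbilical_slice₃ (hdim : 0 < Module.finrank ℝ E₃)
    (h : ∀ z, ∀ u ∈ dist₃ I₁ I₂ I₃ (x, y, z), ∀ v ∈ dist₃ I₁ I₂ I₃ (x, y, z),
      secondFF (model₃ I₁ I₂ I₃) nabla F (x, y, z) u v = 0) :
    IsTotallyUmbilical I₃ nabla (fun z ↦ F (x, y, z)) ∧
      ∀ z, meanCurvature I₃ nabla (fun z ↦ F (x, y, z)) z =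
        -mfderiv I₁ I (fun x ↦ F (x, y, z)) x (riemGrad (fun x ↦ Real.log (f₂ x)) x) := by
  have hfin (z) :
      Module.finrank ℝ (immTangent (I := I) I₃ (fun z ↦ F (x, y, z)) z) ≠ 0 := by
    rw [hF.finrank_immTangent_slice₃]
    exact hdim.ne'
  have hmean (z) : meanCurvature I₃ nabla (fun z ↦ F (x, y, z)) z =
      -mfderiv I₁ I (fun x ↦ F (x, y, z)) x (riemGrad (fun x ↦ Real.log (f₂ x)) x) :=
    meanCurvature_eq_of_secondFF (G := fun z ↦ F (x, y, z)) (hfin z)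
      (hF.secondFF_slice₃ hnabla (h z))
  refine ⟨fun z u v ↦ ?_, hmean⟩
  rw [hmean z]
  exact hF.secondFF_slice₃ hnabla (h z) u v

end IsBiWarpedImmersion

end SliceGeometry

end

theorem theorem4p2
    -- the ambient manifold
    {E : Type*} [NormedAddCommGroup E] [NormedSpace ℝ E] [FiniteDimensional ℝ E]
    {M : Type*} [TopologicalSpace M] [ChartedSpace E M] [IsManifold 𝓘(ℝ, E) ∞ M]
    [RiemannianBundle (fun x : M ↦ TangentSpace 𝓘(ℝ, E) x)]
    [IsContMDiffRiemannianBundle 𝓘(ℝ, E) ∞ E (fun x : M ↦ TangentSpace 𝓘(ℝ, E) x)]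
    (nabla : CovariantDerivative 𝓘(ℝ, E) E (TangentSpace 𝓘(ℝ, E) : M → Type _))
    (hnabla : IsLeviCivita nabla)
    (Phi : ∀ x : M, TangentSpace 𝓘(ℝ, E) x →L[ℝ] TangentSpace 𝓘(ℝ, E) x)
    (xi : ∀ x : M, TangentSpace 𝓘(ℝ, E) x)
    (eta : ∀ x : M, TangentSpace 𝓘(ℝ, E) x →L[ℝ] ℝ) (beta : M → ℝ)
    (hM : IsLocConfAlmostCosymplectic nabla Phi xi eta beta)
    -- the three factors: `LT` invariant, `LP` anti-invariant, `LN` slant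
    {ET : Type*} [NormedAddCommGroup ET] [NormedSpace ℝ ET] [FiniteDimensional ℝ ET]
    {LT : Type*} [TopologicalSpace LT] [ChartedSpace ET LT] [IsManifold 𝓘(ℝ, ET) ∞ LT]
    [RiemannianBundle (fun x : LT ↦ TangentSpace 𝓘(ℝ, ET) x)]
    [IsContMDiffRiemannianBundle 𝓘(ℝ, ET) ∞ ET (fun x : LT ↦ TangentSpace 𝓘(ℝ, ET) x)]
    {EP : Type*} [NormedAddCommGroup EP] [NormedSpace ℝ EP] [FiniteDimensional ℝ EP]
    {LP : Type*} [TopologicalSpace LP] [ChartedSpace EP LP] [IsManifold 𝓘(ℝ, EP) ∞ LP]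
    [RiemannianBundle (fun x : LP ↦ TangentSpace 𝓘(ℝ, EP) x)]
    [IsContMDiffRiemannianBundle 𝓘(ℝ, EP) ∞ EP (fun x : LP ↦ TangentSpace 𝓘(ℝ, EP) x)]
    {EN : Type*} [NormedAddCommGroup EN] [NormedSpace ℝ EN] [FiniteDimensional ℝ EN]
    {LN : Type*} [TopologicalSpace LN] [ChartedSpace EN LN] [IsManifold 𝓘(ℝ, EN) ∞ LN]
    [RiemannianBundle (fun x : LN ↦ TangentSpace 𝓘(ℝ, EN) x)]
    [IsContMDiffRiemannianBundle 𝓘(ℝ, EN) ∞ EN (fun x : LN ↦ TangentSpace 𝓘(ℝ, EN) x)]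
    (t₂ t₃ : ℕ) (ht₂ : 0 < t₂) (ht₃ : 0 < t₃)
    (hdimP : Module.finrank ℝ EP = t₂) (hdimN : Module.finrank ℝ EN = 2 * t₃)
    -- the bi-warped product submanifold
    (phi₁ phi₂ : LT → ℝ) (F : LT × LP × LN → M)
    (hF : IsBiWarpedImmersion 𝓘(ℝ, ET) 𝓘(ℝ, EP) 𝓘(ℝ, EN) 𝓘(ℝ, E) phi₁ phi₂ F)
    (hinv : IsInvariant₁ 𝓘(ℝ, ET) 𝓘(ℝ, EP) 𝓘(ℝ, EN) 𝓘(ℝ, E) Phi F)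
    (hxi : IsTangent₁ 𝓘(ℝ, ET) 𝓘(ℝ, EP) 𝓘(ℝ, EN) 𝓘(ℝ, E) xi F)
    (hanti : IsAntiInvariant₂ 𝓘(ℝ, ET) 𝓘(ℝ, EP) 𝓘(ℝ, EN) 𝓘(ℝ, E) Phi F)
    (nu : ℝ) (hnu₀ : 0 < nu) (hnu₁ : nu < Real.pi / 2)
    (hslant : IsSlant₃ 𝓘(ℝ, ET) 𝓘(ℝ, EP) 𝓘(ℝ, EN) 𝓘(ℝ, E) Phi nu F)
    -- mixed totally geodesic
    (hmixed : ∀ (p : LT × LP × LN), ∀ u ∈ dist₂ 𝓘(ℝ, ET) 𝓘(ℝ, EP) 𝓘(ℝ, EN) p,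
      ∀ v ∈ dist₃ 𝓘(ℝ, ET) 𝓘(ℝ, EP) 𝓘(ℝ, EN) p,
      secondFF (model₃ 𝓘(ℝ, ET) 𝓘(ℝ, EP) 𝓘(ℝ, EN)) nabla F p u v = 0) :
    (∀ p : LT × LP × LN,
      secondFFNormSq (model₃ 𝓘(ℝ, ET) 𝓘(ℝ, EP) 𝓘(ℝ, EN)) nabla F p ≥
        2 * t₂ * (‖riemGrad (I := 𝓘(ℝ, ET)) (fun x ↦ Real.log (phi₁ x)) p.1‖ ^ 2
            - beta (F p) ^ 2)
        + 4 * t₃ * (1 / Real.sin nu) ^ 2 * (Real.sin nu ^ 2 + 2 * Real.cos nu ^ 2)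
          * (‖riemGrad (I := 𝓘(ℝ, ET)) (fun x ↦ Real.log (phi₂ x)) p.1‖ ^ 2
            - beta (F p) ^ 2)) ∧
    ((∀ p : LT × LP × LN,
      secondFFNormSq (model₃ 𝓘(ℝ, ET) 𝓘(ℝ, EP) 𝓘(ℝ, EN)) nabla F p =
        2 * t₂ * (‖riemGrad (I := 𝓘(ℝ, ET)) (fun x ↦ Real.log (phi₁ x)) p.1‖ ^ 2
            - beta (F p) ^ 2)
        + 4 * t₃ * (1 / Real.sin nu) ^ 2 * (Real.sin nu ^ 2 + 2 * Real.cos nu ^ 2)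
          * (‖riemGrad (I := 𝓘(ℝ, ET)) (fun x ↦ Real.log (phi₂ x)) p.1‖ ^ 2
            - beta (F p) ^ 2)) →
      (∀ (y : LP) (z : LN), IsTotallyGeodesic 𝓘(ℝ, ET) nabla (fun x : LT ↦ F (x, y, z))) ∧
      (∀ (x : LT) (z : LN), IsTotallyUmbilical 𝓘(ℝ, EP) nabla (fun y : LP ↦ F (x, y, z)) ∧
        ∀ y : LP, meanCurvature 𝓘(ℝ, EP) nabla (fun y' : LP ↦ F (x, y', z)) y =
          -(mfderiv 𝓘(ℝ, ET) 𝓘(ℝ, E) (fun x' : LT ↦ F (x', y, z)) x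
            (riemGrad (I := 𝓘(ℝ, ET)) (fun x' ↦ Real.log (phi₁ x')) x))) ∧
      (∀ (x : LT) (y : LP), IsTotallyUmbilical 𝓘(ℝ, EN) nabla (fun z : LN ↦ F (x, y, z)) ∧
        ∀ z : LN, meanCurvature 𝓘(ℝ, EN) nabla (fun z' : LN ↦ F (x, y, z')) z =
          -(mfderiv 𝓘(ℝ, ET) 𝓘(ℝ, E) (fun x' : LT ↦ F (x', y, z)) x
            (riemGrad (I := 𝓘(ℝ, ET)) (fun x' ↦ Real.log (phi₂ x')) x)))) := by 
  have hd₂ : 0 < Module.finrank ℝ EP := hdimP ▸ ht₂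
  have hd₃ : 0 < Module.finrank ℝ EN := by omega
  have main (p : LT × LP × LN) := hF.secondFFNormSq_ge hnabla hM hxi hinv hanti hnu₀ hnu₁ hslant
    (hmixed p) hd₂ hd₃
  have hcast : (2 * (Module.finrank ℝ EN : ℝ)) = 4 * t₃ := by
    rw [hdimN]; push_cast; ring
  refine ⟨fun p ↦ ?_, fun heq ↦ ?_⟩
  · obtain ⟨S₁, S₂, S₃, h₁, h₂, h₃, -, -, -, h⟩ := main p
    rw [hcast, hdimP] at h
    linarith
  have hzero (p : LT × LP × LN) :
      (∀ u ∈ dist₁ 𝓘(ℝ, ET) 𝓘(ℝ, EP) 𝓘(ℝ, EN) p, ∀ v ∈ dist₁ 𝓘(ℝ, ET) 𝓘(ℝ, EP) 𝓘(ℝ, EN) p,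
        secondFF (model₃ 𝓘(ℝ, ET) 𝓘(ℝ, EP) 𝓘(ℝ, EN)) nabla F p u v = 0) ∧
      (∀ u ∈ dist₂ 𝓘(ℝ, ET) 𝓘(ℝ, EP) 𝓘(ℝ, EN) p, ∀ v ∈ dist₂ 𝓘(ℝ, ET) 𝓘(ℝ, EP) 𝓘(ℝ, EN) p,
        secondFF (model₃ 𝓘(ℝ, ET) 𝓘(ℝ, EP) 𝓘(ℝ, EN)) nabla F p u v = 0) ∧
      (∀ u ∈ dist₃ 𝓘(ℝ, ET) 𝓘(ℝ, EP) 𝓘(ℝ, EN) p, ∀ v ∈ dist₃ 𝓘(ℝ, ET) 𝓘(ℝ, EP) 𝓘(ℝ, EN) p,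
        secondFF (model₃ 𝓘(ℝ, ET) 𝓘(ℝ, EP) 𝓘(ℝ, EN)) nabla F p u v = 0) := by
    obtain ⟨S₁, S₂, S₃, h₁, h₂, h₃, z₁, z₂, z₃, h⟩ := main p
    rw [hcast, hdimP, heq p] at h
    exact ⟨z₁ (by linarith), z₂ (by linarith), z₃ (by linarith)⟩
  exact ⟨fun y z x ↦ hF.secondFF_slice₁_eq_zero hnabla (hzero (x, y, z)).1,
    fun x z ↦ hF.isTotallyUmbilical_slice₂ hnabla hd₂ fun y ↦ (hzero (x, y, z)).2.1,
    fun x y ↦ hF.isTotallyUmbilical_slice₃ hnabla hd₃ fun z ↦ (hzero (x, y, z)).2.2⟩
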